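/- Let $d,n_1,n_2$ be natural numbers, let $A^i=\begin{pmatrix}0&A^i_{1,2}\\A^i_{2,1}&A^i_{2,2}\end{pmatrix}$ $(i=1,\dots,d)$ be real symmetric $(n_1+n_2)\times(n_1+n_2)$ matrices, let $D$ be a real symmetric positive definite $n_2\times n_2$ matrix, and put $L=\begin{pmatrix}0&0\\0&D\end{pmatrix}$. Assume the Shizuta–Kawashima condition [SK]: if $\phi\in\mathbb{R}^{n_1+n_2}$, $L\phi=0$ and $\mu\phi+\sum_i\omega_iA^i\phi=0$ for some $\mu\in\mathbb{R}$ and $\omega\in\mathbb{R}^d$ with $|\omega|=1$, then $\phi=0$. Let $1<p<\infty$, $0<a_1<a_2<\infty$ and $\mathcal{C}=\{\xi\in\mathbb{R}^d: a_1<|\xi|<a_2\}$. The $L^p$ norm of a vector-valued function is the sum of the $L^p$ norms of its components, and the Fourier transform is taken with respect to $e^{-\mathrm{i}x\cdot\xi}$. Then there are constants $\lambda_0,C_1,R_1,\kappa_1>0$, depending only on the matrices $A^i$, $D$, on $p$ and on $a_1,a_2$ (and on $d,n_1,n_2$), such that the following holds for all $\lambda\in(0,\lambda_0)$. Let $V^\lambda=(V_1^\lambda,V_2^\lambda)\in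 C([0,\infty);L^p(\mathbb{R}^d))$, with components real or complex valued, be a solution in the sense of tempered distributions of $$\partial_tV+\sum_{i=1}^dA^i\partial_{x_i}V+LV=0,\qquad V|_{t=0}=V_0^\lambda=(V_{1,0}^\lambda,V_{2,0}^\lambda),$$ such that the Fourier transforms of $V_0^\lambda$ and of $V^\lambda(t)$, $t\ge0$, are supported in $\lambda\mathcal{C}$. Then for all $t\ge0$: (i) $$\|V^\lambda(t)\|_{L^p}\le C_1e^{-R_1\lambda^2t}\|V_0^\lambda\|_{L^p},$$ $$\|V_1^\lambda(t)\|_{L^p}\le C_1e^{-R_1\lambda^2t}\big(\|V_{1,0}^\lambda\|_{L^p}+\lambda\|V_{2,0}^\lambda\|_{L^p}\big)+C_1e^{-\kappa_1t}\big(\lambda^2\|V_{1,0}^\lambda\|_{L^p}+\lambda\|V_{2,0}^\lambda\|_{L^p}\big),$$ $$\|V_2^\lambda(t)\|_{L^p}\le C_1\lambda e^{-R_1\lambda^2t}\big(\|V_{1,0}^\lambda\|_{L^p}+\lambda\|V_{2,0}^\lambda\|_{L^p}\big)+C_1e^{-\kappa_1t}\big(\lambda\|V_{1,0}^\lambda\|_{L^p}+\|V_{2,0}^\lambda\|_{L^p}\big).$$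 (ii) Let $\mathcal{A}=\sum_{i,l=1}^dA^i_{1,2}D^{-1}A^l_{2,1}\partial^2_{x_ix_l}$, let $e^{t\mathcal{A}}$ be the Fourier multiplier with symbol $\exp\big(-t\sum_{i,l}A^i_{1,2}D^{-1}A^l_{2,1}\xi_i\xi_l\big)$, and let $$\Psi_0^\lambda=V_{1,0}^\lambda-\sum_{i=1}^dA^i_{1,2}D^{-1}\partial_{x_i}V_{2,0}^\lambda,\qquad V_{1,*}^\lambda=e^{t\mathcal{A}}\Psi_0^\lambda,\qquad V_{2,*}^\lambda=-\sum_{i=1}^dD^{-1}A^i_{2,1}\partial_{x_i}e^{t\mathcal{A}}\Psi_0^\lambda.$$ Then $V_1^\lambda-V_{1,*}^\lambda$ and $V_2^\lambda-V_{2,*}^\lambda$ belong to $L^p$ at each time $t\ge0$, and $$\|(V_1^\lambda-V_{1,*}^\lambda)(t)\|_{L^p}\le C_1\lambda e^{-R_1\lambda^2t}\big(\|V_{1,0}^\lambda\|_{L^p}+\lambda\|V_{2,0}^\lambda\|_{L^p}\big)+C_1e^{-\kappa_1t}\big(\lambda^2\|V_{1,0}^\lambda\|_{L^p}+\lambda\|V_{2,0}^\lambda\|_{L^p}\big),$$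 $$\|(V_2^\lambda-V_{2,*}^\lambda)(t)\|_{L^p}\le C_1\lambda^2e^{-R_1\lambda^2t}\big(\|V_{1,0}^\lambda\|_{L^p}+\lambda\|V_{2,0}^\lambda\|_{L^p}\big)+C_1e^{-\kappa_1t}\big(\lambda\|V_{1,0}^\lambda\|_{L^p}+\|V_{2,0}^\lambda\|_{L^p}\big).$$ -/

import Mathlib

open MeasureTheory Matrix
open scoped SchwartzMap LineDeriv FourierTransform ENNReal

noncomputable section

namespace PartialDissipation

/-- The relaxation matrix `L = [[0, 0], [0, D]]`. -/
def relaxation {n₁ n₂ : ℕ} (D : Matrix (Fin n₂) (Fin n₂) ℝ) :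
    Matrix (Fin n₁ ⊕ Fin n₂) (Fin n₁ ⊕ Fin n₂) ℝ :=
  Matrix.fromBlocks 0 0 0 D

/-- The Shizuta-Kawashima stability condition for `∂ₜV + ∑ᵢ Aⁱ ∂ᵢV + L V = 0`: no nonzero vector of
`ker L` solves `μ φ + A(ω) φ = 0` with `μ` real and `|ω| = 1`, where `A(ω) = ∑ᵢ ωᵢ Aⁱ`. -/
def SKCondition {d : ℕ} {ι : Type*} [Fintype ι] (A : Fin d → Matrix ι ι ℝ)
    (L : Matrix ι ι ℝ) : Prop :=
  ∀ (φ : ι → ℝ) (μ : ℝ) (ω : EuclideanSpace ℝ (Fin d)), L *ᵥ φ = 0 → ‖ω‖ = 1 →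
    μ • φ + (∑ i, ω i • A i) *ᵥ φ = 0 → φ = 0

/-- The constant coefficients: `Aⁱ` symmetric with vanishing upper left block, `D` symmetric
positive definite, and the Shizuta-Kawashima condition. -/
structure IsAdmissible {d n₁ n₂ : ℕ}
    (A : Fin d → Matrix (Fin n₁ ⊕ Fin n₂) (Fin n₁ ⊕ Fin n₂) ℝ)
    (D : Matrix (Fin n₂) (Fin n₂) ℝ) : Prop where
  symm : ∀ i, (A i).IsSymm
  block₁₁ : ∀ i, (A i).toBlocks₁₁ = 0
  posDef : D.PosDef
  sk : SKCondition A (relaxation D)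

/-- The partial derivative `∂_{x_i}` of a tempered distribution on `ℝᵈ`. -/
def partialD {d : ℕ} (i : Fin d) (T : 𝓢'(EuclideanSpace ℝ (Fin d), ℂ)) :
    𝓢'(EuclideanSpace ℝ (Fin d), ℂ) :=
  ∂_{EuclideanSpace.single i (1 : ℝ)} T

/-- A real constant matrix acting on a vector of tempered distributions. -/
def matAct {d : ℕ} {ι κ : Type*} [Fintype κ] (M : Matrix ι κ ℝ)
    (T : κ → 𝓢'(EuclideanSpace ℝ (Fin d), ℂ)) : ι → 𝓢'(EuclideanSpace ℝ (Fin d), ℂ) :=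
  fun j => ∑ k, (M j k : ℂ) • T k

/-- The vector of tempered distributions defined by a vector of `L^p` functions. -/
def toTD {d : ℕ} {ι : Type*} {p : ℝ≥0∞} [Fact (1 ≤ p)]
    (v : ι → Lp ℂ p (volume : Measure (EuclideanSpace ℝ (Fin d)))) :
    ι → 𝓢'(EuclideanSpace ℝ (Fin d), ℂ) :=
  fun j => Lp.toTemperedDistribution (v j)

/-- `V ∈ C([0,∞); L^p)` solves `∂ₜV + ∑ᵢ Aⁱ ∂ᵢV + L V = 0` for `t > 0` in the sense of tempered
distributions. The components may be complex valued; real valued ones are a special case.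
The initial datum is `V 0`, and the values `V t` for `t < 0` play no role. -/
structure IsGlobalSolution {d : ℕ} {ι : Type*} [Fintype ι] {p : ℝ≥0∞} [Fact (1 ≤ p)]
    (A : Fin d → Matrix ι ι ℝ) (L : Matrix ι ι ℝ)
    (V : ℝ → ι → Lp ℂ p (volume : Measure (EuclideanSpace ℝ (Fin d)))) : Prop where
  continuousOn : ContinuousOn V (Set.Ici 0)
  hasDerivAt : ∀ (φ : 𝓢(EuclideanSpace ℝ (Fin d), ℂ)) (k : ι) (t : ℝ), 0 < t →
    HasDerivAt (fun s => toTD (V s) k φ)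
      (-(∑ i, matAct (A i) (fun j => partialD i (toTD (V t) j)) k φ)
        - matAct L (toTD (V t)) k φ) t

/-- The dilated annulus `lam 𝓒`, `𝓒 = {a₁ < |ξ| < a₂}`, in the angular frequency `2πξ`, where `ξ`
is the variable of the Fourier transform `∫ exp(-2πi x·ξ) f(x) dx`. -/
def dilatedAnnulus (d : ℕ) (a₁ a₂ lam : ℝ) : Set (EuclideanSpace ℝ (Fin d)) :=
  {ξ | lam * a₁ < 2 * Real.pi * ‖ξ‖ ∧ 2 * Real.pi * ‖ξ‖ < lam * a₂}

/-- The (distributional) Fourier transforms of all components are supported in `S`. -/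
def FourierSupportedIn {d : ℕ} {ι : Type*} (T : ι → 𝓢'(EuclideanSpace ℝ (Fin d), ℂ))
    (S : Set (EuclideanSpace ℝ (Fin d))) : Prop :=
  ∀ j, Distribution.dsupport (𝓕 (T j) : 𝓢'(EuclideanSpace ℝ (Fin d), ℂ)) ⊆ S

/-- The symbol `-∑_{i,l} A₁₂ⁱ D⁻¹ A₂₁ˡ (2πξᵢ)(2πξₗ)` of
`𝒜 = ∑_{i,l} A₁₂ⁱ D⁻¹ A₂₁ˡ ∂ᵢ∂ₗ`. -/
def diffusionSymbol {d n₁ n₂ : ℕ}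
    (A : Fin d → Matrix (Fin n₁ ⊕ Fin n₂) (Fin n₁ ⊕ Fin n₂) ℝ)
    (D : Matrix (Fin n₂) (Fin n₂) ℝ) (ξ : EuclideanSpace ℝ (Fin d)) :
    Matrix (Fin n₁) (Fin n₁) ℝ :=
  -∑ i, ∑ l, ((2 * Real.pi * ξ i) * (2 * Real.pi * ξ l)) •
    ((A i).toBlocks₁₂ * D⁻¹ * (A l).toBlocks₂₁)

/-- The semigroup `e^{t𝒜}`: the Fourier multiplier whose symbol is the matrix exponential of
`t` times the symbol of `𝒜`. -/
def diffusionSemigroup {d n₁ n₂ : ℕ}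
    (A : Fin d → Matrix (Fin n₁ ⊕ Fin n₂) (Fin n₁ ⊕ Fin n₂) ℝ)
    (D : Matrix (Fin n₂) (Fin n₂) ℝ) (t : ℝ)
    (T : Fin n₁ → 𝓢'(EuclideanSpace ℝ (Fin d), ℂ)) :
    Fin n₁ → 𝓢'(EuclideanSpace ℝ (Fin d), ℂ) :=
  fun j => ∑ k, TemperedDistribution.fourierMultiplierCLM ℂ
    (fun ξ => ((NormedSpace.exp (t • diffusionSymbol A D ξ) j k : ℝ) : ℂ)) (T k)

/-- `Ψ₀ = V_{1,0} - ∑ᵢ A₁₂ⁱ D⁻¹ ∂ᵢ V_{2,0}`. -/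
def effectiveDatum {d n₁ n₂ : ℕ}
    (A : Fin d → Matrix (Fin n₁ ⊕ Fin n₂) (Fin n₁ ⊕ Fin n₂) ℝ)
    (D : Matrix (Fin n₂) (Fin n₂) ℝ)
    (V₀ : Fin n₁ ⊕ Fin n₂ → 𝓢'(EuclideanSpace ℝ (Fin d), ℂ)) :
    Fin n₁ → 𝓢'(EuclideanSpace ℝ (Fin d), ℂ) :=
  fun j => V₀ (Sum.inl j) -
    ∑ i, matAct ((A i).toBlocks₁₂ * D⁻¹) (fun k => partialD i (V₀ (Sum.inr k))) j

/-- `V_{1,*}(t) = e^{t𝒜} Ψ₀`. -/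
def profile₁ {d n₁ n₂ : ℕ}
    (A : Fin d → Matrix (Fin n₁ ⊕ Fin n₂) (Fin n₁ ⊕ Fin n₂) ℝ)
    (D : Matrix (Fin n₂) (Fin n₂) ℝ)
    (V₀ : Fin n₁ ⊕ Fin n₂ → 𝓢'(EuclideanSpace ℝ (Fin d), ℂ)) (t : ℝ) :
    Fin n₁ → 𝓢'(EuclideanSpace ℝ (Fin d), ℂ) :=
  diffusionSemigroup A D t (effectiveDatum A D V₀)

/-- `V_{2,*}(t) = -∑ᵢ D⁻¹ A₂₁ⁱ ∂ᵢ e^{t𝒜} Ψ₀`. -/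
def profile₂ {d n₁ n₂ : ℕ}
    (A : Fin d → Matrix (Fin n₁ ⊕ Fin n₂) (Fin n₁ ⊕ Fin n₂) ℝ)
    (D : Matrix (Fin n₂) (Fin n₂) ℝ)
    (V₀ : Fin n₁ ⊕ Fin n₂ → 𝓢'(EuclideanSpace ℝ (Fin d), ℂ)) (t : ℝ) :
    Fin n₂ → 𝓢'(EuclideanSpace ℝ (Fin d), ℂ) :=
  fun j => -∑ i, matAct (D⁻¹ * (A i).toBlocks₂₁) (fun k => partialD i (profile₁ A D V₀ t k)) j

/-- The norm of a vector of `L^p` functions: the sum of the norms of its components. -/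
def vecNorm {d : ℕ} {ι : Type*} [Fintype ι] {p : ℝ≥0∞}
    (v : ι → Lp ℂ p (volume : Measure (EuclideanSpace ℝ (Fin d)))) : ℝ :=
  ∑ j, ‖v j‖

/-- The vector `T` of tempered distributions is a vector of `L^p` functions, and its `L^p` norm
is at most `B`. -/
def HasLpNormLE {d : ℕ} {ι : Type*} [Fintype ι] (p : ℝ≥0∞) [Fact (1 ≤ p)]
    (T : ι → 𝓢'(EuclideanSpace ℝ (Fin d), ℂ)) (B : ℝ) : Prop :=
  ∃ w : ι → Lp ℂ p (volume : Measure (EuclideanSpace ℝ (Fin d))),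
    toTD w = T ∧ vecNorm w ≤ B

end PartialDissipation

end

/-!
The idea is to rescale the frequency variable, so that solutions localised at frequency `λ` become
curves in a fixed kind of Banach space, on which the system is an ordinary differential equation
with bounded operators and a small parameter,
`V₁' = -λ b V₂`, `V₂' = -D V₂ - λ (c V₁ + e V₂)`.

*The abstract equation* (`exists_relaxation_estimates`). For small `λ` a linear change of unknowns,
whose coefficients solve an operator Riccati equation (`exists_riccati`, a fixed point argument;
`exists_decoupling`), decouples the equation into a slow mode, driven by `λ² b D⁻¹ c + O(λ³)`, and a
damped mode, driven by `-D + O(λ)`. If the semigroups of `b D⁻¹ c` and of `-D` decay exponentially,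
Duhamel's formula and Grönwall's inequality show that the two modes decay like `exp (-R λ² t)` and
`exp (-κ t)`, and compare the slow mode with `exp (λ² t b D⁻¹ c)`.

*The operators.* With `s = 2π / λ`, an `L^p` function whose spectrum lies in the dilated annulus is
fixed by the multiplier with symbol `ξ ↦ χ(s ξ)`, where `χ` is a cutoff equal to `1` on the annulus
(`convOp_eq_self`). On the closed subspace of such functions the entire functions `h` on `ℂᵈ` act by
the multipliers with symbol `ξ ↦ h(s ξ)` (`symHom`), and the norm of this operator is at most a
constant times the supremum of `|h|` on a complex neighbourhood of the support of `χ`, uniformly in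
`s` (`exists_kernel_of_bounded`). This follows from Cauchy's estimates, since the convolution kernel
of `χ h` is integrable. In particular no multiplier theorem is needed. Exponentials of matrices of
such multipliers have the expected symbols (`exp_smul_matOp`).

*Decay of the semigroups.* The symbol of `-b D⁻¹ c` at a real frequency `u` is the form
`y ↦ ⟨A₂₁(u) y, D⁻¹ A₂₁(u) y⟩`. By the Shizuta-Kawashima condition `A₂₁(u)` is injective for
`u ≠ 0`, so the form is bounded below by `c |u|² |y|²` by compactness (`exists_diffusion_coercive`),
and by perturbation this remains true up to the constant near the real annulus. The matrix
exponential of a dissipative matrix is bounded by `norm_exp_entry_le`.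

A solution in the sense of distributions satisfies the differential equation in the strong sense,
because the right hand side is a bounded operator applied to a continuous curve
(`hasDerivAt_of_weak`).
-/

noncomputable section

namespace PartialDissipation

/-! ### Perturbation of exponentials in a Banach algebra -/

/-- Grönwall's inequality in integral form. -/
lemma le_mul_exp_of_le_add_integral {w : ℝ → ℝ} (hw : Continuous w) {a b : ℝ} (hb : 0 ≤ b)
    (h : ∀ t, 0 ≤ t → w t ≤ a + b * ∫ s in (0 : ℝ)..t, w s) {t : ℝ} (ht : 0 ≤ t) :
    w t ≤ a * Real.exp (b * t) := by
  have hJ : ∀ s, HasDerivAt (fun u => ∫ x in (0 : ℝ)..u, w x) (w s) s := fun s =>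
    intervalIntegral.integral_hasDerivAt_right (hw.intervalIntegrable _ _)
      hw.aestronglyMeasurable.stronglyMeasurableAtFilter hw.continuousAt
  have hd : ∀ s, HasDerivAt (fun u => Real.exp (-(b * u)) * (a + b * ∫ x in (0 : ℝ)..u, w x))
      (Real.exp (-(b * s)) * b * (w s - (a + b * ∫ x in (0 : ℝ)..s, w x))) s := by
    intro s
    have h1 : HasDerivAt (fun u : ℝ => Real.exp (-(b * u))) (Real.exp (-(b * s)) * (-b)) s := by
      have := ((hasDerivAt_id s).const_mul b).neg.exp
      simpa using this
    have h2 := h1.mul (((hJ s).const_mul b).const_add a)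
    refine h2.congr_deriv ?_
    ring
  have hanti : AntitoneOn (fun u => Real.exp (-(b * u)) * (a + b * ∫ x in (0 : ℝ)..u, w x))
      (Set.Ici 0) := by
    apply antitoneOn_of_deriv_nonpos (convex_Ici 0)
    · exact fun s _ => (hd s).continuousAt.continuousWithinAt
    · exact fun s _ => (hd s).differentiableAt.differentiableWithinAt
    · intro s hs
      rw [interior_Ici] at hs
      rw [(hd s).deriv]
      apply mul_nonpos_of_nonneg_of_nonpos (by positivity)
      linarith [h s (le_of_lt hs)]
  have h0 := hanti (Set.mem_Ici.2 le_rfl) (Set.mem_Ici.2 ht) ht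
  simp only [mul_zero, neg_zero, Real.exp_zero, intervalIntegral.integral_same, add_zero,
    one_mul] at h0
  calc w t ≤ a + b * ∫ s in (0 : ℝ)..t, w s := h t ht
    _ = Real.exp (b * t) * (Real.exp (-(b * t)) * (a + b * ∫ s in (0 : ℝ)..t, w s)) := by
      rw [← mul_assoc, ← Real.exp_add]; simp
    _ ≤ Real.exp (b * t) * a := by gcongr
    _ = _ := mul_comm _ _

section Algebra

variable {𝔸 : Type*} [NormedRing 𝔸] [NormedAlgebra ℝ 𝔸] [CompleteSpace 𝔸]

lemma continuous_exp_smul (A : 𝔸) : Continuous fun t : ℝ => NormedSpace.exp (t • A) :=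
  continuous_iff_continuousAt.2 fun t => (hasDerivAt_exp_smul_const A t).continuousAt

/-- Duhamel's formula for a bounded perturbation. -/
lemma exp_smul_add_eq (A P : 𝔸) (t : ℝ) :
    NormedSpace.exp (t • (A + P)) = NormedSpace.exp (t • A) +
      ∫ s in (0 : ℝ)..t, NormedSpace.exp ((t - s) • A) * P * NormedSpace.exp (s • (A + P)) := by
  have hd : ∀ s : ℝ, HasDerivAt
      (fun s : ℝ => NormedSpace.exp ((t - s) • A) * NormedSpace.exp (s • (A + P)))
      (NormedSpace.exp ((t - s) • A) * P * NormedSpace.exp (s • (A + P))) s := by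
    intro s
    have h1 : HasDerivAt (fun s : ℝ => NormedSpace.exp ((t - s) • A))
        ((-1 : ℝ) • (NormedSpace.exp ((t - s) • A) * A)) s :=
      (hasDerivAt_exp_smul_const A (t - s)).scomp s ((hasDerivAt_id s).const_sub t)
    have h2 := h1.mul (hasDerivAt_exp_smul_const' (A + P) s)
    refine h2.congr_deriv ?_
    rw [neg_one_smul]
    noncomm_ring
  have hc : Continuous fun s : ℝ =>
      NormedSpace.exp ((t - s) • A) * P * NormedSpace.exp (s • (A + P)) :=
    (((continuous_exp_smul A).comp (continuous_const.sub continuous_id)).mul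
      continuous_const).mul (continuous_exp_smul (A + P))
  rw [intervalIntegral.integral_eq_sub_of_hasDerivAt (fun s _ => hd s)
    (hc.intervalIntegrable _ _)]
  simp

variable {A P : 𝔸} {M K κ : ℝ}

/-- Exponential decay survives a small bounded perturbation. -/
lemma norm_exp_smul_add_le (hM : 0 ≤ M) (hA : ∀ t : ℝ, 0 ≤ t →
    ‖NormedSpace.exp (t • A)‖ ≤ M * Real.exp (-(κ * t))) (hP : ‖P‖ ≤ K) {t : ℝ} (ht : 0 ≤ t) :
    ‖NormedSpace.exp (t • (A + P))‖ ≤ M * Real.exp (-((κ - M * K) * t)) := by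
  have hK : 0 ≤ K := (norm_nonneg _).trans hP
  have hc : Continuous fun s : ℝ => Real.exp (κ * s) * ‖NormedSpace.exp (s • (A + P))‖ := by
    have := (continuous_exp_smul (A + P)).norm
    fun_prop
  have key : ∀ t, 0 ≤ t → Real.exp (κ * t) * ‖NormedSpace.exp (t • (A + P))‖ ≤
      M + M * K * ∫ s in (0 : ℝ)..t, Real.exp (κ * s) * ‖NormedSpace.exp (s • (A + P))‖ := by
    intro t ht
    have hint : ‖∫ s in (0 : ℝ)..t,
        NormedSpace.exp ((t - s) • A) * P * NormedSpace.exp (s • (A + P))‖ ≤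
        ∫ s in (0 : ℝ)..t, Real.exp (-(κ * t)) * (M * K) *
          (Real.exp (κ * s) * ‖NormedSpace.exp (s • (A + P))‖) := by
      apply intervalIntegral.norm_integral_le_of_norm_le ht
      · refine Filter.Eventually.of_forall fun s hs => ?_
        calc _ ≤ ‖NormedSpace.exp ((t - s) • A)‖ * ‖P‖ * ‖NormedSpace.exp (s • (A + P))‖ :=
              (norm_mul_le _ _).trans (by gcongr; exact norm_mul_le _ _)
          _ ≤ (M * Real.exp (-(κ * (t - s)))) * K * ‖NormedSpace.exp (s • (A + P))‖ := by
              gcongr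
              exact hA _ (by linarith [hs.2])
          _ = _ := by
              rw [show -(κ * (t - s)) = -(κ * t) + κ * s by ring, Real.exp_add]; ring
      · exact (continuous_const.mul hc).intervalIntegrable _ _
    rw [intervalIntegral.integral_const_mul] at hint
    have h1 : ‖NormedSpace.exp (t • (A + P))‖ ≤ M * Real.exp (-(κ * t)) +
        Real.exp (-(κ * t)) * (M * K) *
          ∫ s in (0 : ℝ)..t, Real.exp (κ * s) * ‖NormedSpace.exp (s • (A + P))‖ := by
      rw [exp_smul_add_eq A P t]
      refine (norm_add_le _ _).trans (add_le_add (hA t ht) ?_)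
      exact hint
    calc _ ≤ Real.exp (κ * t) * (M * Real.exp (-(κ * t)) +
        Real.exp (-(κ * t)) * (M * K) *
          ∫ s in (0 : ℝ)..t, Real.exp (κ * s) * ‖NormedSpace.exp (s • (A + P))‖) := by gcongr
      _ = (Real.exp (κ * t) * Real.exp (-(κ * t))) * (M + M * K *
          ∫ s in (0 : ℝ)..t, Real.exp (κ * s) * ‖NormedSpace.exp (s • (A + P))‖) := by ring
      _ = _ := by rw [← Real.exp_add]; simp
  have h2 := le_mul_exp_of_le_add_integral hc (mul_nonneg hM hK) key ht
  calc ‖NormedSpace.exp (t • (A + P))‖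
      = Real.exp (-(κ * t)) * (Real.exp (κ * t) * ‖NormedSpace.exp (t • (A + P))‖) := by
        rw [← mul_assoc, ← Real.exp_add]; simp
    _ ≤ Real.exp (-(κ * t)) * (M * Real.exp (M * K * t)) := by gcongr
    _ = _ := by
        rw [show -((κ - M * K) * t) = -(κ * t) + M * K * t by ring, Real.exp_add]; ring

/-- The exponential of a perturbed generator is close to the unperturbed one. -/
lemma norm_exp_smul_add_sub_le (hM : 0 ≤ M) (hA : ∀ t : ℝ, 0 ≤ t →
    ‖NormedSpace.exp (t • A)‖ ≤ M * Real.exp (-(κ * t))) (hP : ‖P‖ ≤ K) {t : ℝ} (ht : 0 ≤ t) :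
    ‖NormedSpace.exp (t • (A + P)) - NormedSpace.exp (t • A)‖ ≤
      M * K * M * t * Real.exp (-((κ - M * K) * t)) := by
  have hK : 0 ≤ K := (norm_nonneg _).trans hP
  rw [exp_smul_add_eq A P t, add_sub_cancel_left]
  have := intervalIntegral.norm_integral_le_of_norm_le_const (a := (0 : ℝ)) (b := t)
    (C := M * K * M * Real.exp (-((κ - M * K) * t)))
    (f := fun s => NormedSpace.exp ((t - s) • A) * P * NormedSpace.exp (s • (A + P))) ?_
  · refine this.trans (le_of_eq ?_)
    rw [sub_zero, abs_of_nonneg ht]; ring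
  · intro s hs
    rw [Set.uIoc_of_le ht] at hs
    calc _ ≤ ‖NormedSpace.exp ((t - s) • A)‖ * ‖P‖ * ‖NormedSpace.exp (s • (A + P))‖ :=
          (norm_mul_le _ _).trans (by gcongr; exact norm_mul_le _ _)
      _ ≤ (M * Real.exp (-((κ - M * K) * (t - s)))) * K *
            (M * Real.exp (-((κ - M * K) * s))) := by
          gcongr
          · refine (hA _ (by linarith [hs.2])).trans ?_
            refine mul_le_mul_of_nonneg_left (Real.exp_le_exp.2 ?_) hM
            have h0 : 0 ≤ M * K * (t - s) := mul_nonneg (by positivity) (by linarith [hs.2])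
            nlinarith
          · exact norm_exp_smul_add_le hM hA hP hs.1.le
      _ = M * K * M * (Real.exp (-((κ - M * K) * (t - s))) *
            Real.exp (-((κ - M * K) * s))) := by ring
      _ = _ := by rw [← Real.exp_add]; ring_nf

end Algebra

/-! ### Block diagonalisation of a relaxation system in Banach spaces -/

/-- A continuous solution of the linear equation `y' = -G y` is given by the exponential. -/
lemma eq_exp_of_hasDerivAt {X : Type*} [NormedAddCommGroup X] [NormedSpace ℝ X] [CompleteSpace X]
    (G : X →L[ℝ] X) {y : ℝ → X} (hc : ContinuousOn y (Set.Ici 0))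
    (hd : ∀ t, 0 < t → HasDerivAt y (-(G (y t))) t) {t : ℝ} (ht : 0 ≤ t) :
    y t = NormedSpace.exp (t • (-G)) (y 0) := by
  let _ : NormedAlgebra ℚ (X →L[ℝ] X) := NormedAlgebra.restrictScalars ℚ ℝ _
  have h := intervalIntegral.integral_eq_sub_of_hasDerivAt_of_le (a := 0) (b := t) (f' := fun _
    => 0)
    (f := fun s : ℝ => NormedSpace.exp (s • G) (y s)) ht
    ((continuous_exp_smul G).continuousOn.clm_apply (hc.mono Set.Icc_subset_Ici_self))
    (fun s hs => by
      refine ((hasDerivAt_exp_smul_const G s).clm_apply (hd s hs.1)).congr_deriv ?_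
      simp [mul_apply_eq_comp]) (by simp)
  rw [intervalIntegral.integral_zero, zero_smul, NormedSpace.exp_zero] at h
  have hinv : NormedSpace.exp (t • (-G)) * NormedSpace.exp (t • G) = 1 := by
    rw [← NormedSpace.exp_add_of_commute]
    · simp
    · rw [smul_neg]
      exact (Commute.refl _).neg_left
  have h3 : (NormedSpace.exp (t • (-G)) * NormedSpace.exp (t • G) : X →L[ℝ] X) (y t) =
      NormedSpace.exp (t • (-G)) (y 0) :=
    congrArg (fun x => (NormedSpace.exp (t • (-G)) : X →L[ℝ] X) x) (sub_eq_zero.1 h.symm)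
  rwa [hinv] at h3

/-- A small perturbation of a constant map has a fixed point close to that constant. -/
lemma exists_fixedPoint_near {Z : Type*} [NormedAddCommGroup Z] [CompleteSpace Z] [NormedSpace ℝ Z]
    (z₀ : Z) (N : Z → Z) {ρ K lam : ℝ} (hz₀ : ‖z₀‖ + 1 ≤ ρ) (hlam : 0 ≤ lam) (hlamK : lam * K ≤
      1 / 2)
    (hN : ∀ z, ‖z‖ ≤ ρ → ‖N z‖ ≤ K)
    (hLip : ∀ z w, ‖z‖ ≤ ρ → ‖w‖ ≤ ρ → ‖N z - N w‖ ≤ K * ‖z - w‖) :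
    ∃ z, z = z₀ + lam • N z ∧ ‖z‖ ≤ ρ ∧ ‖z - z₀‖ ≤ lam * K := by
  have hmaps : Set.MapsTo (fun z => z₀ + lam • N z) (Metric.closedBall 0 ρ)
      (Metric.closedBall 0 ρ) := by
    intro z hz
    rw [mem_closedBall_zero_iff] at hz ⊢
    have h1 := hN z hz
    calc ‖z₀ + lam • N z‖ ≤ ‖z₀‖ + lam * ‖N z‖ := by
          refine (norm_add_le _ _).trans ?_
          rw [norm_smul, Real.norm_of_nonneg hlam]
      _ ≤ ‖z₀‖ + lam * K := by gcongr
      _ ≤ ρ := by linarith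
  have hcontr : ContractingWith (1 / 2) (hmaps.restrict _ _ _) := by
    refine ⟨by rw [← NNReal.coe_lt_coe]; norm_num, LipschitzWith.of_dist_le_mul ?_⟩
    rintro ⟨z, hz⟩ ⟨w, hw⟩
    rw [mem_closedBall_zero_iff] at hz hw
    simp only [Subtype.dist_eq, Set.MapsTo.val_restrict_apply, dist_eq_norm]
    rw [add_sub_add_left_eq_sub, ← smul_sub, norm_smul, Real.norm_of_nonneg hlam]
    calc lam * ‖N z - N w‖ ≤ lam * (K * ‖z - w‖) := by gcongr; exact hLip z w hz hw
      _ = (lam * K) * ‖z - w‖ := by ring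
      _ ≤ _ := by
        have : ((1 / 2 : NNReal) : ℝ) = 1 / 2 := by norm_num
        rw [this]; gcongr
  have hρ : 0 ≤ ρ := by linarith [norm_nonneg z₀]
  obtain ⟨z, hz, hfix, -⟩ := hcontr.exists_fixedPoint' Metric.isClosed_closedBall.isComplete hmaps
    (x := 0) (by simpa using hρ) (edist_ne_top _ _)
  rw [mem_closedBall_zero_iff] at hz
  refine ⟨z, hfix.symm, hz, ?_⟩
  have : z - z₀ = lam • N z := by
    conv_lhs => rw [← show z₀ + lam • N z = z from hfix]
    simp
  rw [this, norm_smul, Real.norm_of_nonneg hlam]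
  gcongr
  exact hN z hz

section Blocks

variable {X₁ X₂ : Type*} [NormedAddCommGroup X₁] [NormedSpace ℝ X₁]
  [NormedAddCommGroup X₂] [NormedSpace ℝ X₂]

open ContinuousLinearMap in
/-- The graph of `lam • σ` is the slow invariant subspace of the block operator
`[[0, lam b], [lam c, D + lam e]]`: `lam • σ` solves the associated Riccati equation. -/
lemma exists_riccati [CompleteSpace X₂] {b : X₂ →L[ℝ] X₁} {c : X₁ →L[ℝ] X₂} {e D Di : X₂ →L[ℝ]
    X₂} {M ρ lam : ℝ}
    (hb : ‖b‖ ≤ M) (hc : ‖c‖ ≤ M) (he : ‖e‖ ≤ M) (hDi : ‖Di‖ ≤ M) (hD : ∀ x, D (Di x) = x)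
    (hρ : ρ = M ^ 2 + 1) (hlam : 0 ≤ lam) (hlam1 : lam ≤ 1)
    (hlamK : lam * (2 * M ^ 2 * (1 + ρ) ^ 2) ≤ 1 / 2) :
    ∃ σ : X₁ →L[ℝ] X₂, (∀ x, D (σ x) = -c x - lam • e (σ x) + lam ^ 2 • σ (b (σ x))) ∧ ‖σ‖ ≤ ρ ∧
      ‖σ + Di ∘L c‖ ≤ lam * (2 * M ^ 2 * (1 + ρ) ^ 2) := by
  have hM : 0 ≤ M := (norm_nonneg _).trans hb
  have hρ0 : 0 ≤ ρ := by rw [hρ]; positivity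
  obtain ⟨σ, h1, h2, h3⟩ := exists_fixedPoint_near (-(Di ∘L c))
    (fun σ => Di ∘L (-(e ∘L σ) + lam • (σ ∘L b ∘L σ))) (ρ := ρ)
    (K := 2 * M ^ 2 * (1 + ρ) ^ 2) (lam := lam) (by
      rw [norm_neg, hρ]
      have : ‖Di ∘L c‖ ≤ M * M := (opNorm_comp_le _ _).trans (by gcongr)
      linarith)
    hlam hlamK (by
      intro z hz
      calc _ ≤ M * (M * ρ + 1 * (ρ * (M * ρ))) := by
            refine (opNorm_comp_le _ _).trans ?_
            gcongr
            refine (norm_add_le _ _).trans ?_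
            rw [norm_neg, norm_smul, Real.norm_of_nonneg hlam]
            gcongr
            · exact (opNorm_comp_le _ _).trans (by gcongr)
            · refine (opNorm_comp_le _ _).trans ?_
              gcongr
              exact (opNorm_comp_le _ _).trans (by gcongr)
        _ ≤ _ := by
          nlinarith [mul_nonneg (sq_nonneg M) hρ0, sq_nonneg M, mul_nonneg (sq_nonneg M)
            (sq_nonneg ρ)])
    (by
      intro z w hz hw
      have : Di ∘L (-(e ∘L z) + lam • (z ∘L b ∘L z)) - Di ∘L (-(e ∘L w) + lam • (w ∘L b ∘L w)) =
          Di ∘L (-(e ∘L (z - w)) + lam • (z ∘L b ∘L (z - w) + (z - w) ∘L b ∘L w)) := by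
        ext x
        simp only [_root_.add_apply, _root_.neg_apply, _root_.smul_apply,
          ContinuousLinearMap.comp_apply, map_add, map_neg, map_smul,
          _root_.sub_apply, map_sub]
        module
      rw [this]
      calc _ ≤ M * (M * ‖z - w‖ + 1 * (ρ * (M * ‖z - w‖) + ‖z - w‖ * (M * ρ))) := by
            refine (opNorm_comp_le _ _).trans ?_
            gcongr
            refine (norm_add_le _ _).trans ?_
            rw [norm_neg, norm_smul, Real.norm_of_nonneg hlam]
            gcongr
            · exact (opNorm_comp_le _ _).trans (by gcongr)
            · refine (norm_add_le _ _).trans ?_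
              gcongr
              · refine (opNorm_comp_le _ _).trans ?_
                gcongr
                exact (opNorm_comp_le _ _).trans (by gcongr)
              · refine (opNorm_comp_le _ _).trans ?_
                gcongr
                exact (opNorm_comp_le _ _).trans (by gcongr)
        _ = M ^ 2 * (1 + 2 * ρ) * ‖z - w‖ := by ring
        _ ≤ _ := by
            gcongr
            · nlinarith [sq_nonneg M]
            · nlinarith [sq_nonneg ρ])
  refine ⟨σ, fun x => ?_, h2, by rwa [sub_neg_eq_add] at h3⟩
  conv_lhs => rw [h1]
  simp only [_root_.add_apply, _root_.neg_apply, _root_.smul_apply,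
    ContinuousLinearMap.comp_apply, map_add, map_neg, map_smul, hD]
  module

open ContinuousLinearMap in
/-- The linear companion of `exists_riccati`: `lam • θ` removes the remaining coupling of the slow
variable to the fast one. -/
lemma exists_decoupling [CompleteSpace X₁] {b : X₂ →L[ℝ] X₁} {e D Di : X₂ →L[ℝ] X₂} {σ : X₁
    →L[ℝ] X₂} {M ρ lam : ℝ}
    (hb : ‖b‖ ≤ M) (he : ‖e‖ ≤ M) (hDi : ‖Di‖ ≤ M) (hD : ∀ x, Di (D x) = x) (hσ : ‖σ‖ ≤ ρ)
    (hρ : ρ = M ^ 2 + 1) (hlam : 0 ≤ lam) (hlam1 : lam ≤ 1)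
    (hlamK : lam * (2 * M ^ 2 * (1 + ρ) ^ 2) ≤ 1 / 2) :
    ∃ θ : X₂ →L[ℝ] X₁, (∀ x, θ (D x + lam • (e x - lam • σ (b x))) =
        b x + lam ^ 2 • b (σ (θ x))) ∧ ‖θ‖ ≤ ρ ∧
      ‖θ - b ∘L Di‖ ≤ lam * (2 * M ^ 2 * (1 + ρ) ^ 2) := by
  have hM : 0 ≤ M := (norm_nonneg _).trans hb
  have hρ0 : 0 ≤ ρ := by rw [hρ]; positivity
  have bound : ∀ z : X₂ →L[ℝ] X₁, ‖lam • (b ∘L σ ∘L z ∘L Di) - z ∘L (e - lam • (σ ∘L b)) ∘L Di‖ ≤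
      M ^ 2 * (1 + 2 * ρ) * ‖z‖ := by
    intro z
    calc _ ≤ 1 * (M * (ρ * (‖z‖ * M))) + ‖z‖ * ((M + 1 * (ρ * M)) * M) := by
          refine (norm_sub_le _ _).trans ?_
          rw [norm_smul, Real.norm_of_nonneg hlam]
          gcongr
          · refine (opNorm_comp_le _ _).trans ?_
            gcongr
            refine (opNorm_comp_le _ _).trans ?_
            gcongr
            exact (opNorm_comp_le _ _).trans (by gcongr)
          · refine (opNorm_comp_le _ _).trans ?_
            gcongr
            refine (opNorm_comp_le _ _).trans ?_
            gcongr
            refine (norm_sub_le _ _).trans ?_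
            rw [norm_smul, Real.norm_of_nonneg hlam]
            gcongr
            exact (opNorm_comp_le _ _).trans (by gcongr)
      _ = _ := by ring
  obtain ⟨θ, h1, h2, h3⟩ := exists_fixedPoint_near (b ∘L Di)
    (fun θ => lam • (b ∘L σ ∘L θ ∘L Di) - θ ∘L (e - lam • (σ ∘L b)) ∘L Di) (ρ := ρ)
    (K := 2 * M ^ 2 * (1 + ρ) ^ 2) (lam := lam) (by
      have : ‖b ∘L Di‖ ≤ M * M := (opNorm_comp_le _ _).trans (by gcongr)
      rw [hρ]
      linarith)
    hlam hlamK (by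
      intro z hz
      calc _ ≤ M ^ 2 * (1 + 2 * ρ) * ρ := (bound z).trans (by gcongr)
        _ ≤ _ := by
          nlinarith [mul_nonneg (sq_nonneg M) hρ0, sq_nonneg M, mul_nonneg (sq_nonneg M)
            (sq_nonneg ρ)])
    (by
      intro z w hz hw
      have : lam • (b ∘L σ ∘L z ∘L Di) - z ∘L (e - lam • (σ ∘L b)) ∘L Di -
          (lam • (b ∘L σ ∘L w ∘L Di) - w ∘L (e - lam • (σ ∘L b)) ∘L Di) =
          lam • (b ∘L σ ∘L (z - w) ∘L Di) - (z - w) ∘L (e - lam • (σ ∘L b)) ∘L Di := by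
        ext x
        simp only [_root_.smul_apply, ContinuousLinearMap.comp_apply, map_smul,
          _root_.sub_apply, map_sub]
        module
      rw [this]
      refine (bound _).trans ?_
      gcongr
      · nlinarith [sq_nonneg M]
      · nlinarith [sq_nonneg ρ])
  refine ⟨θ, fun x => ?_, h2, h3⟩
  have h4 := DFunLike.congr_fun h1 (D x)
  simp only [_root_.add_apply, _root_.smul_apply, ContinuousLinearMap.comp_apply, hD,
    _root_.sub_apply, map_sub, map_smul] at h4
  rw [map_add, h4]
  simp only [map_smul, map_sub]
  module

end Blocks

/-! ### Decay of relaxation systems with bounded coefficients -/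

section Modes

variable {X₁ X₂ : Type*} [NormedAddCommGroup X₁] [NormedSpace ℝ X₁] [CompleteSpace X₁]
  [NormedAddCommGroup X₂] [NormedSpace ℝ X₂] [CompleteSpace X₂]

/-- In the variables `Z = V₂ - lam σ V₁` (damped mode) and `Y = V₁ - lam θ Z` (slow mode), the
system `V₁' = -lam b V₂`, `V₂' = -lam c V₁ - D V₂ - lam e V₂` is decoupled. -/
lemma exists_modes {b : X₂ →L[ℝ] X₁} {c : X₁ →L[ℝ] X₂} {e D : X₂ →L[ℝ] X₂} {lam : ℝ}
    {σ : X₁ →L[ℝ] X₂} {θ : X₂ →L[ℝ] X₁}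
    (hσ : ∀ x, D (σ x) = -c x - lam • e (σ x) + lam ^ 2 • σ (b (σ x)))
    (hθ : ∀ x, θ (D x + lam • (e x - lam • σ (b x))) = b x + lam ^ 2 • b (σ (θ x)))
    {V₁ : ℝ → X₁} {V₂ : ℝ → X₂} (hc₁ : ContinuousOn V₁ (Set.Ici 0))
    (hc₂ : ContinuousOn V₂ (Set.Ici 0))
    (hd₁ : ∀ t, 0 < t → HasDerivAt V₁ (-(lam • b (V₂ t))) t)
    (hd₂ : ∀ t, 0 < t → HasDerivAt V₂ (-(lam • c (V₁ t)) - D (V₂ t) - lam • e (V₂ t)) t)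
    {t : ℝ} (ht : 0 ≤ t) :
    ∃ Y Z, V₁ t = Y + lam • θ Z ∧ V₂ t = Z + lam • σ (V₁ t) ∧
      Z = NormedSpace.exp (t • (-(D + lam • (e - lam • (σ ∘L b))))) (V₂ 0 - lam • σ (V₁ 0)) ∧
      Y = NormedSpace.exp (t • (-(lam ^ 2 • (b ∘L σ))))
        (V₁ 0 - lam • θ (V₂ 0 - lam • σ (V₁ 0))) := by
  have hσc : ContinuousOn (fun s => σ (V₁ s)) (Set.Ici 0) := σ.continuous.comp_continuousOn hc₁
  have hZc : ContinuousOn (fun s => V₂ s - lam • σ (V₁ s)) (Set.Ici 0) :=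
    hc₂.sub (hσc.const_smul lam)
  have hZd : ∀ s, 0 < s → HasDerivAt (fun s => V₂ s - lam • σ (V₁ s))
      (-((D + lam • (e - lam • (σ ∘L b))) (V₂ s - lam • σ (V₁ s)))) s := by
    intro s hs
    refine ((hd₂ s hs).sub ((σ.hasFDerivAt.comp_hasDerivAt s (hd₁ s hs)).const_smul
      lam)).congr_deriv ?_
    simp only [_root_.add_apply, _root_.smul_apply, _root_.sub_apply,
      ContinuousLinearMap.comp_apply, map_sub, map_smul, map_neg, hσ]
    module
  have hYd : ∀ s, 0 < s → HasDerivAt (fun s => V₁ s - lam • θ (V₂ s - lam • σ (V₁ s)))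
      (-((lam ^ 2 • (b ∘L σ)) (V₁ s - lam • θ (V₂ s - lam • σ (V₁ s))))) s := by
    intro s hs
    refine ((hd₁ s hs).sub
      ((θ.hasFDerivAt.comp_hasDerivAt s (hZd s hs)).const_smul lam)).congr_deriv ?_
    have h := hθ (V₂ s - lam • σ (V₁ s))
    simp only [_root_.add_apply, _root_.smul_apply, _root_.sub_apply,
      ContinuousLinearMap.comp_apply] at h ⊢
    rw [map_neg, h]
    simp only [map_sub, map_smul]
    module
  refine ⟨V₁ t - lam • θ (V₂ t - lam • σ (V₁ t)), V₂ t - lam • σ (V₁ t), by simp, by simp,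
    eq_exp_of_hasDerivAt _ hZc hZd ht, eq_exp_of_hasDerivAt _ ?_ hYd ht⟩
  exact hc₁.sub ((θ.continuous.comp_continuousOn hZc).const_smul lam)

end Modes

set_option maxHeartbeats 1600000 in
/-- Decay of a relaxation system with bounded coefficients. If the damping `-D` generates a decaying
semigroup and the effective operator `b D⁻¹ c` generates a decaying one, then for small `lam` the
solutions of `V₁' = -lam b V₂`, `V₂' = -lam c V₁ - D V₂ - lam e V₂` consist of a slow part, close to
the effective dynamics, and of an exponentially damped part. All constants depend only on the bounds
of the operators, not on the operators themselves. -/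
theorem exists_relaxation_estimates {M r κ : ℝ} (hM : 1 ≤ M) (hr : 0 < r) (hκ : 0 < κ) :
    ∃ lam₀ > (0 : ℝ), ∃ C > (0 : ℝ), ∃ R > (0 : ℝ), ∃ κ' > (0 : ℝ), lam₀ ≤ 1 ∧ R ≤ κ' ∧
    ∀ {X₁ X₂ : Type} [NormedAddCommGroup X₁] [NormedSpace ℝ X₁] [CompleteSpace X₁]
      [NormedAddCommGroup X₂] [NormedSpace ℝ X₂] [CompleteSpace X₂]
      (b : X₂ →L[ℝ] X₁) (c : X₁ →L[ℝ] X₂) (e D Di : X₂ →L[ℝ] X₂),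
      ‖b‖ ≤ M → ‖c‖ ≤ M → ‖e‖ ≤ M → ‖Di‖ ≤ M → (∀ x, D (Di x) = x) → (∀ x, Di (D x) = x) →
      (∀ t : ℝ, 0 ≤ t → ‖NormedSpace.exp (t • (-D))‖ ≤ M * Real.exp (-(κ * t))) →
      (∀ t : ℝ, 0 ≤ t → ‖NormedSpace.exp (t • (b ∘L Di ∘L c))‖ ≤ M * Real.exp (-(r * t))) →
      ∀ lam : ℝ, 0 < lam → lam < lam₀ → ∀ (V₁ : ℝ → X₁) (V₂ : ℝ → X₂),
      ContinuousOn V₁ (Set.Ici 0) → ContinuousOn V₂ (Set.Ici 0) →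
      (∀ t, 0 < t → HasDerivAt V₁ (-(lam • b (V₂ t))) t) →
      (∀ t, 0 < t → HasDerivAt V₂ (-(lam • c (V₁ t)) - D (V₂ t) - lam • e (V₂ t)) t) →
      ∀ t, 0 ≤ t →
        ‖V₁ t‖ ≤ C * Real.exp (-(R * lam ^ 2 * t)) * (‖V₁ 0‖ + lam * ‖V₂ 0‖) +
          C * Real.exp (-(κ' * t)) * (lam ^ 2 * ‖V₁ 0‖ + lam * ‖V₂ 0‖) ∧
        ‖V₂ t‖ ≤ C * lam * Real.exp (-(R * lam ^ 2 * t)) * (‖V₁ 0‖ + lam * ‖V₂ 0‖) +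
          C * Real.exp (-(κ' * t)) * (lam * ‖V₁ 0‖ + ‖V₂ 0‖) ∧
        ‖V₁ t - NormedSpace.exp ((lam ^ 2 * t) • (b ∘L Di ∘L c)) (V₁ 0 - lam • b (Di (V₂ 0)))‖ ≤
          C * lam * Real.exp (-(R * lam ^ 2 * t)) * (‖V₁ 0‖ + lam * ‖V₂ 0‖) +
          C * Real.exp (-(κ' * t)) * (lam ^ 2 * ‖V₁ 0‖ + lam * ‖V₂ 0‖) ∧
        ‖V₂ t + lam • Di (c (NormedSpace.exp ((lam ^ 2 * t) • (b ∘L Di ∘L c))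
            (V₁ 0 - lam • b (Di (V₂ 0)))))‖ ≤
          C * lam ^ 2 * Real.exp (-(R * lam ^ 2 * t)) * (‖V₁ 0‖ + lam * ‖V₂ 0‖) +
          C * Real.exp (-(κ' * t)) * (lam * ‖V₁ 0‖ + ‖V₂ 0‖) := by
  obtain ⟨ρ, hρ⟩ : ∃ ρ, ρ = M ^ 2 + 1 := ⟨_, rfl⟩
  obtain ⟨K, hK⟩ : ∃ K, K = 2 * M ^ 2 * (1 + ρ) ^ 2 := ⟨_, rfl⟩
  obtain ⟨m, hm⟩ : ∃ m, m = min 1 (min r κ) := ⟨_, rfl⟩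
  have hM0 : 0 < M := by linarith
  have hM2 : 1 ≤ M ^ 2 := one_le_pow₀ hM
  have hρ1 : 1 ≤ ρ := by linarith
  have hρ0 : 0 < ρ := by linarith
  have hKM : M * (1 + ρ) ≤ K := by
    rw [hK]; nlinarith [mul_nonneg hM0.le hρ0.le, mul_le_mul_of_nonneg_left hM hM0.le]
  have hK1 : 1 ≤ K := by nlinarith
  have hK0 : 0 < K := by linarith
  have hm0 : 0 < m := by rw [hm]; positivity
  have hm1 : m ≤ 1 := by rw [hm]; exact min_le_left _ _
  have hmr : m ≤ r := by rw [hm]; exact (min_le_right _ _).trans (min_le_left _ _)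
  have hmκ : m ≤ κ := by rw [hm]; exact (min_le_right _ _).trans (min_le_right _ _)
  obtain ⟨C₁, hC₁⟩ : ∃ C₁, C₁ = 8 * M ^ 3 * K * ρ ^ 2 / r + M * (K + ρ ^ 2) := ⟨_, rfl⟩
  have hC₁0 : 0 < C₁ := by rw [hC₁]; positivity
  obtain ⟨C, hC⟩ : ∃ C, C = M * ρ * (1 + ρ ^ 2) + 2 * M * ρ ^ 3 + 2 * M * ρ ^ 2 + C₁ +
      2 * K * M * ρ ^ 2 + M ^ 2 * C₁ := ⟨_, rfl⟩
  have p1 : 0 < M * ρ * (1 + ρ ^ 2) := by positivity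
  have p2 : 0 < 2 * M * ρ ^ 3 := by positivity
  have p3 : 0 < 2 * M * ρ ^ 2 := by positivity
  have p4 : 0 < 2 * K * M * ρ ^ 2 := by positivity
  have p5 : 0 < M ^ 2 * C₁ := by positivity
  have hC0 : 0 < C := by rw [hC]; positivity
  refine ⟨m / (2 * M ^ 2 * K), by positivity, C, hC0, min (r / 4) (κ / 2), by positivity, κ / 2,
    by positivity, ?_, min_le_right _ _, ?_⟩
  · rw [div_le_one (by positivity)]
    linarith [le_mul_of_one_le_right (sq_nonneg M) hK1]
  intro X₁ X₂ _ _ _ _ _ _ b c e D Di hb hc he hDi hD1 hD2 hexpD hexpA lam hlam hlam0 V₁ V₂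
    hc₁ hc₂ hd₁ hd₂ t ht
  have hlamm : lam * (2 * M ^ 2 * K) ≤ m := by
    rw [lt_div_iff₀ (by positivity)] at hlam0
    exact hlam0.le
  have hlamK2 : lam * K ≤ 1 / 2 := by
    linarith [le_mul_of_one_le_right (mul_pos hlam hK0).le hM2]
  have hlam1 : lam ≤ 1 := by linarith [le_mul_of_one_le_right hlam.le hK1]
  obtain ⟨σ, hσ, hσρ, hσK⟩ := exists_riccati hb hc he hDi hD1 hρ hlam.le hlam1 (hK ▸ hlamK2)
  obtain ⟨θ, hθ, hθρ, hθK⟩ := exists_decoupling hb he hDi hD2 hσρ hρ hlam.le hlam1 (hK ▸ hlamK2)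
  rw [← hK] at hσK hθK
  obtain ⟨Y, Z, hV1, hV2, hZ, hY⟩ := exists_modes hσ hθ hc₁ hc₂ hd₁ hd₂ ht
  set n₁ := ‖V₁ 0‖ with hn₁
  set n₂ := ‖V₂ 0‖ with hn₂
  have hn₁0 : 0 ≤ n₁ := norm_nonneg _
  have hn₂0 : 0 ≤ n₂ := norm_nonneg _
  set τ := lam ^ 2 * t with hτ
  have hτ0 : 0 ≤ τ := by positivity
  obtain ⟨E₁, hE₁⟩ : ∃ E₁, E₁ = Real.exp (-(min (r / 4) (κ / 2) * lam ^ 2 * t)) := ⟨_, rfl⟩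
  obtain ⟨E₂, hE₂⟩ : ∃ E₂, E₂ = Real.exp (-(κ / 2 * t)) := ⟨_, rfl⟩
  have hE₁0 : 0 < E₁ := hE₁ ▸ Real.exp_pos _
  have hE₂0 : 0 < E₂ := hE₂ ▸ Real.exp_pos _
  rw [← hE₁, ← hE₂]
  obtain ⟨α, hα⟩ : ∃ α, α = n₁ + lam * n₂ := ⟨_, rfl⟩
  obtain ⟨β, hβ⟩ : ∃ β, β = lam * n₁ + n₂ := ⟨_, rfl⟩
  have hα0 : 0 ≤ α := hα ▸ by positivity
  have hβ0 : 0 ≤ β := hβ ▸ by positivity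
  have hlβ : lam * β ≤ α := by
    have : lam * (lam * n₁) ≤ 1 * (1 * n₁) := by gcongr
    rw [hα, hβ]; linarith
  rw [show lam ^ 2 * n₁ + lam * n₂ = lam * β by rw [hβ]; ring, ← hα, ← hβ]
  have hσx : ∀ x, ‖σ x‖ ≤ ρ * ‖x‖ := fun x => σ.le_of_opNorm_le hσρ x
  have hθx : ∀ x, ‖θ x‖ ≤ ρ * ‖x‖ := fun x => θ.le_of_opNorm_le hθρ x
  have hls : ∀ {X : Type} [NormedAddCommGroup X] [NormedSpace ℝ X] (x : X),
      ‖lam • x‖ = lam * ‖x‖ := fun x => by rw [norm_smul, Real.norm_of_nonneg hlam.le]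
  -- the initial values of the two modes
  have hZ0 : ‖V₂ 0 - lam • σ (V₁ 0)‖ ≤ ρ * β := by
    calc _ ≤ n₂ + lam * (ρ * n₁) := by
          refine (norm_sub_le _ _).trans ?_
          rw [hls]
          gcongr
          exact hσx _
      _ ≤ _ := by rw [hβ]; linarith [le_mul_of_one_le_left hn₂0 hρ1]
  have hY0 : ‖V₁ 0 - lam • θ (V₂ 0 - lam • σ (V₁ 0))‖ ≤ 2 * ρ ^ 2 * α := by
    calc _ ≤ n₁ + lam * (ρ * (ρ * β)) := by
          refine (norm_sub_le _ _).trans ?_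
          rw [hls]
          gcongr
          exact (hθx _).trans (by gcongr)
      _ = n₁ + ρ ^ 2 * (lam * β) := by ring
      _ ≤ 1 * α + ρ ^ 2 * α := by
          gcongr
          rw [hα, one_mul]
          linarith [mul_nonneg hlam.le hn₂0]
      _ ≤ _ := by
          linarith [mul_le_mul_of_nonneg_right (one_le_pow₀ (n := 2) hρ1) hα0]
  -- the fast mode
  have hMlamK : M * (lam * K) ≤ κ / 2 := by
    have h1 : M * (lam * K) * 2 ≤ lam * (2 * M ^ 2 * K) := by
      linarith [mul_le_mul_of_nonneg_left hM (show 0 ≤ lam * K * M by positivity)]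
    linarith
  have hZt : ‖Z‖ ≤ M * ρ * E₂ * β := by
    have hP : ‖-(lam • (e - lam • (σ ∘L b)))‖ ≤ lam * K := by
      rw [norm_neg, norm_smul, Real.norm_of_nonneg hlam.le]
      gcongr
      refine (norm_sub_le _ _).trans ?_
      rw [norm_smul, Real.norm_of_nonneg hlam.le]
      calc ‖e‖ + lam * ‖σ ∘L b‖ ≤ M + 1 * (ρ * M) := by
            gcongr
            exact (ContinuousLinearMap.opNorm_comp_le _ _).trans (by gcongr)
        _ = M * (1 + ρ) := by ring
        _ ≤ K := hKM
    have h := norm_exp_smul_add_le hM0.le hexpD hP ht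
    rw [← neg_add] at h
    rw [hZ]
    refine (ContinuousLinearMap.le_opNorm _ _).trans ?_
    calc _ ≤ (M * E₂) * (ρ * β) := by
          gcongr
          refine h.trans ?_
          rw [hE₂]
          refine mul_le_mul_of_nonneg_left (Real.exp_le_exp.2 ?_) hM0.le
          linarith [mul_le_mul_of_nonneg_right hMlamK ht]
      _ = _ := by ring
  -- the slow mode
  have hMlamK' : M * (M * (lam * K)) ≤ r / 2 := by
    have : M * (M * (lam * K)) * 2 = lam * (2 * M ^ 2 * K) := by ring
    linarith
  have hRr : min (r / 4) (κ / 2) ≤ r / 4 := min_le_left _ _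
  have hP : ‖-(b ∘L σ + b ∘L Di ∘L c)‖ ≤ M * (lam * K) := by
    rw [norm_neg, ← ContinuousLinearMap.comp_add]
    exact (ContinuousLinearMap.opNorm_comp_le _ _).trans (by gcongr)
  have hgen : t • (-(lam ^ 2 • (b ∘L σ))) =
      τ • (b ∘L Di ∘L c + -(b ∘L σ + b ∘L Di ∘L c)) := by
    rw [hτ]; module
  rw [hgen] at hY
  have hYt : ‖Y‖ ≤ 2 * M * ρ ^ 2 * E₁ * α := by
    have h := norm_exp_smul_add_le hM0.le hexpA hP hτ0
    rw [hY]
    refine (ContinuousLinearMap.le_opNorm _ _).trans ?_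
    calc _ ≤ (M * E₁) * (2 * ρ ^ 2 * α) := by
          gcongr
          refine h.trans ?_
          rw [hE₁]
          refine mul_le_mul_of_nonneg_left (Real.exp_le_exp.2 ?_) hM0.le
          rw [mul_assoc _ (lam ^ 2) t, ← hτ]
          linarith [mul_le_mul_of_nonneg_right hMlamK' hτ0, mul_le_mul_of_nonneg_right hRr hτ0,
            mul_nonneg hr.le hτ0]
      _ = _ := by ring
  set A := b ∘L Di ∘L c with hA
  set W := NormedSpace.exp (τ • A) (V₁ 0 - lam • b (Di (V₂ 0))) with hW
  have hexpE : Real.exp (-(r / 4 * τ)) ≤ E₁ := by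
    rw [hE₁, mul_assoc _ (lam ^ 2) t, ← hτ]
    exact Real.exp_le_exp.2 (by linarith [mul_le_mul_of_nonneg_right hRr hτ0])
  -- the slow mode follows the effective dynamics
  have hYW : ‖Y - W‖ ≤ lam * C₁ * E₁ * α := by
    have h := norm_exp_smul_add_sub_le hM0.le hexpA hP hτ0
    have hsplit : Y - W = (NormedSpace.exp (τ • (A + -(b ∘L σ + A))) - NormedSpace.exp (τ • A))
          (V₁ 0 - lam • θ (V₂ 0 - lam • σ (V₁ 0))) +
        NormedSpace.exp (τ • A) (lam • (lam • θ (σ (V₁ 0)) - (θ - b ∘L Di) (V₂ 0))) := by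
      rw [hY, hW, _root_.sub_apply, sub_add, ← map_sub]
      congr 2
      simp only [_root_.sub_apply, map_sub, map_smul, ContinuousLinearMap.comp_apply]
      module
    rw [hsplit]
    have hτe : τ * Real.exp (-((r - M * (M * (lam * K))) * τ)) ≤ 4 / r * E₁ := by
      have h1 : τ * (r / 4) ≤ Real.exp (r / 4 * τ) := by
        linarith [Real.add_one_le_exp (r / 4 * τ)]
      calc _ ≤ τ * Real.exp (-(r / 4 * τ) + -(r / 4 * τ)) := by
            refine mul_le_mul_of_nonneg_left (Real.exp_le_exp.2 ?_) hτ0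
            linarith [mul_le_mul_of_nonneg_right hMlamK' hτ0]
        _ = 4 / r * (τ * (r / 4) * Real.exp (-(r / 4 * τ))) * Real.exp (-(r / 4 * τ)) := by
            rw [Real.exp_add]; field_simp
        _ ≤ 4 / r * (Real.exp (r / 4 * τ) * Real.exp (-(r / 4 * τ))) * E₁ := by gcongr
        _ = _ := by rw [← Real.exp_add]; simp
    calc _ ≤ (M * (M * (lam * K)) * M * (4 / r * E₁)) * (2 * ρ ^ 2 * α) +
          (M * E₁) * (lam * ((K + ρ ^ 2) * α)) := by
          refine (norm_add_le _ _).trans (add_le_add ?_ ?_)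
          · refine (ContinuousLinearMap.le_opNorm _ _).trans ?_
            gcongr
            refine h.trans ?_
            rw [mul_assoc _ τ]
            gcongr
          · refine (ContinuousLinearMap.le_opNorm _ _).trans ?_
            rw [hls]
            gcongr
            · refine (hexpA τ hτ0).trans ?_
              gcongr
              refine (Real.exp_le_exp.2 ?_).trans hexpE
              linarith [mul_nonneg hr.le hτ0]
            · refine (norm_sub_le _ _).trans ?_
              rw [hls]
              calc _ ≤ lam * (ρ * (ρ * n₁)) + (lam * K) * n₂ := by
                    gcongr
                    · exact (hθx _).trans (by gcongr; exact hσx _)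
                    · exact ContinuousLinearMap.le_of_opNorm_le _ hθK _
                _ ≤ _ := by
                    rw [hα]
                    linarith [mul_nonneg hK0.le hn₁0, mul_nonneg (sq_nonneg ρ) hn₁0,
                      mul_nonneg (mul_nonneg (sq_nonneg ρ) hlam.le) hn₂0,
                      mul_nonneg (sub_nonneg.2 hlam1) (mul_nonneg (sq_nonneg ρ) hn₁0)]
      _ = _ := by rw [hC₁]; ring
  have hlZ : ‖lam • θ Z‖ ≤ M * ρ ^ 2 * E₂ * (lam * β) := by
    rw [hls]
    calc _ ≤ lam * (ρ * (M * ρ * E₂ * β)) := by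
          gcongr
          exact (hθx _).trans (by gcongr)
      _ = _ := by ring
  have hρ23 : M * ρ ^ 2 ≤ M * ρ * (1 + ρ ^ 2) := by
    linarith [mul_pos hM0 hρ0,
      mul_le_mul_of_nonneg_left hρ1 (show 0 ≤ M * ρ ^ 2 by positivity)]
  have q1 : M * ρ ^ 2 ≤ C := by linarith
  have q2 : 2 * M * ρ ^ 2 ≤ C := by linarith
  have q3 : M * ρ * (1 + ρ ^ 2) ≤ C := by linarith
  have q4 : 2 * M * ρ ^ 3 ≤ C := by linarith
  have q5 : C₁ ≤ C := by linarith
  have q6 : 2 * K * M * ρ ^ 2 + M ^ 2 * C₁ ≤ C := by linarith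
  have hV1' : ‖V₁ t‖ ≤ 2 * M * ρ ^ 2 * E₁ * α + M * ρ ^ 2 * E₂ * (lam * β) := by
    rw [hV1]
    exact (norm_add_le _ _).trans (add_le_add hYt hlZ)
  refine ⟨?_, ?_, ?_, ?_⟩
  · refine hV1'.trans ?_
    gcongr
  · rw [hV2]
    calc _ ≤ M * ρ * E₂ * β +
          lam * (ρ * (2 * M * ρ ^ 2 * E₁ * α + M * ρ ^ 2 * E₂ * (1 * β))) := by
          refine (norm_add_le _ _).trans (add_le_add hZt ?_)
          rw [hls]
          gcongr
          refine (hσx _).trans ?_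
          gcongr
          refine hV1'.trans ?_
          gcongr
      _ ≤ M * ρ * E₂ * β + lam * (ρ * (2 * M * ρ ^ 2 * E₁ * α)) +
          1 * (ρ * (M * ρ ^ 2 * E₂ * (1 * β))) := by
          rw [mul_add ρ, mul_add lam, add_assoc]
          gcongr
      _ = 2 * M * ρ ^ 3 * lam * E₁ * α + M * ρ * (1 + ρ ^ 2) * E₂ * β := by ring
      _ ≤ _ := by gcongr
  · have : V₁ t - W = (Y - W) + lam • θ Z := by rw [hV1]; abel
    rw [this]
    calc _ ≤ lam * C₁ * E₁ * α + M * ρ ^ 2 * E₂ * (lam * β) :=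
          (norm_add_le _ _).trans (add_le_add hYW hlZ)
      _ = C₁ * lam * E₁ * α + M * ρ ^ 2 * E₂ * (lam * β) := by ring
      _ ≤ _ := by gcongr
  · have : V₂ t + lam • Di (c W) = Z + lam • σ (lam • θ Z) +
        (lam • (σ + Di ∘L c) Y - lam • Di (c (Y - W))) := by
      rw [hV2, hV1]
      simp only [_root_.add_apply, map_sub, map_add, ContinuousLinearMap.comp_apply]
      module
    rw [this]
    calc _ ≤ (M * ρ * E₂ * β + 1 * (ρ * (M * ρ ^ 2 * E₂ * (1 * β)))) +
          (lam * (lam * K * (2 * M * ρ ^ 2 * E₁ * α)) + lam * (M * (M * (lam * C₁ * E₁ * α)))) := by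
          refine (norm_add_le _ _).trans (add_le_add ?_ ?_)
          · refine (norm_add_le _ _).trans (add_le_add hZt ?_)
            rw [hls]
            gcongr
            refine (hσx _).trans ?_
            gcongr
            refine hlZ.trans ?_
            gcongr
          · refine (norm_sub_le _ _).trans ?_
            rw [hls, hls]
            gcongr
            · exact (ContinuousLinearMap.le_of_opNorm_le _ hσK _).trans (by gcongr)
            · refine (ContinuousLinearMap.le_of_opNorm_le _ hDi _).trans ?_
              gcongr
              exact (ContinuousLinearMap.le_of_opNorm_le _ hc _).trans (by gcongr)
      _ = (2 * K * M * ρ ^ 2 + M ^ 2 * C₁) * lam ^ 2 * E₁ * α + M * ρ * (1 + ρ ^ 2) * E₂ * β := by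
          ring
      _ ≤ _ := by gcongr

/-! ### Exponentials of dissipative matrices -/

/-- The logarithmic norm estimate `‖exp T‖ ≤ exp ω` for `Re ⟨x, T x⟩ ≤ ω ‖x‖²`. -/
lemma norm_exp_le_of_re_inner_le {H : Type*} [NormedAddCommGroup H] [InnerProductSpace ℂ H]
    [CompleteSpace H] (T : H →L[ℂ] H) {ω : ℝ}
    (hT : ∀ x, (inner ℂ x (T x)).re ≤ ω * ‖x‖ ^ 2) : ‖NormedSpace.exp T‖ ≤ Real.exp ω := by
  let _ : NormedAlgebra ℚ (H →L[ℂ] H) := NormedAlgebra.restrictScalars ℚ ℂ _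
  refine ContinuousLinearMap.opNorm_le_bound _ (Real.exp_pos _).le fun x => ?_
  have hy : ∀ s : ℝ, HasDerivAt (fun s : ℝ => NormedSpace.exp (s • T) x)
      (T (NormedSpace.exp (s • T) x)) s := fun s =>
    ((ContinuousLinearMap.apply ℂ H x).restrictScalars ℝ).hasFDerivAt.comp_hasDerivAt s
      (hasDerivAt_exp_smul_const' T s)
  have hn : ∀ s : ℝ, HasDerivAt (fun s : ℝ => ‖NormedSpace.exp (s • T) x‖ ^ 2)
      (2 * (inner ℂ (NormedSpace.exp (s • T) x) (T (NormedSpace.exp (s • T) x))).re) s := by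
    intro s
    have h := ((hy s).inner ℂ (hy s))
    have h2 := Complex.reCLM.hasFDerivAt.comp_hasDerivAt s h
    refine (h2.congr_deriv ?_).congr_of_eventuallyEq (Filter.Eventually.of_forall fun r => ?_)
    · rw [map_add, two_mul]
      congr 1
      exact inner_re_symm (𝕜 := ℂ) _ _
    · exact norm_sq_eq_re_inner (𝕜 := ℂ) _
  have hanti : Antitone fun s : ℝ => Real.exp (-(2 * ω * s)) * ‖NormedSpace.exp (s • T) x‖ ^ 2 := by
    have hd : ∀ s : ℝ, HasDerivAt
        (fun s : ℝ => Real.exp (-(2 * ω * s)) * ‖NormedSpace.exp (s • T) x‖ ^ 2) _ s := fun s =>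
      (((hasDerivAt_id s).const_mul (2 * ω)).neg.exp).mul (hn s)
    refine antitone_of_deriv_nonpos (fun s => (hd s).differentiableAt) fun s => ?_
    rw [(hd s).deriv]
    have h1 := hT (NormedSpace.exp (s • T) x)
    have h2 := Real.exp_pos (-(2 * ω * s))
    simp only [id, mul_one, Pi.neg_apply]
    nlinarith
  have h01 := hanti zero_le_one
  simp only [mul_one, one_smul, mul_zero, neg_zero, Real.exp_zero, one_mul, zero_smul,
    NormedSpace.exp_zero, one_apply_eq_self] at h01
  have h3 : ‖NormedSpace.exp T x‖ ^ 2 ≤ (Real.exp ω * ‖x‖) ^ 2 := by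
    calc _ = Real.exp ω ^ 2 * (Real.exp (-(2 * ω)) * ‖NormedSpace.exp T x‖ ^ 2) := by
          rw [← mul_assoc, ← Real.exp_nat_mul, ← Real.exp_add]
          simp
      _ ≤ Real.exp ω ^ 2 * ‖x‖ ^ 2 := by gcongr
      _ = _ := by ring
  exact le_of_sq_le_sq h3 (by positivity)

section MatrixNorm

open scoped Matrix.Norms.L2Operator

lemma norm_entry_le {n : ℕ} (M : Matrix (Fin n) (Fin n) ℂ) (j k : Fin n) : ‖M j k‖ ≤ ‖M‖ := by
  have h := M.l2_opNorm_mulVec (WithLp.toLp 2 (Pi.single k (1 : ℂ)))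
  refine le_trans ?_ (h.trans (by simp))
  refine le_trans (le_of_eq ?_) (PiLp.norm_apply_le _ j)
  simp

/-- Entries of the exponential of a dissipative matrix. -/
lemma norm_exp_entry_le {n : ℕ} (M : Matrix (Fin n) (Fin n) ℂ) {ω : ℝ}
    (hM : ∀ x : EuclideanSpace ℂ (Fin n),
      (inner ℂ x (Matrix.toEuclideanCLM (𝕜 := ℂ) M x)).re ≤ ω * ‖x‖ ^ 2) (j k : Fin n) :
    ‖NormedSpace.exp M j k‖ ≤ Real.exp ω := by
  refine (norm_entry_le _ j k).trans ?_
  let _ : NormedAlgebra ℚ (Matrix (Fin n) (Fin n) ℂ) := NormedAlgebra.restrictScalars ℚ ℂ _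
  let _ : NormedAlgebra ℚ (EuclideanSpace ℂ (Fin n) →L[ℂ] EuclideanSpace ℂ (Fin n)) :=
    NormedAlgebra.restrictScalars ℚ ℂ _
  have hcont : Continuous (Matrix.toEuclideanCLM (n := Fin n) (𝕜 := ℂ)) :=
    (AddMonoidHomClass.isometry_of_norm _ fun M => Matrix.l2_opNorm_toEuclideanCLM M).continuous
  have h := NormedSpace.map_exp (Matrix.toEuclideanCLM (n := Fin n) (𝕜 := ℂ)) hcont M
  rw [← Matrix.l2_opNorm_toEuclideanCLM, h]
  exact norm_exp_le_of_re_inner_le _ hM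

/-- Entries of the exponential of a matrix are entire functions of its entries. -/
lemma contDiff_exp_entry {E : Type*} [NormedAddCommGroup E] [NormedSpace ℂ E] {n : ℕ}
    {f : E → Matrix (Fin n) (Fin n) ℂ} (hf : ∀ j k, ContDiff ℂ ⊤ fun z => f z j k) (j k : Fin n) :
    ContDiff ℂ ⊤ fun z => NormedSpace.exp (f z) j k := by
  let L : (Fin n → Fin n → ℂ) →L[ℂ] Matrix (Fin n) (Fin n) ℂ :=
    LinearMap.toContinuousLinearMap (Matrix.ofLinearEquiv ℂ).toLinearMap
  have h1 : ContDiff ℂ ⊤ f := by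
    have : ContDiff ℂ ⊤ fun z => (fun j k => f z j k : Fin n → Fin n → ℂ) :=
      contDiff_pi.2 fun j => contDiff_pi.2 fun k => hf j k
    exact L.contDiff.comp this
  have h2 : ContDiff ℂ ⊤ (NormedSpace.exp : Matrix (Fin n) (Fin n) ℂ → _) :=
    contDiff_iff_contDiffAt.2 fun x => (NormedSpace.exp_analytic (𝕂 := ℂ) x).contDiffAt
  let ev : Matrix (Fin n) (Fin n) ℂ →L[ℂ] ℂ :=
    LinearMap.toContinuousLinearMap (Matrix.entryLinearMap ℂ ℂ j k)
  exact ev.contDiff.comp (h2.comp h1)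

end MatrixNorm

/-! ### Cauchy estimates for entire functions -/

/-- Cauchy's estimate for all Fréchet derivatives of an entire function. -/
lemma exists_cauchy_bound {E : Type} [NormedAddCommGroup E] [NormedSpace ℂ E] (n : ℕ) :
    ∃ C : ℝ, 0 ≤ C ∧ ∀ {F : Type} [NormedAddCommGroup F] [NormedSpace ℂ F] (f : E → F),
      ContDiff ℂ ⊤ f → ∀ (x : E) (r B : ℝ), 0 < r → (∀ z ∈ Metric.ball x r, ‖f z‖ ≤ B) →
      ‖iteratedFDeriv ℝ n f x‖ ≤ C * B / r ^ n := by
  induction n with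
  | zero =>
    refine ⟨1, zero_le_one, fun {F} _ _ f _ x r B hr hB => ?_⟩
    simpa using hB x (Metric.mem_ball_self hr)
  | succ n ih =>
    obtain ⟨C, hC0, hC⟩ := ih
    refine ⟨2 ^ (n + 2) * C, by positivity, fun {F} _ _ f hf x r B hr hB => ?_⟩
    have hB0 : 0 ≤ B := (norm_nonneg _).trans (hB x (Metric.mem_ball_self hr))
    have hfd : ContDiff ℂ ⊤ (fderiv ℂ f) := hf.fderiv_right (by simp)
    have hdiff : Differentiable ℂ f := hf.differentiable (by simp)
    have h1 : ∀ y ∈ Metric.ball x (r / 2), ‖fderiv ℂ f y‖ ≤ 2 * 2 * B / r := by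
      intro y hy
      refine ContinuousLinearMap.opNorm_le_bound _ (by positivity) fun v => ?_
      rcases eq_or_ne v 0 with rfl | hv
      · simp
      have hv0 : 0 < ‖v‖ := norm_pos_iff.2 hv
      have hline : Differentiable ℂ fun z : ℂ => f (y + z • v) :=
        hdiff.comp (by fun_prop)
      have h2 := Complex.norm_deriv_le_of_forall_mem_sphere_norm_le (c := 0) (R := r / (4 * ‖v‖))
        (C := B) (f := fun z : ℂ => f (y + z • v)) (by positivity) hline.diffContOnCl ?_
      · have h3 : HasDerivAt (fun z : ℂ => f (y + z • v)) (fderiv ℂ f y v) 0 := by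
          have h4 : HasDerivAt (fun z : ℂ => y + z • v) v 0 := by
            simpa using ((hasDerivAt_id (0 : ℂ)).smul_const v).const_add y
          have h5 : HasFDerivAt f (fderiv ℂ f y) (y + (0 : ℂ) • v) := by
            simpa using (hdiff y).hasFDerivAt
          exact h5.comp_hasDerivAt 0 h4
        rw [h3.deriv] at h2
        refine h2.trans (le_of_eq ?_)
        field_simp
        ring
      · intro z hz
        apply hB
        rw [mem_sphere_zero_iff_norm] at hz
        rw [Metric.mem_ball, dist_eq_norm] at hy ⊢
        calc ‖y + z • v - x‖ = ‖(y - x) + z • v‖ := by congr 1; abel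
          _ ≤ ‖y - x‖ + ‖z‖ * ‖v‖ := (norm_add_le _ _).trans (by rw [norm_smul])
          _ < r / 2 + r / (4 * ‖v‖) * ‖v‖ := by rw [hz]; gcongr
          _ = r / 2 + r / 4 := by field_simp
          _ ≤ r := by linarith
    have h2 := hC (fderiv ℂ f) hfd x (r / 2) (2 * 2 * B / r) (by positivity) h1
    have h3 : fderiv ℝ f = ContinuousLinearMap.restrictScalarsL ℂ E F ℝ ℝ ∘ fderiv ℂ f := by
      ext1 y
      exact (hdiff y).fderiv_restrictScalars ℝ
    rw [← norm_iteratedFDeriv_fderiv, h3]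
    have h4 : ContDiffAt ℝ n (fderiv ℂ f) x :=
      ((hfd.of_le le_top).restrict_scalars ℝ).contDiffAt
    refine (ContinuousLinearMap.norm_iteratedFDeriv_comp_left _ h4 le_rfl).trans ?_
    calc _ ≤ 1 * (C * (2 * 2 * B / r) / (r / 2) ^ n) := by
          gcongr
          refine ContinuousLinearMap.opNorm_le_bound _ zero_le_one fun g => ?_
          simp
      _ = _ := by
          rw [div_pow]
          field_simp
          ring

section

/-! ### Entire functions as symbols on real frequencies -/

/-- The inclusion of `ℝᵈ` into `ℂᵈ`. -/
def complexify (d : ℕ) : EuclideanSpace ℝ (Fin d) →ₗᵢ[ℝ] EuclideanSpace ℂ (Fin d) where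
  toFun x := WithLp.toLp 2 fun i => (x i : ℂ)
  map_add' x y := by ext i; simp
  map_smul' c x := by ext i; simp
  norm_map' x := by simp [EuclideanSpace.norm_eq]

@[simp]
lemma complexify_apply {d : ℕ} (x : EuclideanSpace ℝ (Fin d)) (i : Fin d) :
    complexify d x i = (x i : ℂ) := rfl

variable {d : ℕ}

lemma contDiff_comp_complexify {h : EuclideanSpace ℂ (Fin d) → ℂ} (hh : ContDiff ℂ ⊤ h)
    {n : WithTop ℕ∞} : ContDiff ℝ n fun u => h (complexify d u) :=
  ((hh.restrict_scalars ℝ).comp (complexify d).toContinuousLinearMap.contDiff).of_le le_top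

/-- Cauchy's estimate at real points for the restriction of an entire function to `ℝᵈ`. -/
lemma exists_cauchy_bound_real (d n : ℕ) :
    ∃ C : ℝ, 0 ≤ C ∧ ∀ h : EuclideanSpace ℂ (Fin d) → ℂ, ContDiff ℂ ⊤ h →
      ∀ (u : EuclideanSpace ℝ (Fin d)) (r B : ℝ), 0 < r →
      (∀ z ∈ Metric.ball (complexify d u) r, ‖h z‖ ≤ B) →
      ‖iteratedFDeriv ℝ n (fun u => h (complexify d u)) u‖ ≤ C * B / r ^ n := by
  obtain ⟨C, hC0, hC⟩ := exists_cauchy_bound (E := EuclideanSpace ℂ (Fin d)) n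
  refine ⟨C, hC0, fun h hh u r B hr hB => ?_⟩
  have h1 := (complexify d).toContinuousLinearMap.iteratedFDeriv_comp_right (f := h)
    ((hh.restrict_scalars ℝ).of_le (le_top : (n : WithTop ℕ∞) ≤ ⊤)) u (i := n) le_rfl
  have h2 : (fun u => h (complexify d u)) = h ∘ (complexify d).toContinuousLinearMap := rfl
  rw [h2, h1]
  refine (ContinuousMultilinearMap.norm_compContinuousLinearMap_le _ _).trans ?_
  have h3 : ∏ _i : Fin n, ‖(complexify d).toContinuousLinearMap‖ ≤ 1 :=
    Finset.prod_le_one (fun _ _ => norm_nonneg _)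
      fun _ _ => (complexify d).norm_toContinuousLinearMap_le
  calc _ ≤ ‖iteratedFDeriv ℝ n h (complexify d u)‖ * 1 := by
        refine mul_le_mul_of_nonneg_left h3 (norm_nonneg _)
    _ ≤ _ := by rw [mul_one]; exact hC h hh _ r B hr hB

/-- An entire function which is bounded near every real point `u`, on a scale `1 / (1 + ‖u‖)`, has
temperate growth on real points. -/
lemma hasTemperateGrowth_of_bounded {h : EuclideanSpace ℂ (Fin d) → ℂ} (hh : ContDiff ℂ ⊤ h) {B : ℝ}
    (hB : ∀ (u : EuclideanSpace ℝ (Fin d)), ∀ z ∈ Metric.ball (complexify d u) (1 / (1 + ‖u‖)),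
      ‖h z‖ ≤ B) :
    Function.HasTemperateGrowth fun u => h (complexify d u) := by
  refine ⟨contDiff_comp_complexify hh, fun n => ?_⟩
  obtain ⟨C, hC0, hC⟩ := exists_cauchy_bound_real d n
  refine ⟨n, C * B, fun u => ?_⟩
  refine (hC h hh u _ B (by positivity) (hB u)).trans (le_of_eq ?_)
  rw [one_div, inv_pow, div_inv_eq_mul]

/-- The multiplier `χ h` has a kernel whose `L¹` norm is controlled by the supremum of the entire
function `h` on a complex neighbourhood of the support of `χ`. -/
lemma exists_kernel_of_bounded {χ : EuclideanSpace ℝ (Fin d) → ℂ}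
    (hχ : ContDiff ℝ ((⊤ : ℕ∞) : WithTop ℕ∞) χ) (hχc : HasCompactSupport χ) {δ : ℝ} (hδ : 0 < δ) :
    ∃ C : ℝ, 0 ≤ C ∧ ∀ h : EuclideanSpace ℂ (Fin d) → ℂ, ContDiff ℂ ⊤ h → ∀ B : ℝ, 0 ≤ B →
      (∀ u ∈ tsupport χ, ∀ z ∈ Metric.ball (complexify d u) δ, ‖h z‖ ≤ B) →
      ∃ k : 𝓢(EuclideanSpace ℝ (Fin d), ℂ),
        (∀ u, 𝓕 k u = χ u * h (complexify d u)) ∧ ∫ x, ‖k x‖ ≤ C * B := by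
  -- the `L¹` norm of the inverse Fourier transform is a continuous seminorm on Schwartz functions
  let L : 𝓢(EuclideanSpace ℝ (Fin d), ℂ) →L[ℂ] Lp ℂ 1 (volume : Measure (EuclideanSpace ℝ (Fin
    d))) :=
    (SchwartzMap.toLpCLM ℂ ℂ 1 volume) ∘L
      (FourierTransform.fourierInvCLM ℂ 𝓢(EuclideanSpace ℝ (Fin d), ℂ))
  let q : Seminorm ℂ 𝓢(EuclideanSpace ℝ (Fin d), ℂ) := (normSeminorm ℂ _).comp L.toLinearMap
  have hq : Continuous q := continuous_norm.comp L.continuous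
  obtain ⟨s, C, -, hsC⟩ := Seminorm.bound_of_continuous
    (schwartz_withSeminorms ℂ (EuclideanSpace ℝ (Fin d)) ℂ) q hq
  obtain ⟨r, hr⟩ : ∃ r : ℝ, ∀ u ∈ tsupport χ, ‖u‖ ≤ r := hχc.isCompact.isBounded.exists_norm_le
  have hsemi : ∀ p : ℕ × ℕ, ∃ D : ℝ, 0 ≤ D ∧ ∀ h : EuclideanSpace ℂ (Fin d) → ℂ, ContDiff ℂ ⊤ h →
      ∀ B : ℝ, 0 ≤ B → (∀ u ∈ tsupport χ, ∀ z ∈ Metric.ball (complexify d u) δ, ‖h z‖ ≤ B) →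
      ∀ u, ‖u‖ ^ p.1 * ‖iteratedFDeriv ℝ p.2 (fun u => χ u * h (complexify d u)) u‖ ≤ D * B := by
    rintro ⟨k, n⟩
    choose c hc0 hc using exists_cauchy_bound_real d
    have hχb : ∀ i : ℕ, ∃ a : ℝ, 0 ≤ a ∧ ∀ u, ‖iteratedFDeriv ℝ i χ u‖ ≤ a := by
      intro i
      have hcont : Continuous fun u => ‖iteratedFDeriv ℝ i χ u‖ :=
        (hχ.continuous_iteratedFDeriv (by exact_mod_cast le_top)).norm
      obtain ⟨u₀, hu₀⟩ := hcont.exists_forall_ge_of_hasCompactSupport (hχc.iteratedFDeriv i).norm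
      exact ⟨_, norm_nonneg _, hu₀⟩
    choose a ha0 ha using hχb
    refine ⟨|r| ^ k * ∑ i ∈ Finset.range (n + 1), (n.choose i : ℝ) * a i * (c (n - i) / δ ^ (n -
      i)),
      ?_, fun h hh B hB0 hB u => ?_⟩
    · refine mul_nonneg (by positivity) (Finset.sum_nonneg fun i _ => ?_)
      have := ha0 i; have := hc0 (n - i); positivity
    by_cases hu : u ∈ tsupport χ
    · have h1 := norm_iteratedFDeriv_mul_le (N := ((⊤ : ℕ∞) : WithTop ℕ∞)) hχ
        (contDiff_comp_complexify hh) u (n := n) (by exact_mod_cast le_top)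
      dsimp only
      calc _ ≤ |r| ^ k * ∑ i ∈ Finset.range (n + 1),
            (n.choose i : ℝ) * a i * (c (n - i) * B / δ ^ (n - i)) := by
            gcongr
            · exact (hr u hu).trans (le_abs_self r)
            · refine h1.trans (Finset.sum_le_sum fun i _ => ?_)
              have := ha0 i
              gcongr
              · exact ha i u
              · exact hc _ h hh u δ B hδ (hB u hu)
        _ = _ := by
            rw [mul_assoc, Finset.sum_mul]
            congr 1
            exact Finset.sum_congr rfl fun i _ => by ring
    · have h0 : iteratedFDeriv ℝ n (fun u => χ u * h (complexify d u)) u = 0 := by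
        by_contra hne
        have h1 := support_iteratedFDeriv_subset (𝕜 := ℝ) n (Function.mem_support.2 hne)
        exact hu (tsupport_mul_subset_left h1)
      dsimp only
      rw [h0, norm_zero, mul_zero]
      refine mul_nonneg (mul_nonneg (by positivity) (Finset.sum_nonneg fun i _ => ?_)) hB0
      have := ha0 i; have := hc0 (n - i); positivity
  choose D hD0 hD using hsemi
  refine ⟨C * ∑ p ∈ s, D p, mul_nonneg C.2 (Finset.sum_nonneg fun p _ => hD0 p),
    fun h hh B hB0 hB => ?_⟩
  let m : 𝓢(EuclideanSpace ℝ (Fin d), ℂ) :=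
    HasCompactSupport.toSchwartzMap (f := fun u => χ u * h (complexify d u)) hχc.mul_right
      (hχ.mul (contDiff_comp_complexify hh))
  refine ⟨𝓕⁻ m, fun u => ?_, ?_⟩
  · rw [FourierTransform.fourier_fourierInv_eq]
    rfl
  · have h1 := hsC m
    have h2 : q m = ∫ x, ‖(𝓕⁻ m) x‖ := SchwartzMap.norm_toLp_one
    rw [← h2]
    refine h1.trans ?_
    have h3 : s.sup (schwartzSeminormFamily ℂ (EuclideanSpace ℝ (Fin d)) ℂ) m ≤
        (∑ p ∈ s, D p) * B := by
      refine Seminorm.finset_sup_apply_le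
        (mul_nonneg (Finset.sum_nonneg fun p _ => hD0 p) hB0) fun p hp => ?_
      refine (SchwartzMap.seminorm_le_bound ℂ p.1 p.2 m (mul_nonneg (hD0 p) hB0)
        (hD p h hh B hB0 hB)).trans ?_
      gcongr
      exact Finset.single_le_sum (fun p _ => hD0 p) hp
    rw [mul_assoc]
    exact mul_le_mul_of_nonneg_left h3 C.2

end

section

/-! ### Fourier multipliers with integrable kernel on `L^p` -/

variable {d : ℕ} {p : ℝ≥0∞} [Fact (1 ≤ p)]

/-- The space `L^p(ℝᵈ)` of complex-valued functions. -/
abbrev LpRd (d : ℕ) (p : ℝ≥0∞) := Lp ℂ p (volume : Measure (EuclideanSpace ℝ (Fin d)))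

/-- Testing an `L^p` function against a Schwartz function, as a bounded functional on `L^p`. -/
def testCLM (p : ℝ≥0∞) [Fact (1 ≤ p)] (φ : 𝓢(EuclideanSpace ℝ (Fin d), ℂ)) : LpRd d p →L[ℂ] ℂ :=
  (PointwiseConvergenceCLM.evalCLM (RingHom.id ℂ) ℂ φ) ∘L
    (Lp.toTemperedDistributionCLM ℂ volume p)

@[simp]
lemma testCLM_apply (φ : 𝓢(EuclideanSpace ℝ (Fin d), ℂ)) (v : LpRd d p) :
    testCLM p φ v = Lp.toTemperedDistribution v φ := rfl

/-- An `L^p` function is determined by its distribution. -/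
lemma toTemperedDistribution_injective :
    Function.Injective (Lp.toTemperedDistribution : LpRd d p → 𝓢'(EuclideanSpace ℝ (Fin d), ℂ))
      := by
  intro v w h
  have h1 : Lp.toTemperedDistributionCLM ℂ volume p (v - w) = 0 := by
    rw [map_sub, sub_eq_zero]
    exact h
  have h2 : v - w ∈ (Lp.toTemperedDistributionCLM ℂ (volume : Measure (EuclideanSpace ℝ (Fin
    d))) p).ker := h1
  rw [Lp.ker_toTemperedDistributionCLM_eq_bot, Submodule.mem_bot, sub_eq_zero] at h2
  exact h2

lemma eq_of_testCLM_eq {v w : LpRd d p} (h : ∀ φ, testCLM p φ v = testCLM p φ w) : v = w :=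
  toTemperedDistribution_injective (by ext φ; exact h φ)

/-- Translation on `L^p`: `(translate a v)(x) = v (x - a)`. -/
def translate (a : EuclideanSpace ℝ (Fin d)) (v : LpRd d p) : LpRd d p :=
  Lp.compMeasurePreservingₗᵢ ℂ (fun x => x - a) (measurePreserving_sub_right volume a) v

@[simp]
lemma norm_translate (a : EuclideanSpace ℝ (Fin d)) (v : LpRd d p) : ‖translate a v‖ = ‖v‖ :=
  LinearIsometry.norm_map _ v

lemma translate_zero (v : LpRd d p) : translate 0 v = v := by
  apply Lp.ext
  refine (Lp.coeFn_compMeasurePreserving v (measurePreserving_sub_right volume 0)).trans ?_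
  simp [Function.comp_def]

lemma continuous_translate (hp : p ≠ ∞) (v : LpRd d p) :
    Continuous fun a : EuclideanSpace ℝ (Fin d) => translate a v := by
  let g : C(EuclideanSpace ℝ (Fin d), C(EuclideanSpace ℝ (Fin d), EuclideanSpace ℝ (Fin d))) :=
    ContinuousMap.curry ⟨fun z => z.2 - z.1, by fun_prop⟩
  exact (continuous_const (y := v)).compMeasurePreservingLp g.continuous
    (fun a => measurePreserving_sub_right volume a) hp

lemma integrable_smul_translate (hp : p ≠ ∞) (k : 𝓢(EuclideanSpace ℝ (Fin d), ℂ)) (s : ℝ)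
    (v : LpRd d p) : Integrable fun y => k y • translate (s • y) v := by
  refine (k.integrable.norm.mul_const ‖v‖).mono' ?_ (Filter.Eventually.of_forall fun y => ?_)
  · exact (k.continuous.smul ((continuous_translate hp v).comp
      (continuous_const_smul s))).aestronglyMeasurable
  · rw [norm_smul, norm_translate]

/-- The convolution `v ↦ ∫ k(y) v(· - s y) dy` with a rescaled Schwartz kernel. By
`toTemperedDistribution_convOp` it is the Fourier multiplier with symbol `ξ ↦ (𝓕 k)(s ξ)`. -/
def convOp (hp : p ≠ ∞) (k : 𝓢(EuclideanSpace ℝ (Fin d), ℂ)) (s : ℝ) : LpRd d p →L[ℂ] LpRd d p :=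
  LinearMap.mkContinuous
    { toFun := fun v => ∫ y, k y • translate (s • y) v
      map_add' := fun v w => by
        rw [← integral_add (integrable_smul_translate hp k s v) (integrable_smul_translate hp k
          s w)]
        simp only [translate, map_add, smul_add]
      map_smul' := fun c v => by
        rw [RingHom.id_apply, ← integral_smul]
        simp only [translate, map_smul, smul_comm c] }
    (∫ y, ‖k y‖) fun v => by
      refine (norm_integral_le_integral_norm _).trans (le_of_eq ?_)
      simp only [norm_smul, norm_translate]
      exact integral_mul_const _ _

lemma convOp_apply (hp : p ≠ ∞) (k : 𝓢(EuclideanSpace ℝ (Fin d), ℂ)) (s : ℝ) (v : LpRd d p) :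
    convOp hp k s v = ∫ y, k y • translate (s • y) v := rfl

lemma norm_convOp_le (hp : p ≠ ∞) (k : 𝓢(EuclideanSpace ℝ (Fin d), ℂ)) (s : ℝ) :
    ‖convOp (d := d) hp k s‖ ≤ ∫ y, ‖k y‖ :=
  LinearMap.mkContinuous_norm_le _ (integral_nonneg fun _ => norm_nonneg _) _

lemma hasTemperateGrowth_comp_smul {g : EuclideanSpace ℝ (Fin d) → ℂ}
    (hg : g.HasTemperateGrowth) (s : ℝ) :
    Function.HasTemperateGrowth fun ξ => g (s • ξ) :=
  hg.comp (s • ContinuousLinearMap.id ℝ (EuclideanSpace ℝ (Fin d))).hasTemperateGrowth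

lemma fourier_smul_fourierInv_apply (k φ : 𝓢(EuclideanSpace ℝ (Fin d), ℂ)) (s : ℝ)
    (x : EuclideanSpace ℝ (Fin d)) :
    𝓕 (SchwartzMap.smulLeftCLM ℂ (fun ξ => 𝓕 k (s • ξ)) (𝓕⁻ φ)) x = ∫ y, k y * φ (x + s • y) := by
  have hg : Function.HasTemperateGrowth fun ξ => 𝓕 k (s • ξ) :=
    hasTemperateGrowth_comp_smul (𝓕 k).hasTemperateGrowth s
  have hint : Integrable (fun z : EuclideanSpace ℝ (Fin d) × EuclideanSpace ℝ (Fin d) =>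
      Real.fourierChar (-inner ℝ z.1 (x + s • z.2)) • (k z.2 * 𝓕⁻ φ z.1)) (volume.prod volume) := by
    have h1 : Integrable (fun z : EuclideanSpace ℝ (Fin d) × EuclideanSpace ℝ (Fin d) =>
        (k z.2 * 𝓕⁻ φ z.1)) (volume.prod volume) := by
      refine ((𝓕⁻ φ).integrable.mul_prod k.integrable).congr ?_
      exact Filter.Eventually.of_forall fun z => mul_comm _ _
    refine h1.mono ?_ (Filter.Eventually.of_forall fun z => by simp)
    refine Continuous.aestronglyMeasurable ?_
    have := k.continuous
    have := (𝓕⁻ φ).continuous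
    have := Real.continuous_fourierChar
    simp only [Circle.smul_def]
    fun_prop
  calc 𝓕 (SchwartzMap.smulLeftCLM ℂ (fun ξ => 𝓕 k (s • ξ)) (𝓕⁻ φ)) x
      = ∫ ξ, ∫ y, Real.fourierChar (-inner ℝ ξ (x + s • y)) • (k y * 𝓕⁻ φ ξ) := by
        rw [SchwartzMap.fourier_coe, Real.fourier_eq]
        refine integral_congr_ae (Filter.Eventually.of_forall fun ξ => ?_)
        dsimp only
        rw [SchwartzMap.smulLeftCLM_apply_apply hg, SchwartzMap.fourier_coe k, Real.fourier_eq,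
          Circle.smul_def, smul_eq_mul, smul_eq_mul, ← integral_mul_const, ← integral_const_mul]
        refine integral_congr_ae (Filter.Eventually.of_forall fun y => ?_)
        simp only [Circle.smul_def, smul_eq_mul]
        rw [← mul_assoc, ← mul_assoc, ← Circle.coe_mul, ← AddChar.map_add_eq_mul, mul_assoc]
        congr 3
        rw [inner_add_right, inner_smul_right, inner_smul_right, real_inner_comm y ξ]
        ring
    _ = ∫ y, ∫ ξ, Real.fourierChar (-inner ℝ ξ (x + s • y)) • (k y * 𝓕⁻ φ ξ) :=
        integral_integral_swap hint
    _ = ∫ y, k y * φ (x + s • y) := by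
        refine integral_congr_ae (Filter.Eventually.of_forall fun y => ?_)
        dsimp only
        have hinv : φ (x + s • y) = 𝓕 (𝓕⁻ φ) (x + s • y) := by
          rw [FourierTransform.fourier_fourierInv_eq]
        rw [hinv, SchwartzMap.fourier_coe (𝓕⁻ φ), Real.fourier_eq, ← integral_const_mul]
        refine integral_congr_ae (Filter.Eventually.of_forall fun ξ => ?_)
        simp only [Circle.smul_def, smul_eq_mul]
        ring

lemma testCLM_translate_toLp (φ f : 𝓢(EuclideanSpace ℝ (Fin d), ℂ))
    (a : EuclideanSpace ℝ (Fin d)) :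
    testCLM p φ (translate a (f.toLp p)) = ∫ x, φ (x + a) * f x := by
  have h1 : (fun x => φ x • translate a (f.toLp p) x) =ᵐ[volume] fun x => φ x * f (x - a) := by
    have h2 := Lp.coeFn_compMeasurePreserving (f.toLp p) (measurePreserving_sub_right volume a)
    have h3 := (measurePreserving_sub_right volume a).quasiMeasurePreserving.ae_eq_comp
      (f.coeFn_toLp p volume)
    filter_upwards [h2, h3] with x hx hx'
    simp only [Function.comp_apply] at hx hx'
    rw [smul_eq_mul, ← hx', ← hx]
    rfl
  rw [testCLM_apply, Lp.toTemperedDistribution_apply, integral_congr_ae h1]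
  rw [← integral_add_right_eq_self _ a]
  simp

lemma testCLM_convOp_toLp (hp : p ≠ ∞) (k φ f : 𝓢(EuclideanSpace ℝ (Fin d), ℂ)) (s : ℝ) :
    testCLM p φ (convOp hp k s (f.toLp p)) = ∫ y, ∫ x, φ (x + s • y) * (k y * f x) := by
  rw [convOp_apply, ← ContinuousLinearMap.integral_comp_comm _ (integrable_smul_translate hp k s _)]
  refine integral_congr_ae (Filter.Eventually.of_forall fun y => ?_)
  dsimp only
  rw [map_smul, testCLM_translate_toLp, smul_eq_mul, ← integral_const_mul]
  refine integral_congr_ae (Filter.Eventually.of_forall fun x => ?_)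
  dsimp only
  ring

lemma testCLM_toLp (ψ f : 𝓢(EuclideanSpace ℝ (Fin d), ℂ)) :
    testCLM p ψ (f.toLp p) = ∫ x, ψ x * f x := by
  rw [testCLM_apply, Lp.toTemperedDistribution_toLp_eq,
    SchwartzMap.toTemperedDistributionCLM_apply_apply volume]
  rfl

/-- `convOp` is a Fourier multiplier. On Schwartz functions this is Fubini's theorem; the general
case follows by density. -/
lemma toTemperedDistribution_convOp (hp : p ≠ ∞) (k : 𝓢(EuclideanSpace ℝ (Fin d), ℂ)) (s : ℝ)
    (v : LpRd d p) :
    Lp.toTemperedDistribution (convOp hp k s v) =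
      TemperedDistribution.fourierMultiplierCLM ℂ (fun ξ => 𝓕 k (s • ξ))
        (Lp.toTemperedDistribution v) := by
  ext φ
  rw [TemperedDistribution.fourierMultiplierCLM_apply_apply]
  obtain ⟨ψ, hψ⟩ : ∃ ψ, ψ = 𝓕 (SchwartzMap.smulLeftCLM ℂ (fun ξ => 𝓕 k (s • ξ)) (𝓕⁻ φ)) := ⟨_, rfl⟩
  rw [← hψ, ← testCLM_apply, ← testCLM_apply]
  have key : ∀ f : 𝓢(EuclideanSpace ℝ (Fin d), ℂ),
      testCLM p φ (convOp hp k s (f.toLp p)) = testCLM p ψ (f.toLp p) := by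
    intro f
    have hint : Integrable (fun z : EuclideanSpace ℝ (Fin d) × EuclideanSpace ℝ (Fin d) =>
        φ (z.2 + s • z.1) * (k z.1 * f z.2)) (volume.prod volume) := by
      refine (k.integrable.mul_prod f.integrable).bdd_mul (c := SchwartzMap.seminorm ℝ 0 0 φ) ?_ ?_
      · have := φ.continuous
        exact Continuous.aestronglyMeasurable (by fun_prop)
      · exact Filter.Eventually.of_forall fun z => φ.norm_le_seminorm ℝ _
    rw [testCLM_convOp_toLp, testCLM_toLp, integral_integral_swap hint]
    refine integral_congr_ae (Filter.Eventually.of_forall fun x => ?_)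
    dsimp only
    rw [hψ, fourier_smul_fourierInv_apply, ← integral_mul_const]
    refine integral_congr_ae (Filter.Eventually.of_forall fun y => ?_)
    dsimp only
    ring
  -- both sides are continuous in `v`, so it suffices to treat Schwartz functions
  exact (SchwartzMap.denseRange_toLpCLM (E := EuclideanSpace ℝ (Fin d)) (F := ℂ) hp
    (μ := volume)).induction_on v (isClosed_eq
      ((testCLM p φ).continuous.comp (convOp hp k s).continuous) (testCLM p ψ).continuous)
    key

end

section

/-! ### Spectral localisation -/

variable {d : ℕ} {p : ℝ≥0∞} [Fact (1 ≤ p)]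

open scoped Manifold in
/-- A tempered distribution vanishes on compactly supported test functions whose support avoids the
support of the distribution. -/
lemma apply_eq_zero_of_disjoint_dsupport (T : 𝓢'(EuclideanSpace ℝ (Fin d), ℂ))
    (φ : 𝓢(EuclideanSpace ℝ (Fin d), ℂ)) (hφ : HasCompactSupport φ)
    (hdisj : Disjoint (tsupport φ) (Distribution.dsupport T)) : T φ = 0 := by
  have hU : ∀ x ∈ tsupport φ, ∃ U : Set (EuclideanSpace ℝ (Fin d)),
      Distribution.IsVanishingOn T U ∧ IsOpen U ∧ x ∈ U := fun x hx =>
    (Distribution.notMem_dsupport_iff x).1 (Set.disjoint_left.1 hdisj hx)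
  choose! U hUv hUo hUx using hU
  obtain ⟨t, htφ, ht⟩ := IsCompact.elim_nhds_subcover (s := tsupport φ) hφ U
    fun x hx => (hUo x hx).mem_nhds (hUx x hx)
  obtain ⟨ρ, hρ⟩ := SmoothPartitionOfUnity.exists_isSubordinate 𝓘(ℝ, EuclideanSpace ℝ (Fin d))
    (isClosed_tsupport φ) (fun i : t => U i) (fun i => hUo i (htφ i i.2))
    (fun x hx => by
      obtain ⟨i, hi, hxi⟩ := Set.mem_iUnion₂.1 (ht hx)
      exact Set.mem_iUnion.2 ⟨⟨i, hi⟩, hxi⟩)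
  have hsmooth : ∀ i, ContDiff ℝ ((⊤ : ℕ∞) : WithTop ℕ∞) fun x => ((ρ i x : ℝ) : ℂ) * φ x := fun
    i =>
    (Complex.ofRealCLM.contDiff.comp (ρ i).contMDiff.contDiff).mul (φ.smooth _)
  have hcs : ∀ i, HasCompactSupport fun x => ((ρ i x : ℝ) : ℂ) * φ x := fun i => hφ.mul_left
  have hsum : φ = ∑ i, (hcs i).toSchwartzMap (hsmooth i) := by
    ext x
    rw [_root_.sum_apply]
    simp only [HasCompactSupport.toSchwartzMap_toFun]
    rw [← Finset.sum_mul]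
    by_cases hx : x ∈ tsupport φ
    · have h1 := ρ.sum_eq_one hx
      rw [finsum_eq_sum_of_fintype] at h1
      rw [← Complex.ofReal_sum, h1]
      simp
    · rw [image_eq_zero_of_notMem_tsupport hx, mul_zero]
  rw [hsum, map_sum]
  refine Finset.sum_eq_zero fun i _ => hUv i (htφ i i.2) _ ?_
  refine (tsupport_mul_subset_left (f := fun x => ((ρ i x : ℝ) : ℂ)) (g := φ)).trans ?_
  refine subset_trans ?_ (hρ i)
  exact closure_mono fun x hx => by
    simp only [Function.mem_support, ne_eq, Complex.ofReal_eq_zero] at hx ⊢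
    exact hx

/-- Concentrating kernels form an approximate identity on `L^p`. -/
lemma tendsto_convOp (hp : p ≠ ∞) (k : 𝓢(EuclideanSpace ℝ (Fin d), ℂ)) (hk : 𝓕 k 0 = 1)
    (v : LpRd d p) :
    Filter.Tendsto (fun s : ℝ => convOp hp k s v) (nhds 0) (nhds v) := by
  have h1 : ∫ y, k y = 1 := by
    rw [← hk, SchwartzMap.fourier_coe, Real.fourier_eq]
    simp
  have h2 : v = ∫ y, k y • translate ((0 : ℝ) • y) v := by
    simp_rw [zero_smul, translate_zero]
    rw [integral_smul_const, h1, one_smul]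
  conv_rhs => rw [h2]
  refine tendsto_integral_filter_of_dominated_convergence (fun y => ‖k y‖ * ‖v‖) ?_ ?_
    (k.integrable.norm.mul_const _) ?_
  · exact Filter.Eventually.of_forall fun s => (integrable_smul_translate hp k s v).1
  · exact Filter.Eventually.of_forall fun s => Filter.Eventually.of_forall fun y => by
      rw [norm_smul, norm_translate]
  · refine Filter.Eventually.of_forall fun y => ?_
    have : Continuous fun s : ℝ => k y • translate (s • y) v :=
      ((continuous_translate hp v).comp
        (continuous_id.smul continuous_const : Continuous fun s : ℝ => s • y)).const_smul (k y)
    exact this.tendsto 0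

/-- There is a Schwartz kernel with compactly supported Fourier transform equal to `1` at `0`. -/
lemma exists_bandlimited_kernel (d : ℕ) :
    ∃ k : 𝓢(EuclideanSpace ℝ (Fin d), ℂ), 𝓕 k 0 = 1 ∧
      HasCompactSupport fun ξ => 𝓕 k ξ := by
  let b : ContDiffBump (0 : EuclideanSpace ℝ (Fin d)) := ⟨1, 2, by norm_num, by norm_num⟩
  have hc : HasCompactSupport fun x => ((b x : ℝ) : ℂ) :=
    b.hasCompactSupport.comp_left (g := fun r : ℝ => (r : ℂ)) (by simp)
  have hs : ContDiff ℝ ((⊤ : ℕ∞) : WithTop ℕ∞) fun x => ((b x : ℝ) : ℂ) :=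
    Complex.ofRealCLM.contDiff.comp b.contDiff
  refine ⟨𝓕⁻ (hc.toSchwartzMap hs), ?_, ?_⟩
  · rw [FourierTransform.fourier_fourierInv_eq, HasCompactSupport.toSchwartzMap_toFun,
      b.one_of_mem_closedBall (Metric.mem_closedBall_self b.rIn_pos.le)]
    simp
  · simp_rw [FourierTransform.fourier_fourierInv_eq]
    exact hc

/-- A multiplier which is equal to `1` near the spectrum of `v` leaves `v` unchanged. The support of
a distribution is only tested by compactly supported functions, so the difference is first
mollified by a band-limited kernel at scale `r`, and then `r → 0`. -/
lemma convOp_eq_self (hp : p ≠ ∞) (k : 𝓢(EuclideanSpace ℝ (Fin d), ℂ)) (s : ℝ) (v : LpRd d p)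
    {U : Set (EuclideanSpace ℝ (Fin d))} (hU : IsOpen U)
    (hv : Distribution.dsupport (𝓕 (Lp.toTemperedDistribution v) :
      𝓢'(EuclideanSpace ℝ (Fin d), ℂ)) ⊆ U)
    (hk : ∀ ξ ∈ U, 𝓕 k (s • ξ) = 1) : convOp hp k s v = v := by
  obtain ⟨k₀, hk₀, hk₀c⟩ := exists_bandlimited_kernel d
  rw [eq_comm, ← sub_eq_zero]
  set w := v - convOp hp k s v with hw
  have hg : Function.HasTemperateGrowth fun ξ => 𝓕 k (s • ξ) :=
    hasTemperateGrowth_comp_smul (𝓕 k).hasTemperateGrowth s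
  have hcut : ∀ r : ℝ, r ≠ 0 → convOp hp k₀ r w = 0 := by
    intro r hr
    have hg₀ : Function.HasTemperateGrowth fun ξ => 𝓕 k₀ (r • ξ) :=
      hasTemperateGrowth_comp_smul (𝓕 k₀).hasTemperateGrowth r
    -- testing against `φ` means testing the Fourier transform of `v` against a test function
    -- which vanishes on `U`
    refine eq_of_testCLM_eq fun φ => ?_
    rw [hw, map_sub, map_sub, map_zero]
    simp only [testCLM_apply, toTemperedDistribution_convOp]
    rw [TemperedDistribution.fourierMultiplierCLM_fourierMultiplierCLM_apply hg hg₀]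
    simp only [TemperedDistribution.fourierMultiplierCLM_apply_apply,
      ← TemperedDistribution.fourier_apply]
    rw [← map_sub]
    refine apply_eq_zero_of_disjoint_dsupport _ _ ?_ ?_
    · have : HasCompactSupport fun ξ => 𝓕 k₀ (r • ξ) :=
        hk₀c.comp_homeomorph (Homeomorph.smulOfNeZero r hr)
      refine this.mono fun ξ hξ => ?_
      contrapose! hξ
      simp only [Function.mem_support, ne_eq, not_not] at hξ ⊢
      rw [_root_.sub_apply, SchwartzMap.smulLeftCLM_apply_apply hg₀,
        SchwartzMap.smulLeftCLM_apply_apply (hg.mul hg₀)]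
      simp [hξ]
    · refine Disjoint.mono_right hv ?_
      rw [← Set.subset_compl_iff_disjoint_right]
      refine closure_minimal (fun ξ hξ hξU => hξ ?_) hU.isClosed_compl
      rw [_root_.sub_apply, SchwartzMap.smulLeftCLM_apply_apply hg₀,
        SchwartzMap.smulLeftCLM_apply_apply (hg.mul hg₀), Pi.mul_apply, hk ξ hξU, one_mul, sub_self]
  have h1 := (tendsto_convOp hp k₀ hk₀ w).mono_left
    (nhdsWithin_le_nhds (s := {0}ᶜ))
  have h2 : Filter.Tendsto (fun s : ℝ => convOp hp k₀ s w) (nhdsWithin 0 {0}ᶜ) (nhds 0) :=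
    tendsto_const_nhds.congr' (by
      filter_upwards [self_mem_nhdsWithin] with r hr
      exact (hcut r hr).symm)
  exact tendsto_nhds_unique h1 h2

end

section

/-! ### The symbol calculus on spectrally localised functions -/

/-- The algebra of entire functions on `ℂᵈ`. -/
def Entire (d : ℕ) : Subalgebra ℂ (EuclideanSpace ℂ (Fin d) → ℂ) where
  carrier := {h | ContDiff ℂ ⊤ h}
  mul_mem' {f g} (hf : ContDiff ℂ ⊤ f) (hg : ContDiff ℂ ⊤ g) := hf.mul hg
  add_mem' {f g} (hf : ContDiff ℂ ⊤ f) (hg : ContDiff ℂ ⊤ g) := hf.add hg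
  algebraMap_mem' c := (contDiff_const : ContDiff ℂ ⊤ fun _ : EuclideanSpace ℂ (Fin d) => c)

lemma Entire.contDiff {d : ℕ} (h : Entire d) : ContDiff ℂ ⊤ (h : EuclideanSpace ℂ (Fin d) → ℂ) :=
  h.2

/-- Evaluation of an entire function at a point. -/
def Entire.eval {d : ℕ} (z : EuclideanSpace ℂ (Fin d)) : Entire d →ₐ[ℂ] ℂ :=
  (Pi.evalAlgHom ℂ (fun _ : EuclideanSpace ℂ (Fin d) => ℂ) z).comp (Entire d).val

/-- A smooth, compactly supported cutoff function on the frequency space `ℝᵈ`. -/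
structure Cutoff (d : ℕ) where
  /-- the underlying function -/
  toFun : EuclideanSpace ℝ (Fin d) → ℂ
  smooth : ContDiff ℝ ((⊤ : ℕ∞) : WithTop ℕ∞) toFun
  hasCompactSupport : HasCompactSupport toFun

variable {d : ℕ} {p : ℝ≥0∞} [Fact (1 ≤ p)]

lemma eq_of_fourier_eq {f g : 𝓢(EuclideanSpace ℝ (Fin d), ℂ)}
    (h : ∀ u, 𝓕 f u = 𝓕 g u) : f = g := by
  have : 𝓕 f = 𝓕 g := by
    ext u
    exact h u
  have h2 : 𝓕⁻ (𝓕 f) = 𝓕⁻ (𝓕 g) := by rw [this]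
  rwa [FourierTransform.fourierInv_fourier_eq, FourierTransform.fourierInv_fourier_eq] at h2

/-- The Schwartz kernel whose Fourier transform is `χ h`. -/
def Cutoff.kernel (χ : Cutoff d) (h : Entire d) : 𝓢(EuclideanSpace ℝ (Fin d), ℂ) :=
  𝓕⁻ (HasCompactSupport.toSchwartzMap
    (f := fun u => χ.toFun u * (h : EuclideanSpace ℂ (Fin d) → ℂ) (complexify d u))
    χ.hasCompactSupport.mul_right (χ.smooth.mul (contDiff_comp_complexify (Entire.contDiff h))))

lemma Cutoff.fourier_kernel (χ : Cutoff d) (h : Entire d) (u : EuclideanSpace ℝ (Fin d)) :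
    𝓕 (χ.kernel h) u = χ.toFun u * Entire.eval (complexify d u) h := by
  rw [Cutoff.kernel, FourierTransform.fourier_fourierInv_eq]
  rfl

/-- The `L^p` functions whose spectrum lies where the rescaled cutoff `ξ ↦ χ(s ξ)` equals `1`,
in the form that they are fixed by the corresponding multiplier. -/
def localisedSubmodule (hp : p ≠ ∞) (χ : Cutoff d) (s : ℝ) : Submodule ℂ (LpRd d p) :=
  (convOp (d := d) hp (χ.kernel 1) s - ContinuousLinearMap.id ℂ (LpRd d p)).ker

/-- The Banach space of spectrally localised `L^p` functions, as a type with its own instances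
rather than as a coerced submodule, so that the definition of `convOp` is not unfolded when
instances are compared. -/
def Localised (hp : p ≠ ∞) (χ : Cutoff d) (s : ℝ) : Type := localisedSubmodule hp χ s

variable (hp : p ≠ ∞) (χ : Cutoff d) (s : ℝ)

instance : NormedAddCommGroup (Localised hp χ s) :=
  inferInstanceAs (NormedAddCommGroup (localisedSubmodule hp χ s))

instance : NormedSpace ℂ (Localised hp χ s) :=
  inferInstanceAs (NormedSpace ℂ (localisedSubmodule hp χ s))

instance : CompleteSpace (Localised hp χ s) :=
  ContinuousLinearMap.completeSpace_ker
    (convOp (d := d) hp (χ.kernel 1) s - ContinuousLinearMap.id ℂ (LpRd d p))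

/-- The inclusion of the localised functions into `L^p`. -/
def incl : Localised hp χ s →L[ℂ] LpRd d p := (localisedSubmodule hp χ s).subtypeL

lemma norm_incl (v : Localised hp χ s) : ‖incl hp χ s v‖ = ‖v‖ := rfl

lemma incl_injective : Function.Injective (incl hp χ s) := Subtype.coe_injective

lemma convOp_incl (v : Localised hp χ s) :
    convOp hp (χ.kernel 1) s (incl hp χ s v) = incl hp χ s v :=
  sub_eq_zero.1 (LinearMap.mem_ker.1 v.2)

lemma exists_incl_eq {v : LpRd d p} (hv : convOp hp (χ.kernel 1) s v = v) :
    ∃ w, incl hp χ s w = v :=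
  ⟨⟨v, LinearMap.mem_ker.2 (sub_eq_zero.2 hv)⟩, rfl⟩

lemma hasTemperateGrowth_cutoff (h : Entire d) :
    Function.HasTemperateGrowth fun ξ : EuclideanSpace ℝ (Fin d) =>
      χ.toFun (s • ξ) * Entire.eval (complexify d (s • ξ)) h := by
  simp_rw [← Cutoff.fourier_kernel]
  exact hasTemperateGrowth_comp_smul (𝓕 (χ.kernel h)).hasTemperateGrowth s

lemma toTemperedDistribution_convOp_kernel (h : Entire d) (v : LpRd d p) :
    Lp.toTemperedDistribution (convOp hp (χ.kernel h) s v) =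
      TemperedDistribution.fourierMultiplierCLM ℂ
        (fun ξ => χ.toFun (s • ξ) * Entire.eval (complexify d (s • ξ)) h)
        (Lp.toTemperedDistribution v) := by
  rw [toTemperedDistribution_convOp]
  simp_rw [Cutoff.fourier_kernel]

lemma convOp_kernel_comm (h g : Entire d) (v : LpRd d p) :
    convOp hp (χ.kernel h) s (convOp hp (χ.kernel g) s v) =
      convOp hp (χ.kernel g) s (convOp hp (χ.kernel h) s v) := by
  apply toTemperedDistribution_injective
  simp only [toTemperedDistribution_convOp_kernel]
  rw [TemperedDistribution.fourierMultiplierCLM_fourierMultiplierCLM_apply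
      (hasTemperateGrowth_cutoff χ s g) (hasTemperateGrowth_cutoff χ s h),
    TemperedDistribution.fourierMultiplierCLM_fourierMultiplierCLM_apply
      (hasTemperateGrowth_cutoff χ s h) (hasTemperateGrowth_cutoff χ s g), mul_comm]

/-- The Fourier multiplier with symbol `ξ ↦ h(s ξ)`, `h` entire, on localised functions. It is
defined with the symbol `χ(s ξ) h(s ξ)`, which has a Schwartz kernel whatever the growth of `h`. -/
def symOp (h : Entire d) : Localised hp χ s →L[ℂ] Localised hp χ s :=
  ((convOp hp (χ.kernel h) s) ∘L (incl hp χ s)).codRestrict (localisedSubmodule hp χ s)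
    fun v => LinearMap.mem_ker.2 (sub_eq_zero.2 (by
      change convOp hp (χ.kernel 1) s (convOp hp (χ.kernel h) s (incl hp χ s v)) =
        convOp hp (χ.kernel h) s (incl hp χ s v)
      rw [convOp_kernel_comm, convOp_incl]))

lemma incl_symOp (h : Entire d) (v : Localised hp χ s) :
    incl hp χ s (symOp hp χ s h v) = convOp hp (χ.kernel h) s (incl hp χ s v) := rfl

/-- Localised functions are reproduced by the multiplier `χ(s ξ)`. -/
lemma toTemperedDistribution_incl (v : Localised hp χ s) :
    Lp.toTemperedDistribution (incl hp χ s v) =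
      TemperedDistribution.fourierMultiplierCLM ℂ (fun ξ => χ.toFun (s • ξ))
        (Lp.toTemperedDistribution (incl hp χ s v)) := by
  conv_lhs => rw [← convOp_incl, toTemperedDistribution_convOp_kernel]
  simp

lemma hasTemperateGrowth_cutoff_one :
    Function.HasTemperateGrowth fun ξ : EuclideanSpace ℝ (Fin d) => χ.toFun (s • ξ) := by
  simpa using hasTemperateGrowth_cutoff χ s (1 : Entire d)

/-- If the symbol has temperate growth, the cutoff is invisible. -/
lemma toTemperedDistribution_symOp {h : Entire d} {g : EuclideanSpace ℝ (Fin d) → ℂ}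
    (hg : g.HasTemperateGrowth) (hgh : ∀ ξ, g ξ = Entire.eval (complexify d (s • ξ)) h)
    (v : Localised hp χ s) :
    Lp.toTemperedDistribution (incl hp χ s (symOp hp χ s h v)) =
      TemperedDistribution.fourierMultiplierCLM ℂ g
        (Lp.toTemperedDistribution (incl hp χ s v)) := by
  rw [incl_symOp, toTemperedDistribution_convOp_kernel]
  conv_rhs => rw [toTemperedDistribution_incl hp χ s v]
  rw [TemperedDistribution.fourierMultiplierCLM_fourierMultiplierCLM_apply
    (hasTemperateGrowth_cutoff_one χ s) hg]
  congr 2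
  ext ξ
  rw [Pi.mul_apply, hgh]

lemma symOp_one : symOp hp χ s 1 = ContinuousLinearMap.id ℂ (Localised hp χ s) := by
  ext1 v
  exact incl_injective hp χ s (convOp_incl hp χ s v)

lemma symOp_mul (h g : Entire d) : symOp hp χ s (h * g) = symOp hp χ s h ∘L symOp hp χ s g := by
  ext1 v
  apply incl_injective
  apply toTemperedDistribution_injective
  rw [ContinuousLinearMap.comp_apply, incl_symOp, incl_symOp, incl_symOp]
  simp only [toTemperedDistribution_convOp_kernel]
  rw [TemperedDistribution.fourierMultiplierCLM_fourierMultiplierCLM_apply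
      (hasTemperateGrowth_cutoff χ s g) (hasTemperateGrowth_cutoff χ s h)]
  conv_lhs => rw [toTemperedDistribution_incl hp χ s v]
  rw [TemperedDistribution.fourierMultiplierCLM_fourierMultiplierCLM_apply
    (hasTemperateGrowth_cutoff_one χ s) (hasTemperateGrowth_cutoff χ s (h * g))]
  congr 2
  ext ξ
  simp only [Pi.mul_apply, map_mul]
  ring

lemma Cutoff.kernel_add (h g : Entire d) : χ.kernel (h + g) = χ.kernel h + χ.kernel g := by
  refine eq_of_fourier_eq fun u => ?_
  rw [FourierTransform.fourier_add, _root_.add_apply]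
  simp only [Cutoff.fourier_kernel, map_add, mul_add]

lemma Cutoff.kernel_smul (c : ℂ) (h : Entire d) : χ.kernel (c • h) = c • χ.kernel h := by
  refine eq_of_fourier_eq fun u => ?_
  rw [FourierTransform.fourier_smul, _root_.smul_apply]
  simp only [Cutoff.fourier_kernel, map_smul, smul_eq_mul]
  ring

lemma symOp_add (h g : Entire d) : symOp hp χ s (h + g) = symOp hp χ s h + symOp hp χ s g := by
  ext1 v
  apply incl_injective
  rw [_root_.add_apply, map_add, incl_symOp, incl_symOp, incl_symOp, χ.kernel_add]
  simp only [convOp_apply, _root_.add_apply, add_smul]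
  exact integral_add (integrable_smul_translate hp _ s _) (integrable_smul_translate hp _ s _)

lemma symOp_smul (c : ℂ) (h : Entire d) : symOp hp χ s (c • h) = c • symOp hp χ s h := by
  ext1 v
  apply incl_injective
  rw [_root_.smul_apply, map_smul, incl_symOp, incl_symOp, χ.kernel_smul]
  simp only [convOp_apply, _root_.smul_apply, smul_assoc]
  exact integral_smul _ _

/-- The multipliers on localised functions form a representation of the algebra of entire
functions. -/
def symHom : Entire d →ₐ[ℂ] (Localised hp χ s →L[ℂ] Localised hp χ s) :=
  AlgHom.ofLinearMap
    { toFun := symOp hp χ s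
      map_add' := symOp_add hp χ s
      map_smul' := symOp_smul hp χ s } (symOp_one hp χ s) (symOp_mul hp χ s)

/-- The norm of a multiplier is controlled by the supremum of its symbol on a complex neighbourhood
of the support of the cutoff, uniformly in the dilation parameter. -/
lemma exists_norm_symHom_le {δ : ℝ} (hδ : 0 < δ) :
    ∃ C : ℝ, 0 ≤ C ∧ ∀ (s : ℝ) (h : Entire d) (B : ℝ), 0 ≤ B →
      (∀ u ∈ tsupport χ.toFun, ∀ z ∈ Metric.ball (complexify d u) δ, ‖Entire.eval z h‖ ≤ B) →
      ‖symHom hp χ s h‖ ≤ C * B := by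
  obtain ⟨C, hC0, hC⟩ := exists_kernel_of_bounded χ.smooth χ.hasCompactSupport hδ
  refine ⟨C, hC0, fun s h B hB hhB => ?_⟩
  obtain ⟨k, hk, hkB⟩ := hC h (Entire.contDiff h) B hB hhB
  have hkk : χ.kernel h = k := eq_of_fourier_eq fun u => by
    rw [hk, Cutoff.fourier_kernel]
    rfl
  refine ContinuousLinearMap.opNorm_le_bound _ (mul_nonneg hC0 hB) fun v => ?_
  change ‖convOp hp (χ.kernel h) s (incl hp χ s v)‖ ≤ _
  rw [hkk, ← norm_incl]
  exact ((convOp hp k s).le_opNorm _).trans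
    (mul_le_mul_of_nonneg_right ((norm_convOp_le hp k s).trans hkB) (norm_nonneg _))

/-! ### Matrices of multipliers -/

variable {l m n : Type} [Fintype n]

/-- The operator defined by a matrix of entire symbols. -/
def matOp (H : Matrix m n (Entire d)) : (n → Localised hp χ s) →L[ℝ] (m → Localised hp χ s) :=
  ContinuousLinearMap.pi fun j => ∑ k, ((symHom hp χ s (H j k)).restrictScalars ℝ) ∘L
    (ContinuousLinearMap.proj k)

lemma matOp_apply (H : Matrix m n (Entire d)) (v : n → Localised hp χ s) (j : m) :
    matOp hp χ s H v j = ∑ k, symOp hp χ s (H j k) (v k) := by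
  simp only [matOp, ContinuousLinearMap.pi_apply, _root_.sum_apply]
  rfl

lemma matOp_mul [Fintype m] (H : Matrix l m (Entire d)) (G : Matrix m n (Entire d)) :
    matOp hp χ s (H * G) = matOp hp χ s H ∘L matOp hp χ s G := by
  ext1 v
  funext j
  have h1 : ∀ k, symOp hp χ s ((H * G) j k) =
      ∑ i, symOp hp χ s (H j i) ∘L symOp hp χ s (G i k) := fun k => by
    change symHom hp χ s ((H * G) j k) = _
    rw [Matrix.mul_apply, map_sum]
    exact Finset.sum_congr rfl fun i _ => map_mul (symHom hp χ s) _ _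
  simp only [ContinuousLinearMap.comp_apply, matOp_apply, h1, map_sum, _root_.sum_apply]
  rw [Finset.sum_comm]

lemma matOp_add (H G : Matrix m n (Entire d)) :
    matOp hp χ s (H + G) = matOp hp χ s H + matOp hp χ s G := by
  ext1 v
  funext j
  simp only [matOp_apply, _root_.add_apply, Pi.add_apply, Matrix.add_apply, symOp_add,
    Finset.sum_add_distrib]

lemma matOp_smul (c : ℝ) (H : Matrix m n (Entire d)) :
    matOp hp χ s ((c : ℂ) • H) = c • matOp hp χ s H := by
  ext1 v
  funext j
  rw [_root_.smul_apply, Pi.smul_apply, matOp_apply, matOp_apply, Finset.smul_sum]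
  refine Finset.sum_congr rfl fun k _ => ?_
  rw [Matrix.smul_apply, symOp_smul, _root_.smul_apply, Complex.coe_smul]

lemma matOp_one [DecidableEq n] :
    matOp hp χ s (1 : Matrix n n (Entire d)) = 1 := by
  ext1 v
  funext j
  rw [matOp_apply, Finset.sum_eq_single j]
  · rw [Matrix.one_apply_eq, symOp_one]
    rfl
  · intro k _ hk
    rw [Matrix.one_apply_ne hk.symm]
    exact congrArg (fun T => T (v k)) (map_zero (symHom hp χ s))
  · simp

lemma matOp_zero : matOp hp χ s (0 : Matrix m n (Entire d)) = 0 := by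
  have := matOp_smul hp χ s 0 (0 : Matrix m n (Entire d))
  rwa [zero_smul, smul_zero] at this

/-- Square matrices of entire symbols are represented by bounded operators. -/
def matHom [DecidableEq n] :
    Matrix n n (Entire d) →+* ((n → Localised hp χ s) →L[ℝ] (n → Localised hp χ s)) where
  toFun := matOp hp χ s
  map_one' := matOp_one hp χ s
  map_mul' H G := matOp_mul hp χ s H G
  map_zero' := matOp_zero hp χ s
  map_add' H G := matOp_add hp χ s H G

lemma exists_norm_matOp_le [Fintype m] {δ : ℝ} (hδ : 0 < δ) :
    ∃ C : ℝ, 0 ≤ C ∧ ∀ (s : ℝ) (H : Matrix m n (Entire d)) (B : ℝ), 0 ≤ B →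
      (∀ u ∈ tsupport χ.toFun, ∀ z ∈ Metric.ball (complexify d u) δ, ∀ j k,
        ‖Entire.eval z (H j k)‖ ≤ B) →
      ‖matOp hp χ s H‖ ≤ C * B := by
  obtain ⟨C, hC0, hC⟩ := exists_norm_symHom_le hp χ hδ
  refine ⟨Fintype.card n * C, by positivity, fun s H B hB hH => ?_⟩
  refine ContinuousLinearMap.opNorm_le_bound _ (by positivity) fun v => ?_
  refine (pi_norm_le_iff_of_nonneg (by positivity)).2 fun j => ?_
  rw [matOp_apply]
  refine (norm_sum_le _ _).trans ?_
  have : ∀ k ∈ Finset.univ, ‖symOp hp χ s (H j k) (v k)‖ ≤ C * B * ‖v‖ := fun k _ =>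
    ((symHom hp χ s (H j k)).le_opNorm _).trans (mul_le_mul
      (hC s _ B hB fun u hu z hz => hH u hu z hz j k) (norm_le_pi_norm v k) (norm_nonneg _)
      (by positivity))
  refine (Finset.sum_le_card_nsmul _ _ _ this).trans (le_of_eq ?_)
  rw [nsmul_eq_mul, Finset.card_univ]
  ring

end

section

/-! ### Exponentials of matrices of multipliers -/

/-- The remainder of the exponential series is dominated by that of a real exponential. -/
lemma norm_sum_sub_exp_le {𝔸 : Type*} [NormedRing 𝔸] [NormedAlgebra ℝ 𝔸] [CompleteSpace 𝔸] (x : 𝔸)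
    {K : ℝ} (hx : ‖x‖ ≤ K) (N : ℕ) :
    ‖∑ k ∈ Finset.range (N + 1), ((k.factorial : ℝ)⁻¹) • x ^ k - NormedSpace.exp x‖ ≤
      Real.exp K - ∑ k ∈ Finset.range (N + 1), ((k.factorial : ℝ)⁻¹) * K ^ k := by
  let _ : NormedAlgebra ℚ 𝔸 := NormedAlgebra.restrictScalars ℚ ℝ _
  have h1 := (hasSum_nat_add_iff' (N + 1)).2 (NormedSpace.exp_series_hasSum_exp' (𝕂 := ℝ) x)
  have h2 := (hasSum_nat_add_iff' (N + 1)).2 (NormedSpace.exp_series_hasSum_exp' (𝕂 := ℝ) K)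
  rw [← Real.exp_eq_exp_ℝ] at h2
  rw [norm_sub_rev, ← h1.tsum_eq]
  simp only [smul_eq_mul] at h2
  refine tsum_of_norm_bounded h2 fun k => ?_
  rw [norm_smul, norm_inv, Real.norm_natCast]
  gcongr
  exact (norm_pow_le' x (by omega)).trans (pow_le_pow_left₀ (norm_nonneg _) hx _)

variable {d : ℕ} {p : ℝ≥0∞} [Fact (1 ≤ p)] (hp : p ≠ ∞) (χ : Cutoff d) (s : ℝ) {n : ℕ}

/-- A continuous function is bounded on a bounded complex neighbourhood of the support of `χ`. -/
lemma Cutoff.exists_bound {f : EuclideanSpace ℂ (Fin d) → ℝ} (hf : Continuous f) (δ : ℝ) :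
    ∃ B : ℝ, 0 ≤ B ∧ ∀ u ∈ tsupport χ.toFun, ∀ z ∈ Metric.ball (complexify d u) δ, f z ≤ B := by
  obtain ⟨R, hR⟩ := (show IsCompact (tsupport χ.toFun) from
    χ.hasCompactSupport).isBounded.exists_norm_le
  obtain ⟨B, hB⟩ := (isCompact_closedBall (0 : EuclideanSpace ℂ (Fin d)) (R + δ)).bddAbove_image
    hf.continuousOn
  refine ⟨max B 0, le_max_right _ _, fun u hu z hz => (hB ⟨z, ?_, rfl⟩).trans (le_max_left _ _)⟩
  rw [mem_closedBall_zero_iff]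
  rw [mem_ball_iff_norm] at hz
  calc ‖z‖ = ‖complexify d u + (z - complexify d u)‖ := by congr 1; abel
    _ ≤ ‖complexify d u‖ + ‖z - complexify d u‖ := norm_add_le _ _
    _ ≤ R + δ := by
      rw [LinearIsometry.norm_map]
      exact add_le_add (hR u hu) hz.le

/-- The matrix of symbols `exp (τ H)`. -/
def expSymbol (τ : ℝ) (H : Matrix (Fin n) (Fin n) (Entire d)) :
    Matrix (Fin n) (Fin n) (Entire d) :=
  Matrix.of fun j k => ⟨fun z => NormedSpace.exp ((τ : ℂ) • H.map (Entire.eval z)) j k,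
    contDiff_exp_entry (fun j k => contDiff_const.mul (H j k).2) j k⟩

lemma eval_expSymbol (τ : ℝ) (H : Matrix (Fin n) (Fin n) (Entire d))
    (z : EuclideanSpace ℂ (Fin d)) (j k : Fin n) :
    Entire.eval z (expSymbol τ H j k) =
      NormedSpace.exp ((τ : ℂ) • H.map (Entire.eval z)) j k := rfl

open scoped Matrix.Norms.L2Operator in
lemma continuous_map_eval (H : Matrix (Fin n) (Fin n) (Entire d)) :
    Continuous fun z => H.map (Entire.eval z) :=
  continuous_matrix fun j k => (Entire.contDiff (H j k)).continuous

open scoped Matrix.Norms.L2Operator in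
/-- The exponential of a matrix of multipliers is the matrix of multipliers with the exponential
of the symbol, because the partial sums of the exponential series converge uniformly on the
complex neighbourhood of the support of the cutoff that controls the operator norm. -/
lemma exp_smul_matOp (τ : ℝ) (H : Matrix (Fin n) (Fin n) (Entire d)) :
    NormedSpace.exp (τ • matOp hp χ s H) = matOp hp χ s (expSymbol τ H) := by
  obtain ⟨C, hC0, hC⟩ := exists_norm_matOp_le hp χ (m := Fin n) (n := Fin n) one_pos
  obtain ⟨K, hK0, hK⟩ := χ.exists_bound
    (f := fun z => ‖(τ : ℂ) • H.map (Entire.eval z)‖)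
    ((continuous_map_eval H).const_smul (τ : ℂ)).norm 1
  let P : ℕ → Matrix (Fin n) (Fin n) (Entire d) := fun N =>
    ∑ k ∈ Finset.range (N + 1), (((k.factorial : ℝ)⁻¹ : ℝ) : ℂ) • ((τ : ℂ) • H) ^ k
  have hP : ∀ N, matOp hp χ s (P N) =
      ∑ k ∈ Finset.range (N + 1), ((k.factorial : ℝ)⁻¹) • (τ • matOp hp χ s H) ^ k := by
    intro N
    change matHom hp χ s (P N) = _
    rw [map_sum]
    refine Finset.sum_congr rfl fun k _ => ?_
    have h1 : matOp hp χ s (((τ : ℂ) • H) ^ k) = (matOp hp χ s ((τ : ℂ) • H)) ^ k :=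
      map_pow (matHom hp χ s) _ k
    rw [← matOp_smul, ← h1]
    exact matOp_smul hp χ s _ _
  let ε : ℕ → ℝ := fun N =>
    Real.exp K - ∑ k ∈ Finset.range (N + 1), ((k.factorial : ℝ)⁻¹) * K ^ k
  have hε : Filter.Tendsto ε Filter.atTop (nhds 0) := by
    have h1 := (NormedSpace.exp_series_hasSum_exp' (𝕂 := ℝ) K).tendsto_sum_nat.comp
      (Filter.tendsto_add_atTop_nat 1)
    rw [← Real.exp_eq_exp_ℝ] at h1
    simpa [ε] using h1.const_sub (Real.exp K)
  have hPz : ∀ N z, (P N).map (Entire.eval z) = ∑ k ∈ Finset.range (N + 1),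
      ((k.factorial : ℝ)⁻¹) • ((τ : ℂ) • H.map (Entire.eval z)) ^ k := by
    intro N z
    have h0 : ∀ M : Matrix (Fin n) (Fin n) (Entire d),
      M.map (Entire.eval z) = (Entire.eval z).mapMatrix M := fun _ => rfl
    rw [h0, map_sum]
    refine Finset.sum_congr rfl fun k _ => ?_
    rw [map_smul, map_pow, map_smul, ← h0, Complex.coe_smul]
  have hbound : ∀ N, ‖matOp hp χ s (P N) - matOp hp χ s (expSymbol τ H)‖ ≤ C * ε N := by
    intro N
    have hsub : matOp hp χ s (P N) - matOp hp χ s (expSymbol τ H) =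
        matOp hp χ s (P N - expSymbol τ H) := (map_sub (matHom hp χ s) _ _).symm
    have hz : ∀ z : EuclideanSpace ℂ (Fin d), ‖(τ : ℂ) • H.map (Entire.eval z)‖ ≤ K → ∀ j k,
        ‖Entire.eval z ((P N - expSymbol τ H) j k)‖ ≤ ε N := by
      intro z hzK j k
      have h2 := norm_sum_sub_exp_le ((τ : ℂ) • H.map (Entire.eval z)) hzK N
      rw [← hPz] at h2
      refine (norm_entry_le _ j k).trans' (le_of_eq ?_) |>.trans h2
      rw [Matrix.sub_apply, map_sub, eval_expSymbol, Matrix.sub_apply, Matrix.map_apply]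
    have hε0 : 0 ≤ ε N := by
      have h3 := norm_sum_sub_exp_le (0 : ℝ) (K := K) (by simpa using hK0) N
      exact (norm_nonneg _).trans h3
    rw [hsub]
    exact hC s _ _ hε0 fun u hu z hz' => hz z (hK u hu z hz')
  have hlim1 : Filter.Tendsto (fun N => matOp hp χ s (P N)) Filter.atTop
      (nhds (matOp hp χ s (expSymbol τ H))) :=
    tendsto_iff_norm_sub_tendsto_zero.2 (squeeze_zero (fun _ => norm_nonneg _) hbound
      (by simpa using hε.const_mul C))
  have hlim2 : Filter.Tendsto (fun N => matOp hp χ s (P N)) Filter.atTop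
      (nhds (NormedSpace.exp (τ • matOp hp χ s H))) := by
    let _ : NormedAlgebra ℚ ((Fin n → Localised hp χ s) →L[ℝ] (Fin n → Localised hp χ s)) :=
      NormedAlgebra.restrictScalars ℚ ℝ _
    simp_rw [hP]
    exact (NormedSpace.exp_series_hasSum_exp' (𝕂 := ℝ) (τ • matOp hp χ s H)).tendsto_sum_nat.comp
      (Filter.tendsto_add_atTop_nat 1)
  exact tendsto_nhds_unique hlim2 hlim1

/-- Decay of the semigroup generated by a matrix of multipliers whose symbol is dissipative near
the support of the cutoff. -/
lemma exists_norm_exp_matOp_le {δ : ℝ} (hδ : 0 < δ) :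
    ∃ C : ℝ, 0 ≤ C ∧ ∀ (s ω : ℝ) (H : Matrix (Fin n) (Fin n) (Entire d)),
      (∀ u ∈ tsupport χ.toFun, ∀ z ∈ Metric.ball (complexify d u) δ,
        ∀ x : EuclideanSpace ℂ (Fin n),
          (inner ℂ x (Matrix.toEuclideanCLM (𝕜 := ℂ) (H.map (Entire.eval z)) x)).re
            ≤ ω * ‖x‖ ^ 2) →
      ∀ τ : ℝ, 0 ≤ τ →
        ‖NormedSpace.exp (τ • matOp hp χ s H)‖ ≤ C * Real.exp (τ * ω) := by
  obtain ⟨C, hC0, hC⟩ := exists_norm_matOp_le hp χ (m := Fin n) (n := Fin n) hδ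
  refine ⟨C, hC0, fun s ω H hH τ hτ => ?_⟩
  rw [exp_smul_matOp]
  refine hC s _ _ (Real.exp_pos _).le fun u hu z hz j k => ?_
  rw [eval_expSymbol]
  refine norm_exp_entry_le _ (fun x => ?_) j k
  rw [map_smul, _root_.smul_apply, inner_smul_right, Complex.re_ofReal_mul, mul_assoc]
  exact mul_le_mul_of_nonneg_left (hH u hu z hz x) hτ

end

section

/-! ### Coercivity of the diffusion symbol -/

/-- A continuous function of two variables, homogeneous of degree two in each of them and positive
away from zero, is coercive. -/
lemma exists_coercive {E F : Type*} [NormedAddCommGroup E] [NormedSpace ℝ E] [FiniteDimensional ℝ E]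
    [NormedAddCommGroup F] [NormedSpace ℝ F] [FiniteDimensional ℝ F] {f : E → F → ℝ}
    (hf : Continuous fun z : E × F => f z.1 z.2)
    (hhom : ∀ (s t : ℝ) u y, f (s • u) (t • y) = s ^ 2 * t ^ 2 * f u y)
    (hpos : ∀ u y, ‖u‖ = 1 → y ≠ 0 → 0 < f u y) :
    ∃ c > 0, ∀ u y, c * ‖u‖ ^ 2 * ‖y‖ ^ 2 ≤ f u y := by
  have _ := FiniteDimensional.proper_real E
  have _ := FiniteDimensional.proper_real F
  have hK : IsCompact (Metric.sphere (0 : E) 1 ×ˢ Metric.sphere (0 : F) 1) :=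
    (isCompact_sphere _ _).prod (isCompact_sphere _ _)
  obtain ⟨c, hc, hcf⟩ : ∃ c > 0, ∀ u y, ‖u‖ = 1 → ‖y‖ = 1 → c ≤ f u y := by
    rcases (Metric.sphere (0 : E) 1 ×ˢ Metric.sphere (0 : F) 1).eq_empty_or_nonempty with h | h
    · refine ⟨1, one_pos, fun u y hu hy => ?_⟩
      have : (u, y) ∈ Metric.sphere (0 : E) 1 ×ˢ Metric.sphere (0 : F) 1 := by simp [hu, hy]
      simp [h] at this
    · obtain ⟨z, hz, hmin⟩ := hK.exists_isMinOn h hf.continuousOn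
      simp only [Set.mem_prod, mem_sphere_zero_iff_norm] at hz
      refine ⟨f z.1 z.2, hpos _ _ hz.1 (norm_pos_iff.1 (by rw [hz.2]; exact one_pos)),
        fun u y hu hy => ?_⟩
      exact hmin (show (u, y) ∈ _ by simp [hu, hy])
  refine ⟨c, hc, fun u y => ?_⟩
  rcases eq_or_ne u 0 with rfl | hu
  · have := hhom 0 1 0 y
    rw [zero_smul, one_smul] at this
    rw [this.trans (by ring : _ = (0 : ℝ))]
    simp
  rcases eq_or_ne y 0 with rfl | hy
  · have := hhom 1 0 u 0
    rw [zero_smul, one_smul] at this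
    rw [this.trans (by ring : _ = (0 : ℝ))]
    simp
  have hu' : ‖u‖ ≠ 0 := norm_ne_zero_iff.2 hu
  have hy' : ‖y‖ ≠ 0 := norm_ne_zero_iff.2 hy
  have h1 := hcf (‖u‖⁻¹ • u) (‖y‖⁻¹ • y) 
    (by rw [norm_smul, norm_inv, norm_norm, inv_mul_cancel₀ hu'])
    (by rw [norm_smul, norm_inv, norm_norm, inv_mul_cancel₀ hy'])
  have h2 := hhom ‖u‖ ‖y‖ (‖u‖⁻¹ • u) (‖y‖⁻¹ • y)
  rw [smul_inv_smul₀ hu', smul_inv_smul₀ hy'] at h2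
  rw [h2]
  calc c * ‖u‖ ^ 2 * ‖y‖ ^ 2 = ‖u‖ ^ 2 * ‖y‖ ^ 2 * c := by ring
    _ ≤ _ := by gcongr

lemma re_inner_toEuclideanCLM {n : ℕ} (M : Matrix (Fin n) (Fin n) ℂ)
    (x : EuclideanSpace ℂ (Fin n)) :
    (inner ℂ x (Matrix.toEuclideanCLM (𝕜 := ℂ) M x)).re =
      ∑ j, ∑ k, (star (x j) * (M j k * x k)).re := by
  rw [PiLp.inner_apply, Complex.re_sum]
  refine Finset.sum_congr rfl fun j _ => ?_
  have : (Matrix.toEuclideanCLM (𝕜 := ℂ) M x) j = ∑ k, M j k * x k := rfl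
  rw [this, ← Complex.re_sum, ← Finset.mul_sum]
  simp [mul_comm]

/-- A real quadratic form bounded below stays so on complex vectors. -/
lemma le_re_inner_of_real {n : ℕ} (S : Matrix (Fin n) (Fin n) ℝ) {c : ℝ}
    (hS : ∀ y : EuclideanSpace ℝ (Fin n), c * ‖y‖ ^ 2 ≤ ∑ j, ∑ k, y j * (S j k * y k))
    (x : EuclideanSpace ℂ (Fin n)) :
    c * ‖x‖ ^ 2 ≤ (inner ℂ x (Matrix.toEuclideanCLM (𝕜 := ℂ) (S.map Complex.ofReal) x)).re := by
  have ha := hS (WithLp.toLp 2 fun j => (x j).re)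
  have hb := hS (WithLp.toLp 2 fun j => (x j).im)
  have hn : ‖x‖ ^ 2 = ‖(WithLp.toLp 2 fun j => (x j).re : EuclideanSpace ℝ (Fin n))‖ ^ 2 +
      ‖(WithLp.toLp 2 fun j => (x j).im : EuclideanSpace ℝ (Fin n))‖ ^ 2 := by
    simp only [EuclideanSpace.norm_sq_eq, ← Finset.sum_add_distrib]
    refine Finset.sum_congr rfl fun j _ => ?_
    rw [Complex.sq_norm, Complex.normSq_apply, Real.norm_eq_abs, Real.norm_eq_abs, sq_abs, sq_abs]
    ring
  rw [re_inner_toEuclideanCLM, hn, mul_add]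
  refine (add_le_add ha hb).trans (le_of_eq ?_)
  simp only [← Finset.sum_add_distrib]
  refine Finset.sum_congr rfl fun j _ => Finset.sum_congr rfl fun k _ => ?_
  simp [Complex.mul_re, Complex.mul_im]

lemma re_inner_le_sum_norm {n : ℕ} (M : Matrix (Fin n) (Fin n) ℂ)
    (x : EuclideanSpace ℂ (Fin n)) :
    (inner ℂ x (Matrix.toEuclideanCLM (𝕜 := ℂ) M x)).re ≤ (∑ j, ∑ k, ‖M j k‖) * ‖x‖ ^ 2 := by
  rw [re_inner_toEuclideanCLM, Finset.sum_mul]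
  refine Finset.sum_le_sum fun j _ => ?_
  rw [Finset.sum_mul]
  refine Finset.sum_le_sum fun k _ => (Complex.re_le_norm _).trans ?_
  rw [norm_mul, norm_mul, norm_star]
  have h1 := PiLp.norm_apply_le x j
  have h2 := PiLp.norm_apply_le x k
  calc ‖x j‖ * (‖M j k‖ * ‖x k‖) = ‖M j k‖ * (‖x j‖ * ‖x k‖) := by ring
    _ ≤ ‖M j k‖ * (‖x‖ * ‖x‖) := by gcongr
    _ = _ := by ring

variable {d n₁ n₂ : ℕ} {A : Fin d → Matrix (Fin n₁ ⊕ Fin n₂) (Fin n₁ ⊕ Fin n₂) ℝ}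
  {D : Matrix (Fin n₂) (Fin n₂) ℝ}

lemma exists_posDef_le {n : ℕ} {S : Matrix (Fin n) (Fin n) ℝ} (hS : S.PosDef) :
    ∃ κ > 0, ∀ y : EuclideanSpace ℝ (Fin n), κ * ‖y‖ ^ 2 ≤ ∑ j, ∑ k, y j * (S j k * y k) := by
  obtain ⟨κ, hκ, h⟩ := exists_coercive (E := ℝ) (F := EuclideanSpace ℝ (Fin n))
    (f := fun u y => u ^ 2 * ∑ j, ∑ k, y j * (S j k * y k)) (by fun_prop)
    (fun s t u y => by
      simp only [PiLp.smul_apply, smul_eq_mul, Finset.mul_sum]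
      refine Finset.sum_congr rfl fun j _ => Finset.sum_congr rfl fun k _ => ?_
      ring)
    (fun u y hu hy => by
      have h1 := hS.dotProduct_mulVec_pos (x := y.ofLp) (by simpa using hy)
      have h2 : u ^ 2 = 1 := by
        rw [← sq_abs, ← Real.norm_eq_abs, hu, one_pow]
      rw [h2, one_mul]
      simpa [dotProduct, mulVec, Finset.mul_sum] using h1)
  exact ⟨κ, hκ, fun y => by simpa using h 1 y⟩

/-- The quadratic form `y ↦ y · Q(u) y` with `Q(u) = ∑ uᵢ uₗ A₁₂ⁱ D⁻¹ A₂₁ˡ` is the square of the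
`D⁻¹`-norm of `A₂₁(u) y`, and the Shizuta-Kawashima condition says exactly that `A₂₁(u)` is
injective for `u ≠ 0`. -/
lemma exists_diffusion_coercive (hAD : IsAdmissible A D) :
    ∃ c > 0, ∀ (u : EuclideanSpace ℝ (Fin d)) (y : EuclideanSpace ℝ (Fin n₁)),
      c * ‖u‖ ^ 2 * ‖y‖ ^ 2 ≤ ∑ j, ∑ k, y j * ((∑ i, ∑ l, (u i * u l) •
        ((A i).toBlocks₁₂ * D⁻¹ * (A l).toBlocks₂₁)) j k * y k) := by
  have hform : ∀ (u : EuclideanSpace ℝ (Fin d)) (y : Fin n₁ → ℝ),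
      ∑ j, ∑ k, y j * ((∑ i, ∑ l, (u i * u l) •
        ((A i).toBlocks₁₂ * D⁻¹ * (A l).toBlocks₂₁)) j k * y k) =
      ((∑ l, u l • (A l).toBlocks₂₁) *ᵥ y) ⬝ᵥ D⁻¹ *ᵥ ((∑ l, u l • (A l).toBlocks₂₁) *ᵥ y) := by
    intro u y
    have h1 : (∑ i, ∑ l, (u i * u l) • ((A i).toBlocks₁₂ * D⁻¹ * (A l).toBlocks₂₁)) =
        (∑ l, u l • (A l).toBlocks₂₁)ᵀ * D⁻¹ * (∑ l, u l • (A l).toBlocks₂₁) := by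
      have h2 : ∀ i, ((A i).toBlocks₂₁)ᵀ = (A i).toBlocks₁₂ := fun i => by
        ext j k
        exact (hAD.symm i).apply (Sum.inl j) (Sum.inr k)
      simp only [Matrix.transpose_sum, Matrix.transpose_smul, h2, Matrix.sum_mul, Matrix.mul_sum,
        Matrix.smul_mul, Matrix.mul_smul, Finset.smul_sum, smul_smul]
      rw [Finset.sum_comm]
      refine Finset.sum_congr rfl fun i _ => Finset.sum_congr rfl fun l _ => ?_
      rw [mul_comm]
    rw [h1]
    set B := ∑ l, u l • (A l).toBlocks₂₁
    have h3 : ∑ j, ∑ k, y j * ((Bᵀ * D⁻¹ * B) j k * y k) = y ⬝ᵥ (Bᵀ * D⁻¹ * B) *ᵥ y := by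
      simp [dotProduct, mulVec, Finset.mul_sum]
    rw [h3, ← Matrix.mulVec_mulVec, ← Matrix.mulVec_mulVec, Matrix.dotProduct_mulVec,
      Matrix.vecMul_transpose]
  refine exists_coercive (f := fun (u : EuclideanSpace ℝ (Fin d)) (y : EuclideanSpace ℝ (Fin n₁)) =>
    ∑ j, ∑ k, y j * ((∑ i, ∑ l, (u i * u l) •
      ((A i).toBlocks₁₂ * D⁻¹ * (A l).toBlocks₂₁)) j k * y k)) ?_ ?_ ?_
  · simp only [Matrix.sum_apply, Matrix.smul_apply]
    fun_prop
  · intro s t u y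
    simp only [PiLp.smul_apply, smul_eq_mul, Matrix.sum_apply, Matrix.smul_apply, Finset.mul_sum,
      Finset.sum_mul]
    refine Finset.sum_congr rfl fun j _ => Finset.sum_congr rfl fun k _ =>
      Finset.sum_congr rfl fun i _ => Finset.sum_congr rfl fun l _ => ?_
    ring
  · intro u y hu hy
    rw [hform]
    have hne : (∑ l, u l • (A l).toBlocks₂₁) *ᵥ y.ofLp ≠ 0 := by
      intro h0
      have hblock : ∀ i, A i = Matrix.fromBlocks 0 (A i).toBlocks₁₂ (A i).toBlocks₂₁
          (A i).toBlocks₂₂ := fun i => by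
        conv_lhs => rw [← Matrix.fromBlocks_toBlocks (A i), hAD.block₁₁ i]
      have hφ := hAD.sk (Sum.elim y.ofLp 0) 0 u ?_ hu ?_
      · apply hy
        ext j
        exact congrFun hφ (Sum.inl j)
      · rw [relaxation, Matrix.fromBlocks_mulVec]
        simp
      · rw [zero_smul, zero_add]
        rw [Matrix.sum_mulVec] at h0 ⊢
        ext (j | j)
        · rw [Finset.sum_apply]
          refine Finset.sum_eq_zero fun i _ => ?_
          rw [hblock i, Matrix.smul_mulVec, Matrix.fromBlocks_mulVec]
          simp
        · rw [Finset.sum_apply]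
          refine Eq.trans ?_ (congrFun h0 j)
          rw [Finset.sum_apply]
          refine Finset.sum_congr rfl fun i _ => ?_
          conv_lhs => rw [hblock i, Matrix.smul_mulVec, Matrix.fromBlocks_mulVec]
          simp [Matrix.smul_mulVec]
    simpa using hAD.posDef.inv.dotProduct_mulVec_pos hne

/-! ### Symbols of the system -/

/-- The entire function `z ↦ i zᵢ`, the symbol of a rescaled partial derivative. -/
def coordSymbol (i : Fin d) : Entire d :=
  ⟨fun z => Complex.I * z i, by
    change ContDiff ℂ ⊤ fun z : EuclideanSpace ℂ (Fin d) => Complex.I * z i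
    fun_prop⟩

/-- The symbol `∑ᵢ i zᵢ Mᵢ` of a first order operator with real matrix coefficients. -/
def gradSymbol {m n : ℕ} (M : Fin d → Matrix (Fin m) (Fin n) ℝ) :
    Matrix (Fin m) (Fin n) (Entire d) :=
  Matrix.of fun j k => ∑ i, (M i j k : ℂ) • coordSymbol i

/-- A real matrix as a constant symbol. -/
def constSymbol (d : ℕ) {m n : ℕ} (M : Matrix (Fin m) (Fin n) ℝ) :
    Matrix (Fin m) (Fin n) (Entire d) :=
  M.map fun r => algebraMap ℂ (Entire d) (r : ℂ)

lemma constSymbol_mul {l m n : ℕ} (M : Matrix (Fin l) (Fin m) ℝ) (N : Matrix (Fin m) (Fin n) ℝ) :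
    constSymbol d M * constSymbol d N = constSymbol d (M * N) := by
  ext1 j k
  simp [constSymbol, Matrix.mul_apply]

lemma constSymbol_one {n : ℕ} : constSymbol d (1 : Matrix (Fin n) (Fin n) ℝ) = 1 := by
  ext1 j k
  by_cases h : j = k <;> simp [constSymbol, Matrix.one_apply, h]

lemma gradSymbol_mul_constSymbol {l m n : ℕ} (M : Fin d → Matrix (Fin l) (Fin m) ℝ)
    (N : Matrix (Fin m) (Fin n) ℝ) :
    gradSymbol M * constSymbol d N = gradSymbol fun i => M i * N := by
  ext1 j k
  simp only [gradSymbol, constSymbol, Matrix.mul_apply, Matrix.of_apply, Matrix.map_apply,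
    Finset.sum_mul, Complex.ofReal_sum, Complex.ofReal_mul, Finset.sum_smul]
  rw [Finset.sum_comm]
  refine Finset.sum_congr rfl fun i _ => Finset.sum_congr rfl fun a _ => ?_
  rw [Algebra.smul_mul_assoc, mul_comm (coordSymbol i), ← Algebra.smul_def, smul_smul]

lemma constSymbol_mul_gradSymbol {l m n : ℕ} (M : Matrix (Fin l) (Fin m) ℝ)
    (N : Fin d → Matrix (Fin m) (Fin n) ℝ) :
    constSymbol d M * gradSymbol N = gradSymbol fun i => M * N i := by
  ext1 j k
  simp only [gradSymbol, constSymbol, Matrix.mul_apply, Matrix.of_apply, Matrix.map_apply,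
    Finset.mul_sum, Complex.ofReal_sum, Complex.ofReal_mul, Finset.sum_smul]
  rw [Finset.sum_comm]
  refine Finset.sum_congr rfl fun i _ => Finset.sum_congr rfl fun a _ => ?_
  rw [← Algebra.smul_def, smul_smul]

lemma constSymbol_map_eval {m n : ℕ} (M : Matrix (Fin m) (Fin n) ℝ) (z : EuclideanSpace ℂ (Fin d)) :
    (constSymbol d M).map (Entire.eval z) = M.map Complex.ofReal := by
  ext j k
  simp [constSymbol]

/-- The entire symbol `-∑ zᵢ zₗ A₁₂ⁱ D⁻¹ A₂₁ˡ` of the rescaled operator `𝒜`. -/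
def parabolicSymbol (A : Fin d → Matrix (Fin n₁ ⊕ Fin n₂) (Fin n₁ ⊕ Fin n₂) ℝ)
    (D : Matrix (Fin n₂) (Fin n₂) ℝ) : Matrix (Fin n₁) (Fin n₁) (Entire d) :=
  gradSymbol (fun i => (A i).toBlocks₁₂) * constSymbol d D⁻¹ *
    gradSymbol (fun i => (A i).toBlocks₂₁)

lemma parabolicSymbol_map_eval (z : EuclideanSpace ℂ (Fin d)) (j k : Fin n₁) :
    (parabolicSymbol A D).map (Entire.eval z) j k =
      -∑ i, ∑ l, (z i * z l) * (((A i).toBlocks₁₂ * D⁻¹ * (A l).toBlocks₂₁) j k : ℂ) := by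
  rw [parabolicSymbol, gradSymbol_mul_constSymbol, Matrix.map_apply, Matrix.mul_apply, map_sum]
  have hB : ∀ i l, (((A i).toBlocks₁₂ * D⁻¹ * (A l).toBlocks₂₁) j k : ℂ) =
      ∑ a, (((A i).toBlocks₁₂ * D⁻¹) j a : ℂ) * ((A l).toBlocks₂₁ a k : ℂ) := fun i l => by
    rw [Matrix.mul_apply, Complex.ofReal_sum]
    simp only [Complex.ofReal_mul]
  have hc : ∀ i, Entire.eval z (coordSymbol i) = Complex.I * z i := fun i => rfl
  simp only [hB, gradSymbol, Matrix.of_apply, map_mul, map_sum, map_smul, smul_eq_mul, hc]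
  simp only [Finset.sum_mul_sum]
  simp only [Finset.mul_sum, ← Finset.sum_neg_distrib]
  rw [Finset.sum_comm]
  refine Finset.sum_congr rfl fun i _ => ?_
  rw [Finset.sum_comm]
  refine Finset.sum_congr rfl fun l _ => Finset.sum_congr rfl fun a _ => ?_
  linear_combination (((A i).toBlocks₁₂ * D⁻¹) j a : ℂ) * ((A l).toBlocks₂₁ a k : ℂ) * z i * z l
    * Complex.I_mul_I

/-- Dissipativity of the diffusion symbol near the real frequencies. -/
lemma exists_re_inner_parabolicSymbol_le (hAD : IsAdmissible A D) :
    ∃ c > 0, ∃ K : ℝ, 0 ≤ K ∧ ∀ (u : EuclideanSpace ℝ (Fin d)) (z : EuclideanSpace ℂ (Fin d)) (r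
      : ℝ),
      ‖z - complexify d u‖ ≤ r → ∀ x : EuclideanSpace ℂ (Fin n₁),
      (inner ℂ x (Matrix.toEuclideanCLM (𝕜 := ℂ)
        ((parabolicSymbol A D).map (Entire.eval z)) x)).re
        ≤ (K * (r * (2 * ‖u‖ + r)) - c * ‖u‖ ^ 2) * ‖x‖ ^ 2 := by
  obtain ⟨c, hc, hcoer⟩ := exists_diffusion_coercive hAD
  let q : Fin d → Fin d → Matrix (Fin n₁) (Fin n₁) ℝ := fun i l =>
    (A i).toBlocks₁₂ * D⁻¹ * (A l).toBlocks₂₁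
  refine ⟨c, hc, ∑ j, ∑ k, ∑ i, ∑ l, |q i l j k|, by positivity, fun u z r hr x => ?_⟩
  have hr0 : 0 ≤ r := (norm_nonneg _).trans hr
  set G : EuclideanSpace ℂ (Fin d) → Matrix (Fin n₁) (Fin n₁) ℂ := fun z =>
    (parabolicSymbol A D).map (Entire.eval z) with hG
  have hGu : G (complexify d u) = -(∑ i, ∑ l, (u i * u l) • q i l).map Complex.ofReal := by
    ext j k
    rw [hG]
    dsimp only
    rw [parabolicSymbol_map_eval, Matrix.neg_apply, Matrix.map_apply]
    simp only [Matrix.sum_apply, Matrix.smul_apply, smul_eq_mul, Complex.ofReal_sum,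
      Complex.ofReal_mul, complexify_apply]
    rfl
  have h1 : (inner ℂ x (Matrix.toEuclideanCLM (𝕜 := ℂ) (G (complexify d u)) x)).re
      ≤ -(c * ‖u‖ ^ 2 * ‖x‖ ^ 2) := by
    rw [hGu, map_neg, _root_.neg_apply, inner_neg_right, Complex.neg_re]
    exact neg_le_neg (le_re_inner_of_real _ (hcoer u) x)
  have h2 := re_inner_le_sum_norm (G z - G (complexify d u)) x
  have h3 : ∀ i l, ‖z i * z l - u i * u l‖ ≤ r * (2 * ‖u‖ + r) := by
    intro i l
    have hz : ∀ i, ‖z i - u i‖ ≤ r := fun i =>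
      (PiLp.norm_apply_le (z - complexify d u) i).trans hr
    have hu : ∀ i, ‖(u i : ℂ)‖ ≤ ‖u‖ := fun i => by
      rw [Complex.norm_real]
      exact PiLp.norm_apply_le u i
    have hzl : ‖z l‖ ≤ r + ‖u‖ := by
      calc ‖z l‖ = ‖(z l - u l) + u l‖ := by congr 1; ring
        _ ≤ _ := (norm_add_le _ _).trans (add_le_add (hz l) (hu l))
    calc ‖z i * z l - u i * u l‖ = ‖(z i - u i) * z l + u i * (z l - u l)‖ := by congr 1; ring
      _ ≤ ‖z i - u i‖ * ‖z l‖ + ‖(u i : ℂ)‖ * ‖z l - u l‖ := by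
        rw [← norm_mul, ← norm_mul]
        exact norm_add_le _ _
      _ ≤ r * (r + ‖u‖) + ‖u‖ * r := by
        gcongr
        · exact hz i
        · exact hu i
        · exact hz l
      _ = _ := by ring
  have h4 : ∑ j, ∑ k, ‖(G z - G (complexify d u)) j k‖ ≤
      (∑ j, ∑ k, ∑ i, ∑ l, |q i l j k|) * (r * (2 * ‖u‖ + r)) := by
    simp only [Finset.sum_mul]
    refine Finset.sum_le_sum fun j _ => Finset.sum_le_sum fun k _ => ?_
    have h5 : (G z - G (complexify d u)) j k =
        -∑ i, ∑ l, (z i * z l - u i * u l) * (q i l j k : ℂ) := by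
      rw [Matrix.sub_apply, hG]
      dsimp only
      rw [parabolicSymbol_map_eval, parabolicSymbol_map_eval]
      simp only [sub_mul, Finset.sum_sub_distrib, complexify_apply]
      ring
    rw [h5, norm_neg]
    refine (norm_sum_le _ _).trans (Finset.sum_le_sum fun i _ => (norm_sum_le _ _).trans
      (Finset.sum_le_sum fun l _ => ?_))
    rw [norm_mul, Complex.norm_real, Real.norm_eq_abs, mul_comm]
    exact mul_le_mul_of_nonneg_left (h3 i l) (abs_nonneg _)
  have h6 : G z = G (complexify d u) + (G z - G (complexify d u)) := by abel
  change (inner ℂ x (Matrix.toEuclideanCLM (𝕜 := ℂ) (G z) x)).re ≤ _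
  rw [h6, map_add, _root_.add_apply, inner_add_right, Complex.add_re]
  have h7 := mul_le_mul_of_nonneg_right h4 (sq_nonneg ‖x‖)
  linarith

end

section

/-! ### From multipliers to distributions -/

/-- A cutoff adapted to the annulus `{a₁ < |u| < a₂}`. -/
lemma exists_cutoff (d : ℕ) {a₁ a₂ : ℝ} (ha₁ : 0 < a₁) (ha₂ : a₁ < a₂) :
    ∃ χ : Cutoff d, (∀ u, a₁ < ‖u‖ → ‖u‖ < a₂ → χ.toFun u = 1) ∧
      ∀ u ∈ tsupport χ.toFun, a₁ / 2 ≤ ‖u‖ ∧ ‖u‖ ≤ 2 * a₂ := by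
  have h1 : 0 < (a₂ ^ 2 - a₁ ^ 2) / 2 := by nlinarith
  have h2 : 0 < a₁ ^ 2 / 2 := by positivity
  let ψ : ContDiffBump ((a₁ ^ 2 + a₂ ^ 2) / 2 : ℝ) :=
    ⟨(a₂ ^ 2 - a₁ ^ 2) / 2, (a₂ ^ 2 - a₁ ^ 2) / 2 + a₁ ^ 2 / 2, h1, by linarith⟩
  let f : EuclideanSpace ℝ (Fin d) → ℂ := fun u => ((ψ (‖u‖ ^ 2) : ℝ) : ℂ)
  have hsupp : tsupport f ⊆ {u | a₁ / 2 ≤ ‖u‖ ∧ ‖u‖ ≤ 2 * a₂} := by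
    refine closure_minimal (fun u hu => ?_) ?_
    · have hu' : ‖u‖ ^ 2 ∈ Function.support ψ := by
        intro h
        exact hu (by simp [f, h])
      rw [ψ.support_eq, Real.ball_eq_Ioo] at hu'
      obtain ⟨hl, hr⟩ := hu'
      simp only [ψ] at hl hr
      exact ⟨abs_le_of_sq_le_sq' (by nlinarith) (norm_nonneg u) |>.2,
        abs_le_of_sq_le_sq' (by nlinarith) (by linarith) |>.2⟩
    · exact (isClosed_le continuous_const continuous_norm).inter
        (isClosed_le continuous_norm continuous_const)
  refine ⟨⟨f, ?_, ?_⟩, fun u hu₁ hu₂ => ?_, hsupp⟩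
  · exact Complex.ofRealCLM.contDiff.comp (ψ.contDiff.comp (contDiff_norm_sq ℝ))
  · refine HasCompactSupport.of_support_subset_isCompact
      (isCompact_closedBall (0 : EuclideanSpace ℝ (Fin d)) (2 * a₂)) fun u hu => ?_
    rw [mem_closedBall_zero_iff]
    exact (hsupp (subset_tsupport f hu)).2
  · have : ψ (‖u‖ ^ 2) = 1 := by
      apply ψ.one_of_mem_closedBall
      rw [Real.closedBall_eq_Icc]
      simp only [ψ]
      constructor <;> nlinarith
    simp [f, this]

variable {d : ℕ} {p : ℝ≥0∞} [Fact (1 ≤ p)] (hp : p ≠ ∞) (χ : Cutoff d) (s : ℝ)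

/-- Functions with spectrum in the dilated annulus are localised, for the dilation `s = 2π / lam`
which maps the frequency `ξ` to the rescaled angular frequency `2πξ / lam`. -/
lemma exists_incl_eq_of_dsupport {a₁ a₂ lam : ℝ} (hlam : 0 < lam)
    (hχ : ∀ u, a₁ < ‖u‖ → ‖u‖ < a₂ → χ.toFun u = 1) {v : LpRd d p}
    (hv : Distribution.dsupport (𝓕 (Lp.toTemperedDistribution v) :
      𝓢'(EuclideanSpace ℝ (Fin d), ℂ)) ⊆ dilatedAnnulus d a₁ a₂ lam) :
    ∃ w, incl hp χ (2 * Real.pi / lam) w = v := by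
  refine exists_incl_eq hp χ _ (convOp_eq_self hp _ _ v ?_ hv fun ξ hξ => ?_)
  · exact (isOpen_lt continuous_const (continuous_const.mul continuous_norm)).inter
      (isOpen_lt (continuous_const.mul continuous_norm) continuous_const)
  · have h0 : 0 < 2 * Real.pi / lam := by positivity
    have h1 : ‖(2 * Real.pi / lam) • ξ‖ = 2 * Real.pi * ‖ξ‖ / lam := by
      rw [norm_smul, Real.norm_of_nonneg h0.le]
      ring
    rw [Cutoff.fourier_kernel, map_one, mul_one]
    apply hχ
    · rw [h1, lt_div_iff₀ hlam, mul_comm]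
      exact hξ.1
    · rw [h1, div_lt_iff₀ hlam, mul_comm _ lam]
      exact hξ.2

/-- The distribution defined by a localised function. -/
def toDist : Localised hp χ s →ₗ[ℂ] 𝓢'(EuclideanSpace ℝ (Fin d), ℂ) :=
  ((Lp.toTemperedDistributionCLM ℂ volume p) ∘L incl hp χ s).toLinearMap

lemma toDist_apply (w : Localised hp χ s) :
    toDist hp χ s w = Lp.toTemperedDistribution (incl hp χ s w) := rfl

lemma toDist_real_smul (c : ℝ) (w : Localised hp χ s) :
    toDist hp χ s (c • w) = (c : ℂ) • toDist hp χ s w := by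
  rw [← Complex.coe_smul, map_smul]

lemma toDist_symOp_algebraMap (c : ℂ) (w : Localised hp χ s) :
    toDist hp χ s (symOp hp χ s (algebraMap ℂ (Entire d) c) w) = c • toDist hp χ s w := by
  rw [Algebra.algebraMap_eq_smul_one, symOp_smul, symOp_one, _root_.smul_apply, map_smul]
  rfl

/-- After rescaling, `∂ᵢ` is `lam` times the multiplier with symbol `i zᵢ`. -/
lemma partialD_toDist {lam : ℝ} (hlam : 0 < lam) (i : Fin d)
    (w : Localised hp χ (2 * Real.pi / lam)) :
    partialD i (toDist hp χ _ w) = (lam : ℂ) • toDist hp χ _ (symOp hp χ _ (coordSymbol i) w) := by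
  have hlam' : (lam : ℂ) ≠ 0 := by exact_mod_cast hlam.ne'
  have hR : (lam : ℂ) • toDist hp χ _ (symOp hp χ _ (coordSymbol i) w) =
      toDist hp χ _ (symOp hp χ _ ((lam : ℂ) • coordSymbol i) w) := by
    rw [symOp_smul, _root_.smul_apply, map_smul]
  rw [partialD, TemperedDistribution.lineDeriv_eq_fourierMultiplierCLM, hR, toDist_apply,
    toDist_apply]
  have hg : Function.HasTemperateGrowth fun ξ : EuclideanSpace ℝ (Fin d) =>
      ((inner ℝ ξ (EuclideanSpace.single i (1 : ℝ)) : ℝ) : ℂ) := by fun_prop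
  have hg' := (Function.HasTemperateGrowth.const (2 * Real.pi * Complex.I)
    (E := EuclideanSpace ℝ (Fin d))).mul hg
  rw [toTemperedDistribution_symOp hp χ _ (g := fun ξ => (2 * Real.pi * Complex.I) *
    ((inner ℝ ξ (EuclideanSpace.single i (1 : ℝ)) : ℝ) : ℂ)) hg']
  · have h2 := TemperedDistribution.fourierMultiplierCLM_smul (F := ℂ) hg (2 * Real.pi * Complex.I)
    exact (congrArg (fun T => T (Lp.toTemperedDistribution (incl hp χ _ w))) h2).symm
  · intro ξ
    rw [map_smul]
    have hc : Entire.eval (complexify d ((2 * Real.pi / lam) • ξ)) (coordSymbol i) =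
      Complex.I * (((2 * Real.pi / lam) * ξ i : ℝ) : ℂ) := rfl
    rw [hc, EuclideanSpace.inner_single_right]
    simp only [one_mul, smul_eq_mul]
    push_cast
    field_simp
    simp

/-- The vector of distributions defined by a vector of localised functions. -/
def toDistVec {ι : Type*} (w : ι → Localised hp χ s) : ι → 𝓢'(EuclideanSpace ℝ (Fin d), ℂ) :=
  fun j => toDist hp χ s (w j)

variable {m n n₁ n₂ : ℕ}

lemma toDist_matOp_constSymbol (M : Matrix (Fin m) (Fin n) ℝ) (w : Fin n → Localised hp χ s)
    (j : Fin m) :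
    toDist hp χ s (matOp hp χ s (constSymbol d M) w j) = matAct M (toDistVec hp χ s w) j := by
  rw [matOp_apply, map_sum]
  refine Finset.sum_congr rfl fun k _ => ?_
  exact toDist_symOp_algebraMap hp χ s _ _

lemma toDist_matOp_gradSymbol {lam : ℝ} (hlam : 0 < lam) (M : Fin d → Matrix (Fin m) (Fin n) ℝ)
    (w : Fin n → Localised hp χ (2 * Real.pi / lam)) (j : Fin m) :
    toDist hp χ _ (lam • matOp hp χ _ (gradSymbol M) w j) =
      ∑ i, matAct (M i) (fun k => partialD i (toDistVec hp χ _ w k)) j := by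
  rw [toDist_real_smul, matOp_apply, map_sum, Finset.smul_sum]
  simp only [matAct]
  rw [Finset.sum_comm]
  refine Finset.sum_congr rfl fun k _ => ?_
  have h1 : symOp hp χ (2 * Real.pi / lam) (gradSymbol M j k) =
      ∑ i, (M i j k : ℂ) • symOp hp χ (2 * Real.pi / lam) (coordSymbol i) := by
    change symHom hp χ _ (gradSymbol M j k) = _
    rw [gradSymbol, Matrix.of_apply, map_sum]
    exact Finset.sum_congr rfl fun i _ => symOp_smul hp χ _ _ _
  rw [h1, _root_.sum_apply, map_sum, Finset.smul_sum]
  refine Finset.sum_congr rfl fun i _ => ?_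
  rw [toDistVec, partialD_toDist hp χ hlam, _root_.smul_apply, map_smul, smul_comm]

lemma matAct_inl {ι : Type*} (M : Matrix (ι ⊕ Fin n₂) (Fin n₁ ⊕ Fin n₂) ℝ)
    (T : Fin n₁ ⊕ Fin n₂ → 𝓢'(EuclideanSpace ℝ (Fin d), ℂ)) (j : ι) :
    matAct M T (Sum.inl j) = matAct M.toBlocks₁₁ (fun k => T (Sum.inl k)) j +
      matAct M.toBlocks₁₂ (fun k => T (Sum.inr k)) j :=
  Fintype.sum_sum_type _

lemma matAct_inr {ι : Type*} (M : Matrix (Fin n₁ ⊕ ι) (Fin n₁ ⊕ Fin n₂) ℝ)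
    (T : Fin n₁ ⊕ Fin n₂ → 𝓢'(EuclideanSpace ℝ (Fin d), ℂ)) (j : ι) :
    matAct M T (Sum.inr j) = matAct M.toBlocks₂₁ (fun k => T (Sum.inl k)) j +
      matAct M.toBlocks₂₂ (fun k => T (Sum.inr k)) j :=
  Fintype.sum_sum_type _

lemma matAct_zero {ι κ : Type*} [Fintype κ] (T : κ → 𝓢'(EuclideanSpace ℝ (Fin d), ℂ)) (j : ι) :
    matAct (0 : Matrix ι κ ℝ) T j = 0 := by
  refine Finset.sum_eq_zero fun k _ => ?_
  rw [Matrix.zero_apply, Complex.ofReal_zero]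
  exact zero_smul ℂ (T k)

/-! ### The parabolic profiles -/

variable {A : Fin d → Matrix (Fin n₁ ⊕ Fin n₂) (Fin n₁ ⊕ Fin n₂) ℝ}
  {D : Matrix (Fin n₂) (Fin n₂) ℝ}

lemma exp_map_ofReal (M : Matrix (Fin n) (Fin n) ℝ) :
    (NormedSpace.exp M).map Complex.ofReal = NormedSpace.exp (M.map Complex.ofReal) := by
  have hc : Continuous (Complex.ofRealHom.mapMatrix (m := Fin n)) :=
    continuous_id.matrix_map Complex.continuous_ofReal
  open scoped Matrix.Norms.L2Operator in
  let _ : NormedAlgebra ℚ (Matrix (Fin n) (Fin n) ℝ) := NormedAlgebra.restrictScalars ℚ ℝ _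
  open scoped Matrix.Norms.L2Operator in
  let _ : NormedAlgebra ℚ (Matrix (Fin n) (Fin n) ℂ) := NormedAlgebra.restrictScalars ℚ ℂ _
  open scoped Matrix.Norms.L2Operator in
  exact NormedSpace.map_exp (Complex.ofRealHom.mapMatrix (m := Fin n)) hc M

/-- After rescaling, the symbol of `e^{t𝒜}` is the restriction of an entire symbol. -/
lemma exp_diffusionSymbol_eq {lam : ℝ} (hlam : 0 < lam) (t : ℝ) (ξ : EuclideanSpace ℝ (Fin d))
    (j k : Fin n₁) :
    ((NormedSpace.exp (t • diffusionSymbol A D ξ) j k : ℝ) : ℂ) =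
      Entire.eval (complexify d ((2 * Real.pi / lam) • ξ))
        (expSymbol (lam ^ 2 * t) (parabolicSymbol A D) j k) := by
  have hlam' : (lam : ℂ) ≠ 0 := by exact_mod_cast hlam.ne'
  rw [eval_expSymbol]
  have h1 := congrFun (congrFun (exp_map_ofReal (t • diffusionSymbol A D ξ)) j) k
  rw [Matrix.map_apply] at h1
  have h2 : (t • diffusionSymbol A D ξ).map Complex.ofReal = ((lam ^ 2 * t : ℝ) : ℂ) •
      (parabolicSymbol A D).map (Entire.eval (complexify d ((2 * Real.pi / lam) • ξ))) := by
    ext j k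
    rw [Matrix.smul_apply, parabolicSymbol_map_eval, Matrix.map_apply, Matrix.smul_apply,
      diffusionSymbol, Matrix.neg_apply]
    simp only [Matrix.sum_apply, Matrix.smul_apply, smul_eq_mul, Complex.ofReal_mul,
      Complex.ofReal_neg, Complex.ofReal_sum, complexify_apply, PiLp.smul_apply, mul_neg,
      Finset.mul_sum]
    congr 1
    refine Finset.sum_congr rfl fun i _ => Finset.sum_congr rfl fun l _ => ?_
    push_cast
    field_simp
  rw [h1, h2]

/-- The symbol of `e^{t𝒜}` has temperate growth, so that `fourierMultiplierCLM` has its intended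
meaning in `diffusionSemigroup`. The entire extension of the symbol is bounded on the balls of
radius `1 / (1 + ‖u‖)` around the real points `u`, where the quadratic exponent changes by `O(1)`. -/
lemma hasTemperateGrowth_exp_diffusionSymbol (hAD : IsAdmissible A D) {t : ℝ} (ht : 0 ≤ t)
    (j k : Fin n₁) :
    Function.HasTemperateGrowth fun ξ : EuclideanSpace ℝ (Fin d) =>
      ((NormedSpace.exp (t • diffusionSymbol A D ξ) j k : ℝ) : ℂ) := by
  obtain ⟨c, hc, K, hK, h⟩ := exists_re_inner_parabolicSymbol_le hAD
  simp_rw [exp_diffusionSymbol_eq one_pos]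
  refine hasTemperateGrowth_comp_smul (g := fun u => Entire.eval (complexify d u)
    (expSymbol (1 ^ 2 * t) (parabolicSymbol A D) j k)) ?_ _
  refine hasTemperateGrowth_of_bounded
    (h := fun z => Entire.eval z (expSymbol (1 ^ 2 * t) (parabolicSymbol A D) j k))
    (Entire.contDiff (expSymbol (1 ^ 2 * t) (parabolicSymbol A D) j k)) (B := Real.exp (t * (K *
      3)))
    fun u z hz => ?_
  rw [eval_expSymbol]
  refine norm_exp_entry_le _ (fun x => ?_) j k
  rw [mem_ball_iff_norm] at hz
  have h1 := h u z _ hz.le x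
  have hr : 1 / (1 + ‖u‖) * (2 * ‖u‖ + 1 / (1 + ‖u‖)) ≤ 3 := by
    have h2 : 1 / (1 + ‖u‖) ≤ 1 := by
      rw [div_le_one (by positivity)]
      linarith [norm_nonneg u]
    have h3 : 1 / (1 + ‖u‖) * ‖u‖ ≤ 1 := by
      rw [one_div, inv_mul_le_iff₀ (by positivity)]
      linarith
    have h4 : 0 ≤ 1 / (1 + ‖u‖) := by positivity
    nlinarith
  rw [map_smul, _root_.smul_apply, inner_smul_right, Complex.re_ofReal_mul, one_pow, one_mul,
    mul_assoc]
  refine mul_le_mul_of_nonneg_left (h1.trans ?_) ht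
  refine mul_le_mul_of_nonneg_right ?_ (sq_nonneg _)
  have h5 := mul_le_mul_of_nonneg_left hr hK
  have h6 : 0 ≤ c * ‖u‖ ^ 2 := by positivity
  linarith

/-- On localised functions `e^{t𝒜}` is the exponential of a bounded operator. -/
lemma diffusionSemigroup_toDistVec (hAD : IsAdmissible A D) {lam : ℝ} (hlam : 0 < lam) {t : ℝ}
    (ht : 0 ≤ t) (w : Fin n₁ → Localised hp χ (2 * Real.pi / lam)) :
    diffusionSemigroup A D t (toDistVec hp χ _ w) = toDistVec hp χ _
      (NormedSpace.exp ((lam ^ 2 * t) • matOp hp χ _ (parabolicSymbol A D)) w) := by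
  funext j
  rw [exp_smul_matOp, toDistVec, matOp_apply, map_sum]
  refine Finset.sum_congr rfl fun k _ => ?_
  rw [toDist_apply, toTemperedDistribution_symOp hp χ _
    (hasTemperateGrowth_exp_diffusionSymbol hAD ht j k)
    (fun ξ => exp_diffusionSymbol_eq hlam t ξ j k)]
  rfl

/-- The distribution `Ψ₀` is given by `V₁(0) - lam b D⁻¹ V₂(0)`. -/
lemma effectiveDatum_eq {lam : ℝ} (hlam : 0 < lam)
    (w₁ : Fin n₁ → Localised hp χ (2 * Real.pi / lam))
    (w₂ : Fin n₂ → Localised hp χ (2 * Real.pi / lam))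
    {T : Fin n₁ ⊕ Fin n₂ → 𝓢'(EuclideanSpace ℝ (Fin d), ℂ)}
    (hT₁ : ∀ j, T (Sum.inl j) = toDist hp χ _ (w₁ j))
    (hT₂ : ∀ j, T (Sum.inr j) = toDist hp χ _ (w₂ j)) :
    effectiveDatum A D T = toDistVec hp χ _ (w₁ - lam • matOp hp χ _
      (gradSymbol fun i => (A i).toBlocks₁₂) (matOp hp χ _ (constSymbol d D⁻¹) w₂)) := by
  funext j
  rw [effectiveDatum, toDistVec, Pi.sub_apply, map_sub, hT₁, ← ContinuousLinearMap.comp_apply,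
    ← matOp_mul, gradSymbol_mul_constSymbol, Pi.smul_apply, toDist_matOp_gradSymbol hp χ hlam]
  simp only [hT₂]
  rfl

end

section

/-! ### From distributional to strong solutions -/

/-- A curve whose weak derivative is a continuous curve is differentiable. Weak derivatives are
tested against a family of functionals that separates points. -/
lemma hasDerivAt_of_weak {E ι : Type*} [NormedAddCommGroup E] [NormedSpace ℝ E] [CompleteSpace E]
    (ℓ : ι → E →L[ℝ] ℂ) (hℓ : ∀ x, (∀ i, ℓ i x = 0) → x = 0) {F G : ℝ → E} (hG : Continuous G)
    (h : ∀ i, ∀ t > 0, HasDerivAt (fun s => ℓ i (F s)) (ℓ i (G t)) t) {t : ℝ} (ht : 0 < t) :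
    HasDerivAt F (G t) t := by
  have key : ∀ r > 0, F r = F t + ∫ τ in t..r, G τ := by
    intro r hr
    rw [← sub_eq_zero]
    refine hℓ _ fun i => ?_
    rw [map_sub, map_add, ← ContinuousLinearMap.intervalIntegral_comp_comm _
      (hG.intervalIntegrable _ _), intervalIntegral.integral_eq_sub_of_hasDerivAt
      (f := fun s => ℓ i (F s)) (fun τ hτ => h i τ ?_)
      (((ℓ i).continuous.comp hG).intervalIntegrable _ _)]
    · ring
    · exact (lt_min ht hr).trans_le hτ.1
  have h1 : HasDerivAt (fun r => F t + ∫ τ in t..r, G τ) (G t) t :=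
    (intervalIntegral.integral_hasDerivAt_right (hG.intervalIntegrable _ _)
      (hG.stronglyMeasurableAtFilter _ _) hG.continuousAt).const_add _
  refine h1.congr_of_eventuallyEq ?_
  filter_upwards [lt_mem_nhds ht] with r hr
  exact key r hr

variable {d n n₁ n₂ : ℕ} {p : ℝ≥0∞} [Fact (1 ≤ p)] (hp : p ≠ ∞) (χ : Cutoff d) (s : ℝ)

/-- Testing one component of a vector of localised functions. -/
def testVec (i : 𝓢(EuclideanSpace ℝ (Fin d), ℂ) × Fin n) : (Fin n → Localised hp χ s) →L[ℝ] ℂ :=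
  ((testCLM p i.1 ∘L incl hp χ s).restrictScalars ℝ) ∘L ContinuousLinearMap.proj i.2

lemma testVec_apply (i : 𝓢(EuclideanSpace ℝ (Fin d), ℂ) × Fin n) (w : Fin n → Localised hp χ s) :
    testVec hp χ s i w = toDist hp χ s (w i.2) i.1 := rfl

lemma eq_zero_of_testVec (w : Fin n → Localised hp χ s) (h : ∀ i, testVec hp χ s i w = 0) :
    w = 0 := by
  funext k
  refine incl_injective hp χ s (eq_of_testCLM_eq fun φ => ?_)
  rw [Pi.zero_apply, map_zero, map_zero]
  exact h (φ, k)

variable {A : Fin d → Matrix (Fin n₁ ⊕ Fin n₂) (Fin n₁ ⊕ Fin n₂) ℝ}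
  {D : Matrix (Fin n₂) (Fin n₂) ℝ}

/-- Localised representatives of the components of a solution satisfy the rescaled system
`V₁' = -λ b V₂`, `V₂' = -λ c V₁ - D V₂ - λ e V₂` with bounded operators `b`, `c`, `e`. -/
lemma hasDerivAt_localised (hAD : IsAdmissible A D) {lam : ℝ} (hlam : 0 < lam)
    {V : ℝ → Fin n₁ ⊕ Fin n₂ → LpRd d p} (hV : IsGlobalSolution A (relaxation D) V)
    {W₁ : ℝ → Fin n₁ → Localised hp χ (2 * Real.pi / lam)}
    {W₂ : ℝ → Fin n₂ → Localised hp χ (2 * Real.pi / lam)}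
    (hW₁ : Continuous W₁) (hW₂ : Continuous W₂)
    (h₁ : ∀ t, 0 ≤ t → ∀ j, incl hp χ _ (W₁ t j) = V t (Sum.inl j))
    (h₂ : ∀ t, 0 ≤ t → ∀ j, incl hp χ _ (W₂ t j) = V t (Sum.inr j)) {t : ℝ} (ht : 0 < t) :
    HasDerivAt W₁ (-(lam • matOp hp χ _ (gradSymbol fun i => (A i).toBlocks₁₂) (W₂ t))) t ∧
    HasDerivAt W₂ (-(lam • matOp hp χ _ (gradSymbol fun i => (A i).toBlocks₂₁) (W₁ t))
      - matOp hp χ _ (constSymbol d D) (W₂ t)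
      - lam • matOp hp χ _ (gradSymbol fun i => (A i).toBlocks₂₂) (W₂ t)) t := by
  have hT₁ : ∀ t, 0 ≤ t → ∀ j, toTD (V t) (Sum.inl j) = toDist hp χ _ (W₁ t j) := fun t ht j => by
    rw [toTD, ← h₁ t ht, toDist_apply]
  have hT₂ : ∀ t, 0 ≤ t → ∀ j, toTD (V t) (Sum.inr j) = toDist hp χ _ (W₂ t j) := fun t ht j => by
    rw [toTD, ← h₂ t ht, toDist_apply]
  constructor
  · refine hasDerivAt_of_weak (testVec hp χ _) (eq_zero_of_testVec hp χ _)
      (G := fun t => -(lam • matOp hp χ _ (gradSymbol fun i => (A i).toBlocks₁₂) (W₂ t)))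
      (((ContinuousLinearMap.continuous _).comp hW₂).const_smul lam).neg (fun i t ht => ?_) ht
    have h := hV.hasDerivAt i.1 (Sum.inl i.2) t ht
    refine (h.congr_of_eventuallyEq ?_).congr_deriv ?_
    · filter_upwards [lt_mem_nhds ht] with r hr
      rw [testVec_apply, hT₁ r hr.le]
    · rw [testVec_apply, Pi.neg_apply, map_neg, Pi.smul_apply, toDist_matOp_gradSymbol hp χ hlam]
      simp only [matAct_inl, hAD.block₁₁, relaxation, toBlocks_fromBlocks₁₁,
        toBlocks_fromBlocks₁₂, matAct_zero, zero_add, hT₂ t ht.le]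
      rw [_root_.neg_apply, _root_.sum_apply, _root_.zero_apply, sub_zero]
      rfl
  · refine hasDerivAt_of_weak (testVec hp χ _) (eq_zero_of_testVec hp χ _)
      (G := fun t => -(lam • matOp hp χ _ (gradSymbol fun i => (A i).toBlocks₂₁) (W₁ t))
        - matOp hp χ _ (constSymbol d D) (W₂ t)
        - lam • matOp hp χ _ (gradSymbol fun i => (A i).toBlocks₂₂) (W₂ t))
      (((((ContinuousLinearMap.continuous _).comp hW₁).const_smul lam).neg.sub
        ((ContinuousLinearMap.continuous _).comp hW₂)).sub
        (((ContinuousLinearMap.continuous _).comp hW₂).const_smul lam)) (fun i t ht => ?_) ht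
    have h := hV.hasDerivAt i.1 (Sum.inr i.2) t ht
    refine (h.congr_of_eventuallyEq ?_).congr_deriv ?_
    · filter_upwards [lt_mem_nhds ht] with r hr
      rw [testVec_apply, hT₂ r hr.le]
    · rw [testVec_apply, Pi.sub_apply, Pi.sub_apply, Pi.neg_apply, map_sub, map_sub, map_neg,
        Pi.smul_apply, Pi.smul_apply, toDist_matOp_gradSymbol hp χ hlam,
        toDist_matOp_gradSymbol hp χ hlam, toDist_matOp_constSymbol]
      simp only [matAct_inr, relaxation, toBlocks_fromBlocks₂₁,
        toBlocks_fromBlocks₂₂, matAct_zero, zero_add, hT₂ t ht.le, hT₁ t ht.le]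
      simp only [_root_.neg_apply, _root_.sum_apply, _root_.sub_apply, _root_.add_apply,
        Finset.sum_add_distrib]
      rw [neg_add, sub_eq_add_neg, sub_eq_add_neg, sub_eq_add_neg, add_right_comm]
      rfl

/-! ### Uniform bounds and comparison of norms -/

/-- The operator norm of a fixed matrix of symbols is bounded uniformly in the dilation. -/
lemma exists_norm_matOp_le_forall (H : Matrix (Fin n₁) (Fin n₂) (Entire d)) :
    ∃ B : ℝ, 0 ≤ B ∧ ∀ s, ‖matOp hp χ s H‖ ≤ B := by
  obtain ⟨C, hC0, hC⟩ := exists_norm_matOp_le hp χ (m := Fin n₁) (n := Fin n₂) one_pos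
  obtain ⟨B, hB0, hB⟩ := χ.exists_bound
    (f := fun z => ∑ j, ∑ k, ‖Entire.eval z (H j k)‖)
    (continuous_finsetSum _ fun j _ => continuous_finsetSum _ fun k _ =>
      (Entire.contDiff (H j k)).continuous.norm) 1
  refine ⟨C * B, mul_nonneg hC0 hB0, fun s => hC s H B hB0 fun u hu z hz j k => ?_⟩
  refine le_trans ?_ (hB u hu z hz)
  calc ‖Entire.eval z (H j k)‖ ≤ ∑ k, ‖Entire.eval z (H j k)‖ :=
        Finset.single_le_sum (f := fun k => ‖Entire.eval z (H j k)‖)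
          (fun _ _ => norm_nonneg _) (Finset.mem_univ k)
    _ ≤ _ := Finset.single_le_sum (f := fun j => ∑ k, ‖Entire.eval z (H j k)‖)
          (fun _ _ => Finset.sum_nonneg fun _ _ => norm_nonneg _) (Finset.mem_univ j)

lemma vecNorm_incl_le (w : Fin n → Localised hp χ s) :
    vecNorm (fun j => incl hp χ s (w j)) ≤ n * ‖w‖ := by
  refine (Finset.sum_le_card_nsmul _ _ ‖w‖ fun j _ => norm_le_pi_norm w j).trans (le_of_eq ?_)
  simp

lemma norm_le_vecNorm_incl (w : Fin n → Localised hp χ s) :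
    ‖w‖ ≤ vecNorm (fun j => incl hp χ s (w j)) := by
  refine (pi_norm_le_iff_of_nonneg (Finset.sum_nonneg fun _ _ => norm_nonneg _)).2 fun j => ?_
  exact Finset.single_le_sum (f := fun j => ‖incl hp χ s (w j)‖)
    (fun _ _ => norm_nonneg _) (Finset.mem_univ j)

end

section

/-! ### Uniform decay and the conclusion -/

variable {d n₁ n₂ : ℕ} {A : Fin d → Matrix (Fin n₁ ⊕ Fin n₂) (Fin n₁ ⊕ Fin n₂) ℝ}
  {D : Matrix (Fin n₂) (Fin n₂) ℝ}

/-- The operators of the rescaled system are bounded, and the two semigroups decay, uniformly in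
the dilation parameter. -/
lemma exists_uniform_bounds (hAD : IsAdmissible A D) {p : ℝ≥0∞} [Fact (1 ≤ p)] (hp : p ≠ ∞)
    {a₁ a₂ : ℝ} (ha₁ : 0 < a₁) (ha₂ : a₁ < a₂) {χ : Cutoff d}
    (hχ : ∀ u ∈ tsupport χ.toFun, a₁ / 2 ≤ ‖u‖ ∧ ‖u‖ ≤ 2 * a₂) :
    ∃ M r κ : ℝ, 1 ≤ M ∧ 0 < r ∧ 0 < κ ∧ ∀ s : ℝ,
      ‖matOp hp χ s (gradSymbol fun i => (A i).toBlocks₁₂)‖ ≤ M ∧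
      ‖matOp hp χ s (gradSymbol fun i => (A i).toBlocks₂₁)‖ ≤ M ∧
      ‖matOp hp χ s (gradSymbol fun i => (A i).toBlocks₂₂)‖ ≤ M ∧
      ‖matOp hp χ s (constSymbol d D⁻¹)‖ ≤ M ∧
      (∀ t : ℝ, 0 ≤ t → ‖NormedSpace.exp (t • (-matOp hp χ s (constSymbol d D)))‖ ≤
        M * Real.exp (-(κ * t))) ∧
      (∀ t : ℝ, 0 ≤ t → ‖NormedSpace.exp (t • matOp hp χ s (parabolicSymbol A D))‖ ≤
        M * Real.exp (-(r * t))) := by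
  obtain ⟨c, hc, K, hK, hpar⟩ := exists_re_inner_parabolicSymbol_le hAD
  obtain ⟨κ, hκ, hD⟩ := exists_posDef_le hAD.posDef
  have ha₂' : 0 < a₂ := ha₁.trans ha₂
  -- the radius for which the perturbation costs at most half of the coercivity
  obtain ⟨δ, hδ, hδK⟩ : ∃ δ > 0, K * (δ * (2 * (2 * a₂) + δ)) ≤ c * a₁ ^ 2 / 8 := by
    have hcont : Filter.Tendsto (fun δ : ℝ => K * (δ * (2 * (2 * a₂) + δ))) (nhdsWithin 0
      (Set.Ioi 0))
        (nhds (K * (0 * (2 * (2 * a₂) + 0)))) :=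
      ((by fun_prop : Continuous fun δ : ℝ => K * (δ * (2 * (2 * a₂) + δ))).tendsto 0).mono_left
        nhdsWithin_le_nhds
    have hpos : K * (0 * (2 * (2 * a₂) + 0)) < c * a₁ ^ 2 / 8 := by
      rw [zero_mul, mul_zero]
      positivity
    obtain ⟨δ, h1, h2⟩ := ((hcont.eventually (gt_mem_nhds hpos)).and self_mem_nhdsWithin).exists
    exact ⟨δ, h2, h1.le⟩
  obtain ⟨C₁, hC₁0, hC₁⟩ := exists_norm_exp_matOp_le hp χ (n := n₁) hδ
  obtain ⟨C₂, hC₂0, hC₂⟩ := exists_norm_exp_matOp_le hp χ (n := n₂) one_pos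
  obtain ⟨B₁, hB₁0, hB₁⟩ := exists_norm_matOp_le_forall hp χ
    (gradSymbol fun i => (A i).toBlocks₁₂)
  obtain ⟨B₂, hB₂0, hB₂⟩ := exists_norm_matOp_le_forall hp χ
    (gradSymbol fun i => (A i).toBlocks₂₁)
  obtain ⟨B₃, hB₃0, hB₃⟩ := exists_norm_matOp_le_forall hp χ
    (gradSymbol fun i => (A i).toBlocks₂₂)
  obtain ⟨B₄, hB₄0, hB₄⟩ := exists_norm_matOp_le_forall hp χ (constSymbol d D⁻¹)
  refine ⟨1 + C₁ + C₂ + B₁ + B₂ + B₃ + B₄, c * a₁ ^ 2 / 8, κ, by linarith, by positivity, hκ,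
    fun s => ⟨(hB₁ s).trans (by linarith), (hB₂ s).trans (by linarith),
      (hB₃ s).trans (by linarith), (hB₄ s).trans (by linarith), fun t ht => ?_, fun t ht => ?_⟩⟩
  · have hneg : -matOp hp χ s (constSymbol d D) = matOp hp χ s (-constSymbol d D) :=
      (map_neg (matHom hp χ s) _).symm
    rw [hneg]
    have h := hC₂ s (-κ) (-constSymbol d D) (fun u _ z _ x => by
      have h0 : (-constSymbol d D).map (Entire.eval z) = -D.map Complex.ofReal := by
        rw [← constSymbol_map_eval D z]
        ext j k
        simp
      rw [h0, map_neg, _root_.neg_apply, inner_neg_right, Complex.neg_re, neg_mul]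
      exact neg_le_neg (le_re_inner_of_real D hD x)) t ht
    refine h.trans ?_
    rw [mul_neg, mul_comm t κ]
    exact mul_le_mul_of_nonneg_right (by linarith) (Real.exp_pos _).le
  · have h := hC₁ s (-(c * a₁ ^ 2 / 8)) (parabolicSymbol A D) (fun u hu z hz x => by
      rw [mem_ball_iff_norm] at hz
      refine (hpar u z δ hz.le x).trans (mul_le_mul_of_nonneg_right ?_ (sq_nonneg _))
      obtain ⟨hu₁, hu₂⟩ := hχ u hu
      have h1 : K * (δ * (2 * ‖u‖ + δ)) ≤ K * (δ * (2 * (2 * a₂) + δ)) := by gcongr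
      have h2 : c * (a₁ / 2) ^ 2 ≤ c * ‖u‖ ^ 2 := by gcongr
      linarith) t ht
    refine h.trans ?_
    rw [mul_neg, mul_comm t]
    exact mul_le_mul_of_nonneg_right (by linarith) (Real.exp_pos _).le

/-- The bounds for the two blocks imply the bound for the whole vector, since `E₂ ≤ E₁`. -/
lemma add_le_of_block_bounds {lam E₁ E₂ N₁ N₂ K y₁ y₂ : ℝ} (hlam : 0 ≤ lam) (hlam1 : lam ≤ 1)
    (hE₂ : 0 ≤ E₂)
    (hE : E₂ ≤ E₁) (hN₁ : 0 ≤ N₁) (hN₂ : 0 ≤ N₂) (hK : 0 ≤ K)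
    (h₁ : 4 * y₁ ≤ K * E₁ * (N₁ + lam * N₂) + K * E₂ * (lam ^ 2 * N₁ + lam * N₂))
    (h₂ : 4 * y₂ ≤ K * (lam * E₁) * (N₁ + lam * N₂) + K * E₂ * (lam * N₁ + 1 * N₂)) :
    y₁ + y₂ ≤ K * E₁ * (N₁ + N₂) := by
  have hE₁ : 0 ≤ E₁ := hE₂.trans hE
  have b1 : N₁ + lam * N₂ ≤ N₁ + N₂ := by nlinarith
  have b2 : lam ^ 2 * N₁ + lam * N₂ ≤ N₁ + N₂ :=
    add_le_add (mul_le_of_le_one_left hN₁ (pow_le_one₀ hlam hlam1))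
      (mul_le_of_le_one_left hN₂ hlam1)
  have b3 : lam * N₁ + 1 * N₂ ≤ N₁ + N₂ := by nlinarith
  have c1 : K * E₁ * (N₁ + lam * N₂) ≤ K * E₁ * (N₁ + N₂) := by gcongr
  have c2 : K * E₂ * (lam ^ 2 * N₁ + lam * N₂) ≤ K * E₁ * (N₁ + N₂) := by gcongr
  have c3 : K * (lam * E₁) * (N₁ + lam * N₂) ≤ K * E₁ * (N₁ + N₂) := by
    have : lam * E₁ ≤ E₁ := mul_le_of_le_one_left hE₁ hlam1
    gcongr
  have c4 : K * E₂ * (lam * N₁ + 1 * N₂) ≤ K * E₁ * (N₁ + N₂) := by gcongr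
  linarith

/-- Passing from the maximum to the sum of the norms of the components in a bound for one block. -/
lemma bound_of_sup_bound {C N a b c e S₁ S₂ N₁ N₂ x y : ℝ} (hC : 0 ≤ C) (hN : 0 ≤ N) (ha : 0 ≤ a)
    (hb : 0 ≤ b) (hc : 0 ≤ c) (he : 0 ≤ e) {lam : ℝ} (hlam : 0 ≤ lam)
    (hS₁ : S₁ ≤ N₁) (hS₂ : S₂ ≤ N₂) (hNy : y ≤ N * x)
    (hx : x ≤ C * a * (S₁ + lam * S₂) + C * b * (c * S₁ + e * S₂)) :
    4 * y ≤ 4 * (N * C) * a * (N₁ + lam * N₂) + 4 * (N * C) * b * (c * N₁ + e * N₂) := by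
  have h1 : C * a * (S₁ + lam * S₂) ≤ C * a * (N₁ + lam * N₂) := by gcongr
  have h2 : C * b * (c * S₁ + e * S₂) ≤ C * b * (c * N₁ + e * N₂) := by gcongr
  have h3 := mul_le_mul_of_nonneg_left (hx.trans (add_le_add h1 h2)) hN
  linarith

end

end PartialDissipation

end

open PartialDissipation in
theorem proposition3p2 {d n₁ n₂ : ℕ}
    (A : Fin d → Matrix (Fin n₁ ⊕ Fin n₂) (Fin n₁ ⊕ Fin n₂) ℝ)
    (D : Matrix (Fin n₂) (Fin n₂) ℝ) (hAD : PartialDissipation.IsAdmissible A D)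
    (p : ℝ≥0∞) [Fact (1 ≤ p)] (hp₁ : 1 < p) (hp : p < ∞)
    (a₁ a₂ : ℝ) (ha₁ : 0 < a₁) (ha₂ : a₁ < a₂) :
    ∃ lam₀ > (0 : ℝ), ∃ C₁ > (0 : ℝ), ∃ R₁ > (0 : ℝ), ∃ κ₁ > (0 : ℝ),
      ∀ lam : ℝ, 0 < lam → lam < lam₀ →
      ∀ V : ℝ → Fin n₁ ⊕ Fin n₂ → Lp ℂ p (volume : Measure (EuclideanSpace ℝ (Fin d))),
        PartialDissipation.IsGlobalSolution A (PartialDissipation.relaxation D) V →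
        (∀ t : ℝ, 0 ≤ t → PartialDissipation.FourierSupportedIn (PartialDissipation.toTD (V t))
          (PartialDissipation.dilatedAnnulus d a₁ a₂ lam)) →
        ∀ N₁ N₂ : ℝ,
          N₁ = PartialDissipation.vecNorm (fun j => V 0 (Sum.inl j)) →
          N₂ = PartialDissipation.vecNorm (fun j => V 0 (Sum.inr j)) →
          ∀ t : ℝ, 0 ≤ t →
            PartialDissipation.vecNorm (V t)
              ≤ C₁ * Real.exp (-(R₁ * lam ^ 2 * t)) * PartialDissipation.vecNorm (V 0) ∧
            PartialDissipation.vecNorm (fun j => V t (Sum.inl j))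
              ≤ C₁ * Real.exp (-(R₁ * lam ^ 2 * t)) * (N₁ + lam * N₂)
                + C₁ * Real.exp (-(κ₁ * t)) * (lam ^ 2 * N₁ + lam * N₂) ∧
            PartialDissipation.vecNorm (fun j => V t (Sum.inr j))
              ≤ C₁ * lam * Real.exp (-(R₁ * lam ^ 2 * t)) * (N₁ + lam * N₂)
                + C₁ * Real.exp (-(κ₁ * t)) * (lam * N₁ + N₂) ∧
            PartialDissipation.HasLpNormLE p
              (fun j => PartialDissipation.toTD (V t) (Sum.inl j)
                - PartialDissipation.profile₁ A D (PartialDissipation.toTD (V 0)) t j)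
              (C₁ * lam * Real.exp (-(R₁ * lam ^ 2 * t)) * (N₁ + lam * N₂)
                + C₁ * Real.exp (-(κ₁ * t)) * (lam ^ 2 * N₁ + lam * N₂)) ∧
            PartialDissipation.HasLpNormLE p
              (fun j => PartialDissipation.toTD (V t) (Sum.inr j)
                - PartialDissipation.profile₂ A D (PartialDissipation.toTD (V 0)) t j)
              (C₁ * lam ^ 2 * Real.exp (-(R₁ * lam ^ 2 * t)) * (N₁ + lam * N₂)
                + C₁ * Real.exp (-(κ₁ * t)) * (lam * N₁ + N₂)) := by
  obtain ⟨χ, hχ1, hχ2⟩ := exists_cutoff d ha₁ ha₂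
  obtain ⟨M, r, κ, hM, hr, hκ, hbounds⟩ := exists_uniform_bounds hAD hp.ne ha₁ ha₂ hχ2
  obtain ⟨lam₀, hlam₀, C, hC, R, hR, κ', hκ', hlam₀1, hRκ, hmain⟩ :=
    exists_relaxation_estimates hM hr hκ
  -- `N` accounts for passing between the maximum and the sum of the component norms; the factor
  -- `4` in the constant pays for the four terms in the bound for the whole vector
  obtain ⟨N, hN⟩ : ∃ N : ℝ, N = n₁ + n₂ + 1 := ⟨_, rfl⟩
  have hNpos : 0 < N := by rw [hN]; positivity
  have hNn₁ : (n₁ : ℝ) ≤ N := by rw [hN]; linarith [(Nat.cast_nonneg n₂ : (0 : ℝ) ≤ n₂)]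
  have hNn₂ : (n₂ : ℝ) ≤ N := by rw [hN]; linarith [(Nat.cast_nonneg n₁ : (0 : ℝ) ≤ n₁)]
  refine ⟨lam₀, hlam₀, 4 * (N * C), by positivity, R, hR, κ', hκ', ?_⟩
  intro lam hlam hlamlt V hV hsupp N₁ N₂ hN₁ hN₂ t ht
  have hlam1 : lam ≤ 1 := hlamlt.le.trans hlam₀1
  obtain ⟨hb, hc, he, hDi, hexpD, hexpQ⟩ := hbounds (2 * Real.pi / lam)
  -- representatives; for negative times the initial value is used
  have hex : ∀ (t : ℝ) (j : Fin n₁ ⊕ Fin n₂), ∃ w, incl hp.ne χ (2 * Real.pi / lam) w =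
      V (max t 0) j := fun t j =>
    exists_incl_eq_of_dsupport hp.ne χ hlam hχ1 (hsupp (max t 0) (le_max_right _ _) j)
  choose W hW using hex
  have hWt : ∀ t, 0 ≤ t → ∀ j, incl hp.ne χ _ (W t j) = V t j := fun t ht j => by
    rw [hW, max_eq_left ht]
  have hVc : Continuous fun t => V (max t 0) :=
    hV.continuousOn.comp_continuous (by fun_prop) fun t => Set.mem_Ici.2 (le_max_right _ _)
  have hisom : Isometry (incl hp.ne χ (2 * Real.pi / lam)) :=
    AddMonoidHomClass.isometry_of_norm _ (norm_incl hp.ne χ _)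
  have hWc : ∀ j, Continuous fun t => W t j := fun j => by
    rw [hisom.isEmbedding.continuous_iff]
    simp only [Function.comp_def, hW]
    exact (continuous_apply j).comp hVc
  obtain ⟨W₁, hW₁⟩ : ∃ W₁ : ℝ → Fin n₁ → Localised hp.ne χ (2 * Real.pi / lam),
    W₁ = fun t j => W t (Sum.inl j) := ⟨_, rfl⟩
  obtain ⟨W₂, hW₂⟩ : ∃ W₂ : ℝ → Fin n₂ → Localised hp.ne χ (2 * Real.pi / lam),
    W₂ = fun t j => W t (Sum.inr j) := ⟨_, rfl⟩
  have hW₁c : Continuous W₁ := by rw [hW₁]; exact continuous_pi fun j => hWc _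
  have hW₂c : Continuous W₂ := by rw [hW₂]; exact continuous_pi fun j => hWc _
  have hV₁ : ∀ t, 0 ≤ t → ∀ j, incl hp.ne χ _ (W₁ t j) = V t (Sum.inl j) := fun t ht j => by
    rw [hW₁, hWt t ht]
  have hV₂ : ∀ t, 0 ≤ t → ∀ j, incl hp.ne χ _ (W₂ t j) = V t (Sum.inr j) := fun t ht j => by
    rw [hW₂, hWt t ht]
  have hode := fun t ht => hasDerivAt_localised hp.ne χ hAD hlam hV hW₁c hW₂c hV₁ hV₂ (t := t) ht
  have hDDi : ∀ x, matOp hp.ne χ (2 * Real.pi / lam) (constSymbol d D)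
      (matOp hp.ne χ _ (constSymbol d D⁻¹) x) = x := fun x => by
    rw [← ContinuousLinearMap.comp_apply, ← matOp_mul, constSymbol_mul,
      Matrix.mul_nonsing_inv _ ((Matrix.isUnit_iff_isUnit_det _).1 hAD.posDef.isUnit),
      constSymbol_one, matOp_one]
    rfl
  have hDiD : ∀ x, matOp hp.ne χ (2 * Real.pi / lam) (constSymbol d D⁻¹)
      (matOp hp.ne χ _ (constSymbol d D) x) = x := fun x => by
    rw [← ContinuousLinearMap.comp_apply, ← matOp_mul, constSymbol_mul,
      Matrix.nonsing_inv_mul _ ((Matrix.isUnit_iff_isUnit_det _).1 hAD.posDef.isUnit),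
      constSymbol_one, matOp_one]
    rfl
  have hQ : matOp hp.ne χ (2 * Real.pi / lam) (parabolicSymbol A D) =
      matOp hp.ne χ _ (gradSymbol fun i => (A i).toBlocks₁₂) ∘L
        matOp hp.ne χ _ (constSymbol d D⁻¹) ∘L
        matOp hp.ne χ _ (gradSymbol fun i => (A i).toBlocks₂₁) := by
    rw [parabolicSymbol, Matrix.mul_assoc, matOp_mul, matOp_mul]
  rw [hQ] at hexpQ
  have hest := hmain _ _ _ _ _ hb hc he hDi hDDi hDiD hexpD hexpQ lam hlam hlamlt W₁ W₂
    hW₁c.continuousOn hW₂c.continuousOn (fun t ht => (hode t ht).1) (fun t ht => (hode t ht).2) t ht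
  rw [← hQ] at hest
  obtain ⟨e₁, e₂, e₃, e₄⟩ := hest
  -- the rescaled slow profile `V_{1,*}(t)`
  obtain ⟨P, hP⟩ : ∃ P, P = NormedSpace.exp ((lam ^ 2 * t) • matOp hp.ne χ _ (parabolicSymbol A D))
      (W₁ 0 - lam • matOp hp.ne χ _ (gradSymbol fun i => (A i).toBlocks₁₂)
        (matOp hp.ne χ _ (constSymbol d D⁻¹) (W₂ 0))) := ⟨_, rfl⟩
  rw [← hP] at e₃ e₄
  have hS₁ : ‖W₁ 0‖ ≤ N₁ := by
    rw [hN₁]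
    simpa only [hV₁ 0 le_rfl] using norm_le_vecNorm_incl hp.ne χ _ (W₁ 0)
  have hS₂ : ‖W₂ 0‖ ≤ N₂ := by
    rw [hN₂]
    simpa only [hV₂ 0 le_rfl] using norm_le_vecNorm_incl hp.ne χ _ (W₂ 0)
  have hN₁0 : 0 ≤ N₁ := (norm_nonneg _).trans hS₁
  have hN₂0 : 0 ≤ N₂ := (norm_nonneg _).trans hS₂
  have hv₁ : ∀ w : Fin n₁ → Localised hp.ne χ (2 * Real.pi / lam),
      vecNorm (fun j => incl hp.ne χ _ (w j)) ≤ N * ‖w‖ := fun w =>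
    (vecNorm_incl_le hp.ne χ _ w).trans (by gcongr)
  have hv₂ : ∀ w : Fin n₂ → Localised hp.ne χ (2 * Real.pi / lam),
      vecNorm (fun j => incl hp.ne χ _ (w j)) ≤ N * ‖w‖ := fun w =>
    (vecNorm_incl_le hp.ne χ _ w).trans (by gcongr)
  have hnn : ∀ {n : ℕ} (w : Fin n → Localised hp.ne χ (2 * Real.pi / lam)),
      0 ≤ vecNorm (fun j => incl hp.ne χ _ (w j)) := fun w =>
    Finset.sum_nonneg fun _ _ => norm_nonneg _
  have hE₁ := (Real.exp_pos (-(R * lam ^ 2 * t))).le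
  have hE₂ := (Real.exp_pos (-(κ' * t))).le
  have f₁ := bound_of_sup_bound hC.le hNpos.le hE₁ hE₂ (sq_nonneg lam) hlam.le hlam.le hS₁ hS₂
    (hv₁ _) e₁
  have f₂ := bound_of_sup_bound (a := lam * _) (e := 1) hC.le hNpos.le (mul_nonneg hlam.le hE₁)
    hE₂ hlam.le
    zero_le_one hlam.le hS₁ hS₂ (hv₂ _) (e₂.trans_eq (by ring))
  have f₃ := bound_of_sup_bound (a := lam * _) hC.le hNpos.le (mul_nonneg hlam.le hE₁) hE₂
    (sq_nonneg lam)
    hlam.le hlam.le hS₁ hS₂ (hv₁ _) (e₃.trans_eq (by ring))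
  have f₄ := bound_of_sup_bound (a := lam ^ 2 * _) (e := 1) hC.le hNpos.le
    (mul_nonneg (sq_nonneg lam) hE₁) hE₂ hlam.le
    zero_le_one hlam.le hS₁ hS₂ (hv₂ _) (e₄.trans_eq (by ring))
  have hprof : profile₁ A D (toTD (V 0)) t = toDistVec hp.ne χ _ P := by
    rw [profile₁, effectiveDatum_eq hp.ne χ hlam (W₁ 0) (W₂ 0)
        (fun j => by rw [toTD, ← hV₁ 0 le_rfl, toDist_apply])
        (fun j => by rw [toTD, ← hV₂ 0 le_rfl, toDist_apply]),
      diffusionSemigroup_toDistVec hp.ne χ hAD hlam ht, hP]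
  refine ⟨?_, ?_, ?_, 
    ⟨fun j => incl hp.ne χ _ ((W₁ t - P) j), ?_, le_trans ?_ (f₃.trans_eq (by ring))⟩,
    ⟨fun j => incl hp.ne χ _ ((W₂ t + lam • matOp hp.ne χ _ (constSymbol d D⁻¹) (matOp hp.ne χ _
      (gradSymbol fun i => (A i).toBlocks₂₁) P)) j), ?_, le_trans ?_ (f₄.trans_eq (by ring))⟩⟩
  · have h0 : vecNorm (V 0) = N₁ + N₂ := by
      rw [hN₁, hN₂]
      exact Fintype.sum_sum_type _
    have h1 : vecNorm (V t) = vecNorm (fun j => incl hp.ne χ _ (W₁ t j)) +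
        vecNorm (fun j => incl hp.ne χ _ (W₂ t j)) := by
      simp only [hV₁ t ht, hV₂ t ht]
      exact Fintype.sum_sum_type _
    rw [h0, h1]
    refine add_le_of_block_bounds hlam.le hlam1 hE₂ (Real.exp_le_exp.2 (neg_le_neg ?_)) hN₁0 hN₂0
      (by positivity) f₁ f₂
    have : R * lam ^ 2 ≤ κ' := (mul_le_of_le_one_right hR.le (pow_le_one₀ hlam.le hlam1)).trans hRκ
    gcongr
  · have h := hnn (W₁ t)
    simp only [hV₁ t ht] at f₁ h
    linarith
  · have h := hnn (W₂ t)
    simp only [hV₂ t ht] at f₂ h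
    refine le_trans ?_ (f₂.trans_eq (by ring))
    linarith
  · funext j
    rw [hprof]
    change toDist hp.ne χ _ _ = _
    rw [Pi.sub_apply, map_sub]
    congr 1
    rw [toTD, ← hV₁ t ht, toDist_apply]
  · linarith [hnn (W₁ t - P)]
  · funext j
    change toDist hp.ne χ _ _ = _
    rw [profile₂, hprof, Pi.add_apply, map_add, ← ContinuousLinearMap.comp_apply, ← matOp_mul,
      constSymbol_mul_gradSymbol, Pi.smul_apply, toDist_matOp_gradSymbol hp.ne χ hlam,
        sub_neg_eq_add]
    congr 1
    rw [toTD, ← hV₂ t ht, toDist_apply]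
  · linarith [hnn (W₂ t + lam • matOp hp.ne χ _ (constSymbol d D⁻¹) (matOp hp.ne χ _
      (gradSymbol fun i => (A i).toBlocks₂₁) P))]
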